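/- All C*-algebras are complex and need not be unital; ideals are two-sided. For subsets of a C*-algebra write $\mathcal F\subset_\varepsilon\mathcal G$ if for every $a\in\mathcal F$ there is $b\in\mathcal G$ with $\|a-b\|<\varepsilon$. **Definitions.** A separable nonzero C*-algebra $D$ is *weakly semiprojective* if for every separable C*-algebra $B$, every increasing sequence of closed ideals $J_n$ of $B$ with $J=\overline{\bigcup_n J_n}$, every $*$-homomorphism $\varphi:D\to B/J$, every finite set $F\subset D$ and every $\varepsilon>0$ there are $n$ and a $*$-homomorphism $\psi:D\to B/J_n$ whose composition with $B/J_n\to B/J$ is within $\varepsilon$ of $\varphi$ at every $d\in F$. A sequence $(A_k)$ of C*-subalgebras of $A$ is *exhaustive* if for every finite $\mathcal F\subset A$ and $\varepsilon>0$ there is $k$ with $\mathcal F\subset_\varepsilon A_k$. Let $X$ be a compact Hausdorff space. A *$C(X)$-algebra* is a C*-algebra $A$ with a $*$-homomorphism from $C(X)$ to the center of the multiplier algebra of $A$ such that $C(X)A$ spans a dense subspace of $A$. For $Y\subseteq X$ closed, $A(Y)=A/C(X,Y)A$, where $C(X,Y)$ is the ideal of functions vanishing on $Y$; let $\pi_Y:A\to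 A(Y)$ and $\pi^Y_Z:A(Y)\to A(Z)$ ($Z\subseteq Y$ closed) be the quotient maps. The fiber of $A$ at $x$ is $A(x)=A(\{x\})$, and $A$ is *continuous* if $x\mapsto\|\pi_{\{x\}}(a)\|$ is continuous for all $a\in A$. Let $\mathcal C$ be a class of C*-algebras. A $C(Z)$-algebra $E$ is *$\mathcal C$-elementary* if there are a partition of $Z$ into nonempty closed sets $Z_1,\dots,Z_r$ ($r\ge1$) and $D_1,\dots,D_r\in\mathcal C$ with $E\cong\bigoplus_{j=1}^r C(Z_j)\otimes D_j$ as $C(Z)$-algebras. An *$n$-fibered $\mathcal C$-monomorphism* $(\psi_0,\dots,\psi_n)$ into $A$ consists of a closed cover $Y_0,\dots,Y_n$ of $X$, $\mathcal C$-elementary $C(Y_i)$-algebras $E_i$, and injective $C(X)$-linear $*$-homomorphisms $\psi_i:E_i\to A(Y_i)$ such that $$\pi^{Y_i}_{Y_i\cap Y_j}\psi_i(E_i)\subseteq\pi^{Y_j}_{Y_i\cap Y_j}\psi_j(E_j)\qquad\text{for all } i\le j.$$ Its *fibered product* is $$A(\psi_0,\dots,\psi_n)=\Big\{(d_0,\dots,d_n)\in\prod_i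 E_i:\ \pi^{Y_i}_{Y_i\cap Y_j}\psi_i(d_i)=\pi^{Y_j}_{Y_i\cap Y_j}\psi_j(d_j)\ \text{for all } i,j\Big\},$$ and the *induced map* $\eta:A(\psi_0,\dots,\psi_n)\to A$ is the $*$-homomorphism determined by $\pi_{Y_i}(\eta(d_0,\dots,d_n))=\psi_i(d_i)$ for all $i$. **Theorem.** Let $\mathcal C$ be a class of C*-algebras each of which is isomorphic to a finite direct sum of weakly semiprojective simple C*-algebras. Let $X$ be a nonempty compact metrizable space of finite covering dimension, and let $A$ be a separable continuous $C(X)$-algebra each of whose fibers admits an exhaustive sequence of C*-subalgebras isomorphic to C*-algebras in $\mathcal C$. Then for every finite set $\mathcal F\subset A$ and every $\varepsilon>0$ there exist an integer $0\le n\le\dim(X)$ and an $n$-fibered $\mathcal C$-monomorphism $(\psi_0,\dots,\psi_n)$ into $A$ for which the induced map $\eta:A(\psi_0,\dots,\psi_n)\to A$ exists, is injective and $C(X)$-linear, and satisfies $\mathcal F\subset_\varepsilon\eta\big(A(\psi_0,\dots,\psi_n)\big)$. -/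

import Mathlib

open Set Filter Topology TopologicalSpace

universe u v

noncomputable section

namespace CStarBundle

/-! ### Covering dimension -/

/-- The covering dimension of `X` is at most `n`: every finite open cover of `X` has a finite open
refinement such that no point lies in more than `n + 1` of its members. -/
def HasCoveringDimLE (X : Type v) [TopologicalSpace X] (n : ℕ) : Prop :=
  ∀ (m : ℕ) (U : Fin m → Set X), (∀ i, IsOpen (U i)) → (⋃ i, U i) = univ →
    ∃ (k : ℕ) (V : Fin k → Set X), (∀ j, IsOpen (V j)) ∧ (⋃ j, V j) = univ ∧
      (∀ j, ∃ i, V j ⊆ U i) ∧ ∀ x, {j | x ∈ V j}.ncard ≤ n + 1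

open Classical in
/-- The covering dimension of `X`: the least `n` with `HasCoveringDimLE X n`, `⊤` if there is none,
and `⊥` (that is, `-1`) for the empty space. -/
def coveringDim (X : Type v) [TopologicalSpace X] : WithBot ℕ∞ :=
  if IsEmpty X then ⊥ else ((⨅ (n : ℕ) (_ : HasCoveringDimLE X n), (n : ℕ∞) : ℕ∞) : WithBot ℕ∞)

/-! ### Closed two-sided ideals and quotient C*-algebras -/

section Ideals

/-- A closed two-sided ideal of a C*-algebra. -/
structure ClosedIdeal (A : Type u) [NonUnitalCStarAlgebra A] where
  toSubmodule : Submodule ℂ A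
  mul_mem_left : ∀ (a : A) {x : A}, x ∈ toSubmodule → a * x ∈ toSubmodule
  mul_mem_right : ∀ (a : A) {x : A}, x ∈ toSubmodule → x * a ∈ toSubmodule
  isClosed : IsClosed (toSubmodule : Set A)

namespace ClosedIdeal

variable {A : Type u} [NonUnitalCStarAlgebra A]

/-- The self-adjoint part `I ∩ I*`. -/
def starPart (I : ClosedIdeal A) : NonUnitalStarSubalgebra ℂ A where
  carrier := {x | x ∈ I.toSubmodule ∧ star x ∈ I.toSubmodule}
  add_mem' := fun {a b} ha hb => ⟨add_mem ha.1 hb.1, by rw [star_add]; exact add_mem ha.2 hb.2⟩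
  zero_mem' := ⟨zero_mem _, by rw [star_zero]; exact zero_mem _⟩
  mul_mem' := fun {a b} _ hb => ⟨I.mul_mem_left a hb.1, by
    rw [star_mul]; exact I.mul_mem_right _ hb.2⟩
  smul_mem' := fun c x hx => ⟨I.toSubmodule.smul_mem c hx.1, by
    rw [star_smul]; exact I.toSubmodule.smul_mem _ hx.2⟩
  star_mem' := fun {a} ha => ⟨ha.2, by rw [star_star]; exact ha.1⟩

theorem isClosed_starPart (I : ClosedIdeal A) : IsClosed (I.starPart : Set A) :=
  I.isClosed.inter (I.isClosed.preimage continuous_star)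

/-- Approximate units in `I ∩ I*`. -/
theorem exists_approx (I : ClosedIdeal A) (i : A) (hi : i ∈ I.starPart) (ε : ℝ) (hε : 0 < ε) :
    ∃ e ∈ I.starPart, (∀ a : A, ‖a - a * e‖ ≤ ‖a‖) ∧ star e = e ∧ ‖i - i * e‖ < ε := by
  have : IsClosed (I.starPart : Set A) := I.isClosed_starPart
  let _ := CStarAlgebra.spectralOrder I.starPart
  have _ := CStarAlgebra.spectralOrderedRing I.starPart
  let _ := CStarAlgebra.spectralOrder A
  have _ := CStarAlgebra.spectralOrderedRing A
  have h := CStarAlgebra.increasingApproximateUnit I.starPart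
  have h1 := h.tendsto_mul_left ⟨i, hi⟩
  rw [Metric.tendsto_nhds] at h1
  obtain ⟨e, he, he0, he1⟩ := ((h1 ε hε).and (h.eventually_nonneg.and h.eventually_norm)).exists
  have he0' : (0 : A) ≤ (e : A) := by
    obtain ⟨b, hb⟩ := CStarAlgebra.nonneg_iff_eq_star_mul_self.1 he0
    have hb' : (e : A) = star (b : A) * (b : A) := congrArg Subtype.val hb
    rw [hb']
    exact star_mul_self_nonneg _
  have he1' : ‖(e : A)‖ ≤ 1 := he1
  have h0 : (0 : Unitization ℂ A) ≤ ((e : A) : Unitization ℂ A) := by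
    rwa [Unitization.inr_nonneg_iff]
  have h2 : ((e : A) : Unitization ℂ A) ≤ 1 := by
    rw [← CStarAlgebra.norm_le_one_iff_of_nonneg ((e : A) : Unitization ℂ A) h0,
      Unitization.norm_inr]
    exact he1'
  have h3 : ‖(1 : Unitization ℂ A) - ((e : A) : Unitization ℂ A)‖ ≤ 1 := by
    rw [CStarAlgebra.norm_le_one_iff_of_nonneg _ (sub_nonneg.2 h2)]
    exact sub_le_self _ h0
  refine ⟨e, e.2, fun a => ?_, (IsSelfAdjoint.of_nonneg he0').star_eq, ?_⟩
  · have h4 : ((a - a * (e : A) : A) : Unitization ℂ A) = (a : Unitization ℂ A) *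
        ((1 : Unitization ℂ A) - ((e : A) : Unitization ℂ A)) := by
      rw [mul_sub, mul_one, ← Unitization.inr_mul, ← Unitization.inr_sub]
    rw [← Unitization.norm_inr (𝕜 := ℂ) (a - a * (e : A)), h4]
    refine (norm_mul_le _ _).trans ?_
    rw [Unitization.norm_inr]
    exact mul_le_of_le_one_right (norm_nonneg _) h3
  · rw [dist_comm, dist_eq_norm] at he
    exact he

/-- Closed two-sided ideals of C*-algebras are self-adjoint. -/
theorem star_mem (I : ClosedIdeal A) {a : A} (ha : a ∈ I.toSubmodule) : star a ∈ I.toSubmodule := by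
  have hs : star a * a ∈ I.starPart :=
    ⟨I.mul_mem_left _ ha, by rw [star_mul, star_star]; exact I.mul_mem_left _ ha⟩
  suffices h : a ∈ closure (I.starPart : Set A) by
    rw [I.isClosed_starPart.closure_eq] at h
    exact h.2
  rw [Metric.mem_closure_iff]
  intro ε hε
  obtain ⟨e, he, hc, hse, hlt⟩ := I.exists_approx _ hs (ε ^ 2) (by positivity)
  refine ⟨a * e, ⟨I.mul_mem_left _ he.1, ?_⟩, ?_⟩
  · rw [star_mul]
    exact I.mul_mem_right _ he.2
  · rw [dist_eq_norm]
    have key := CStarRing.norm_star_mul_self (x := a - a * e)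
    have h6 : ‖star (a - a * e) * (a - a * e)‖ ≤ ‖star a * a - star a * a * e‖ := by
      set y := star a * a - star a * a * e
      have h7 : star (a - a * e) * (a - a * e) = star (star y - star y * e) := by
        simp only [y, star_sub, star_mul, star_star, hse]
        noncomm_ring
      rw [h7, norm_star]
      exact (hc _).trans (norm_star _).le
    rw [key] at h6
    nlinarith [norm_nonneg (a - a * e)]

/-- The C*-identity for quotients, on representatives. -/
theorem norm_aux (I : ClosedIdeal A) (a i : A) (hi : i ∈ I.toSubmodule) (ε : ℝ) (hε : 0 < ε) :
    ∃ j ∈ I.toSubmodule, ‖a + j‖ * ‖a + j‖ ≤ ‖star a * a + i‖ + ε := by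
  obtain ⟨e, he, hc, hse, hlt⟩ := I.exists_approx i ⟨hi, I.star_mem hi⟩ ε hε
  refine ⟨-(a * e), neg_mem (I.mul_mem_left _ he.1), ?_⟩
  rw [← sub_eq_add_neg, ← CStarRing.norm_star_mul_self (x := a - a * e)]
  set y := star a * a - star a * a * e with hy
  have h7 : star (a - a * e) * (a - a * e) = star (star y - star y * e) := by
    simp only [y, star_sub, star_mul, star_star, hse]
    noncomm_ring
  have h8 : y = ((star a * a + i) - (star a * a + i) * e) - (i - i * e) := by
    rw [hy]
    noncomm_ring
  rw [h7, norm_star]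
  refine (hc _).trans ?_
  rw [norm_star, h8]
  exact (norm_sub_le _ _).trans (add_le_add (hc _) hlt.le)

instance (I : ClosedIdeal A) : IsClosed (I.toSubmodule : Set A) := I.isClosed

/-- The quotient C*-algebra `A / I`, with the quotient norm. -/
def Quotient (I : ClosedIdeal A) : Type u := A ⧸ I.toSubmodule

section

variable (I : ClosedIdeal A)

instance : NormedAddCommGroup I.Quotient :=
  inferInstanceAs (NormedAddCommGroup (A ⧸ I.toSubmodule))

instance : NormedSpace ℂ I.Quotient :=
  inferInstanceAs (NormedSpace ℂ (A ⧸ I.toSubmodule))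

instance : CompleteSpace I.Quotient :=
  inferInstanceAs (CompleteSpace (A ⧸ I.toSubmodule))

/-- The quotient map as a linear map. -/
def mkL : A →ₗ[ℂ] I.Quotient := I.toSubmodule.mkQ

theorem mkL_surjective : Function.Surjective I.mkL := Submodule.mkQ_surjective _

theorem mkL_eq_iff {a b : A} : I.mkL a = I.mkL b ↔ a - b ∈ I.toSubmodule :=
  Submodule.Quotient.eq I.toSubmodule

theorem norm_mkL_le (a : A) : ‖I.mkL a‖ ≤ ‖a‖ := Submodule.Quotient.norm_mk_le I.toSubmodule a

theorem exists_norm_lt (x : I.Quotient) {ε : ℝ} (hε : 0 < ε) : ∃ a, I.mkL a = x ∧ ‖a‖ < ‖x‖ + ε :=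
  Submodule.Quotient.norm_mk_lt (S := I.toSubmodule) x hε

instance : Mul I.Quotient where
  mul := Quotient.map₂ (· * ·) (by
    intro a b hab c d hcd
    rw [← Quotient.eq_iff_equiv] at hab hcd ⊢
    have h1 := I.mkL_eq_iff.1 hab
    have h2 := I.mkL_eq_iff.1 hcd
    refine I.mkL_eq_iff.2 ?_
    have h3 : a * c - b * d = (a - b) * c + b * (c - d) := by noncomm_ring
    rw [h3]
    exact add_mem (I.mul_mem_right _ h1) (I.mul_mem_left _ h2))

theorem mkL_mul (a b : A) : I.mkL (a * b) = I.mkL a * I.mkL b := rfl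

instance : Star I.Quotient where
  star := Quotient.map star (by
    intro a b hab
    rw [← Quotient.eq_iff_equiv] at hab ⊢
    refine I.mkL_eq_iff.2 ?_
    rw [← star_sub]
    exact I.star_mem (I.mkL_eq_iff.1 hab))

theorem mkL_star (a : A) : I.mkL (star a) = star (I.mkL a) := rfl

theorem norm_mul_aux (x y : I.Quotient) : ‖x * y‖ ≤ ‖x‖ * ‖y‖ := by
  have key : ∀ ε : ℝ, 0 < ε → ‖x * y‖ ≤ (‖x‖ + ε) * (‖y‖ + ε) := by
    intro ε hε
    obtain ⟨a, rfl, ha⟩ := I.exists_norm_lt x hε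
    obtain ⟨b, rfl, hb⟩ := I.exists_norm_lt y hε
    rw [← mkL_mul]
    exact ((I.norm_mkL_le _).trans (norm_mul_le a b)).trans
      (mul_le_mul ha.le hb.le (norm_nonneg _) ((norm_nonneg a).trans ha.le))
  have ht : Tendsto (fun ε : ℝ => (‖x‖ + ε) * (‖y‖ + ε)) (𝓝[>] 0) (𝓝 (‖x‖ * ‖y‖)) := by
    have hc : Continuous (fun ε : ℝ => (‖x‖ + ε) * (‖y‖ + ε)) := by fun_prop
    have := hc.tendsto 0
    simp only [add_zero] at this
    exact this.mono_left nhdsWithin_le_nhds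
  exact ge_of_tendsto ht (eventually_nhdsWithin_of_forall fun ε hε => key ε hε)

theorem norm_star_mul_aux (x : I.Quotient) : ‖x‖ * ‖x‖ ≤ ‖star x * x‖ := by
  obtain ⟨a, rfl⟩ := I.mkL_surjective x
  refine le_of_forall_pos_le_add fun ε hε => ?_
  obtain ⟨b, hb, hlt⟩ := I.exists_norm_lt (star (I.mkL a) * I.mkL a) (half_pos hε)
  rw [← mkL_star, ← mkL_mul, mkL_eq_iff] at hb
  obtain ⟨j, hj, hle⟩ := I.norm_aux a (b - star a * a) hb (ε / 2) (half_pos hε)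
  have h1 : I.mkL a = I.mkL (a + j) := by
    rw [mkL_eq_iff]
    simpa using hj
  rw [add_sub_cancel] at hle
  have h2 := I.norm_mkL_le (a + j)
  rw [← h1] at h2
  have h3 := mul_le_mul h2 h2 (norm_nonneg _) (norm_nonneg _)
  linarith

instance : NonUnitalCStarAlgebra I.Quotient where
  __ := (inferInstance : NormedAddCommGroup I.Quotient)
  __ := (inferInstance : NormedSpace ℂ I.Quotient)
  left_distrib x y z := by
    obtain ⟨a, rfl⟩ := I.mkL_surjective x
    obtain ⟨b, rfl⟩ := I.mkL_surjective y
    obtain ⟨c, rfl⟩ := I.mkL_surjective z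
    rw [← map_add, ← mkL_mul, ← mkL_mul, ← mkL_mul, ← map_add, mul_add]
  right_distrib x y z := by
    obtain ⟨a, rfl⟩ := I.mkL_surjective x
    obtain ⟨b, rfl⟩ := I.mkL_surjective y
    obtain ⟨c, rfl⟩ := I.mkL_surjective z
    rw [← map_add, ← mkL_mul, ← mkL_mul, ← mkL_mul, ← map_add, add_mul]
  zero_mul x := by
    obtain ⟨a, rfl⟩ := I.mkL_surjective x
    rw [← map_zero I.mkL, ← mkL_mul, zero_mul]
  mul_zero x := by
    obtain ⟨a, rfl⟩ := I.mkL_surjective x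
    rw [← map_zero I.mkL, ← mkL_mul, mul_zero]
  mul_assoc x y z := by
    obtain ⟨a, rfl⟩ := I.mkL_surjective x
    obtain ⟨b, rfl⟩ := I.mkL_surjective y
    obtain ⟨c, rfl⟩ := I.mkL_surjective z
    rw [← mkL_mul, ← mkL_mul, ← mkL_mul, ← mkL_mul, mul_assoc]
  complete := fun {f} hf => CompleteSpace.complete hf
  norm_mul_le := I.norm_mul_aux
  star_involutive x := by
    obtain ⟨a, rfl⟩ := I.mkL_surjective x
    rw [← mkL_star, ← mkL_star, star_star]
  star_mul x y := by
    obtain ⟨a, rfl⟩ := I.mkL_surjective x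
    obtain ⟨b, rfl⟩ := I.mkL_surjective y
    rw [← mkL_mul, ← mkL_star, ← mkL_star, ← mkL_star, ← mkL_mul, star_mul]
  star_add x y := by
    obtain ⟨a, rfl⟩ := I.mkL_surjective x
    obtain ⟨b, rfl⟩ := I.mkL_surjective y
    rw [← map_add, ← mkL_star, ← mkL_star, ← mkL_star, ← map_add, star_add]
  norm_mul_self_le := I.norm_star_mul_aux
  smul_assoc c x y := by
    obtain ⟨a, rfl⟩ := I.mkL_surjective x
    obtain ⟨b, rfl⟩ := I.mkL_surjective y
    rw [smul_eq_mul, smul_eq_mul, ← map_smul, ← mkL_mul, ← mkL_mul, ← map_smul, smul_mul_assoc]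
  smul_comm c x y := by
    obtain ⟨a, rfl⟩ := I.mkL_surjective x
    obtain ⟨b, rfl⟩ := I.mkL_surjective y
    rw [smul_eq_mul, smul_eq_mul, ← mkL_mul, ← map_smul, ← map_smul, ← mkL_mul, mul_smul_comm]
  star_smul c x := by
    obtain ⟨a, rfl⟩ := I.mkL_surjective x
    rw [← map_smul, ← mkL_star, ← mkL_star, ← map_smul, star_smul]

/-- The quotient map `A → A / I`. -/
def proj : A →⋆ₙₐ[ℂ] I.Quotient where
  toFun := I.mkL
  map_smul' c a := map_smul I.mkL c a
  map_zero' := map_zero I.mkL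
  map_add' := map_add I.mkL
  map_mul' := I.mkL_mul
  map_star' := I.mkL_star

theorem proj_surjective : Function.Surjective I.proj := I.mkL_surjective

theorem proj_eq_iff {a b : A} : I.proj a = I.proj b ↔ a - b ∈ I.toSubmodule := I.mkL_eq_iff

theorem norm_proj_le (a : A) : ‖I.proj a‖ ≤ ‖a‖ := I.norm_mkL_le a

variable {I}

/-- The canonical map `A / I → A / J` for `I ⊆ J`. -/
def factor {J : ClosedIdeal A} (h : I.toSubmodule ≤ J.toSubmodule) :
    I.Quotient →⋆ₙₐ[ℂ] J.Quotient where
  toFun := Submodule.factor h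
  map_smul' c x := map_smul (Submodule.factor h) c x
  map_zero' := map_zero (Submodule.factor h)
  map_add' x y := map_add (Submodule.factor h) x y
  map_mul' x y := by
    obtain ⟨a, rfl⟩ := I.mkL_surjective x
    obtain ⟨b, rfl⟩ := I.mkL_surjective y
    rfl
  map_star' x := by
    obtain ⟨a, rfl⟩ := I.mkL_surjective x
    rfl

theorem factor_proj {J : ClosedIdeal A} (h : I.toSubmodule ≤ J.toSubmodule) (a : A) :
    factor h (I.proj a) = J.proj a := rfl

end

end ClosedIdeal

end Ideals

/-! ### Simple and weakly semiprojective C*-algebras -/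

/-- A simple C*-algebra: nonzero, without closed two-sided ideals other than `0` and itself. -/
def IsSimpleCStar (D : Type u) [NonUnitalCStarAlgebra D] : Prop :=
  Nontrivial D ∧ ∀ I : ClosedIdeal D, I.toSubmodule = ⊥ ∨ I.toSubmodule = ⊤

/-- Weak semiprojectivity: `D` is separable and nonzero, and for every increasing sequence of closed
two-sided ideals `J n` of a separable C*-algebra `B`, with `J∞` the closure of their union, the maps
`D → B / J∞` that lift to some `B / J n` are dense, in the point-norm topology, among all
*-homomorphisms `D → B / J∞`. -/
structure IsWeaklySemiprojective (D : Type u) [NonUnitalCStarAlgebra D] : Prop where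
  separable : SeparableSpace D
  nontrivial : Nontrivial D
  dense_range : ∀ (B : Type u) [NonUnitalCStarAlgebra B] [SeparableSpace B]
    (J : ℕ → ClosedIdeal B) (_ : ∀ n, (J n).toSubmodule ≤ (J (n + 1)).toSubmodule)
    (Jinf : ClosedIdeal B) (hle : ∀ n, (J n).toSubmodule ≤ Jinf.toSubmodule)
    (_ : (Jinf.toSubmodule : Set B) = closure (⋃ n, ((J n).toSubmodule : Set B)))
    (φ : D →⋆ₙₐ[ℂ] Jinf.Quotient) (F : Finset D) (ε : ℝ) (_ : 0 < ε),
    ∃ (n : ℕ) (ψ : D →⋆ₙₐ[ℂ] (J n).Quotient),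
      ∀ d ∈ F, ‖ClosedIdeal.factor (hle n) (ψ d) - φ d‖ < ε

/-- `D` is isomorphic to a finite direct sum of weakly semiprojective simple C*-algebras. -/
def IsSumOfSimpleWSP (D : Type u) [NonUnitalCStarAlgebra D] : Prop :=
  ∃ (m : ℕ) (S : Fin m → Type u) (_ : ∀ i, NonUnitalCStarAlgebra (S i)),
    (∀ i, IsSimpleCStar (S i) ∧ IsWeaklySemiprojective (S i)) ∧
      Nonempty (D ≃⋆ₐ[ℂ] (∀ i, S i))

/-- `A` admits an exhaustive sequence of C*-subalgebras, each isomorphic to a member of the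
class `C`. -/
def AdmitsExhaustiveSequence (C : (D : Type u) → [NonUnitalCStarAlgebra D] → Prop)
    (A : Type u) [NonUnitalCStarAlgebra A] : Prop :=
  ∃ B : ℕ → NonUnitalStarSubalgebra ℂ A,
    (∀ k, IsClosed (B k : Set A)) ∧
    (∀ k, ∃ (D : Type u) (_ : NonUnitalCStarAlgebra D), C D ∧ Nonempty (D ≃⋆ₐ[ℂ] B k)) ∧
    ∀ (F : Finset A) (ε : ℝ), 0 < ε → ∃ k, ∀ a ∈ F, ∃ b ∈ B k, ‖a - b‖ < ε

/-! ### `C(X)`-algebras -/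

section CXAlgebras

open MultiplierAlgebra

/-- A `C(X)`-algebra over a compact space `X`: a C*-algebra `A` with a *-homomorphism `θ` from
`C(X)` to the centre of the multiplier algebra of `A` such that `C(X) A` spans a dense subspace. -/
class CXAlgebra (X : Type v) [TopologicalSpace X] [CompactSpace X] (A : Type u)
    [NonUnitalCStarAlgebra A] where
  θ : C(X, ℂ) →⋆ₙₐ[ℂ] 𝓜(ℂ, A)
  central : ∀ f, θ f ∈ Set.center 𝓜(ℂ, A)
  nondegenerate :
    Dense (Submodule.span ℂ {a : A | ∃ (f : C(X, ℂ)) (b : A), (θ f).fst b = a} : Set A)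

namespace CXAlgebra

variable {X : Type v} [TopologicalSpace X] [CompactSpace X] {A : Type u} [NonUnitalCStarAlgebra A]
  [CXAlgebra X A]

/-- The product `f a` of `f ∈ C(X)` and `a ∈ A`. -/
def act (f : C(X, ℂ)) : A →L[ℂ] A := (θ f).fst

theorem eq_of_forall_mul {B : Type*} [NonUnitalCStarAlgebra B] {a b : B}
    (h : ∀ x, x * a = x * b) : a = b := by
  rw [← sub_eq_zero, ← CStarRing.star_mul_self_eq_zero_iff, mul_sub, h, sub_self]

theorem fst_mul {B : Type*} [NonUnitalCStarAlgebra B] (T : 𝓜(ℂ, B)) (a b : B) :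
    T.fst (a * b) = T.fst a * b := by
  refine eq_of_forall_mul fun x => ?_
  rw [← T.central, ← mul_assoc, T.central, mul_assoc]

theorem act_mul (f : C(X, ℂ)) (a b : A) : act f (a * b) = act f a * b := fst_mul _ _ _

theorem mul_act (f : C(X, ℂ)) (a b : A) : act f (a * b) = a * act f b := by
  have h := (Set.mem_center_iff.1 (central (A := A) f)).comm (a : 𝓜(ℂ, A))
  have h2 := congrArg (fun T : 𝓜(ℂ, A) => T.fst b) h
  exact h2

theorem snd_eq (f : C(X, ℂ)) (a : A) : (θ f : 𝓜(ℂ, A)).snd a = act f a := by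
  have h : ∀ y, (θ f : 𝓜(ℂ, A)).snd a * y = act f a * y := fun y => by
    rw [DoubleCentralizer.central, ← act_mul, mul_act]
    rfl
  rw [← star_inj]
  refine eq_of_forall_mul fun x => ?_
  rw [← star_inj, star_mul, star_mul, star_star, star_star, h]

theorem act_add (f g : C(X, ℂ)) (a : A) : act (f + g) a = act f a + act g a := by
  simp [act]

theorem act_smul (c : ℂ) (f : C(X, ℂ)) (a : A) : act (c • f) a = c • act f a := by
  have h : (θ (c • f) : 𝓜(ℂ, A)) = c • θ f := map_smul _ _ _
  simp [act, h]

theorem act_zero (a : A) : act (0 : C(X, ℂ)) a = 0 := by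
  simp [act]

theorem act_act (f g : C(X, ℂ)) (a : A) : act (f * g) a = act f (act g a) := by
  simp [act]

theorem act_star (f : C(X, ℂ)) (a : A) : act (star f) a = star (act f (star a)) := by
  rw [← snd_eq f (star a)]
  simp [act, map_star]

/-- The ideal `C(X, Y) A`: the closed linear span of the products `f a` with `f ∈ C(X)` vanishing
on the closed set `Y` and `a ∈ A`. -/
def vanishingIdeal (X : Type v) [TopologicalSpace X] [CompactSpace X] (A : Type u)
    [NonUnitalCStarAlgebra A] [CXAlgebra X A] (Y : Closeds X) : ClosedIdeal A where
  toSubmodule := (Submodule.span ℂ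
    {a : A | ∃ (f : C(X, ℂ)) (b : A), (∀ y ∈ Y, f y = 0) ∧ act f b = a}).topologicalClosure
  mul_mem_left a {x} hx := by
    refine map_mem_closure (f := fun x => a * x) (by fun_prop) hx fun y hy => ?_
    induction hy using Submodule.span_induction with
    | mem y hy =>
      obtain ⟨f, b, hf, rfl⟩ := hy
      exact Submodule.subset_span ⟨f, a * b, hf, mul_act f a b⟩
    | zero => simp
    | add y z _ _ hy hz => dsimp only at hy hz ⊢; rw [mul_add]; exact Submodule.add_mem _ hy hz
    | smul c y _ hy => dsimp only at hy ⊢; rw [mul_smul_comm]; exact Submodule.smul_mem _ c hy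
  mul_mem_right a {x} hx := by
    refine map_mem_closure (f := fun x => x * a) (by fun_prop) hx fun y hy => ?_
    induction hy using Submodule.span_induction with
    | mem y hy =>
      obtain ⟨f, b, hf, rfl⟩ := hy
      exact Submodule.subset_span ⟨f, b * a, hf, act_mul f b a⟩
    | zero => simp
    | add y z _ _ hy hz => dsimp only at hy hz ⊢; rw [add_mul]; exact Submodule.add_mem _ hy hz
    | smul c y _ hy => dsimp only at hy ⊢; rw [smul_mul_assoc]; exact Submodule.smul_mem _ c hy
  isClosed := Submodule.isClosed_topologicalClosure _

theorem vanishingIdeal_mono {Y Z : Closeds X} (h : Z ≤ Y) :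
    (vanishingIdeal X A Y).toSubmodule ≤ (vanishingIdeal X A Z).toSubmodule := by
  refine Submodule.topologicalClosure_mono (Submodule.span_mono ?_)
  rintro _ ⟨f, b, hf, rfl⟩
  exact ⟨f, b, fun y hy => hf y (h hy), rfl⟩

theorem act_mem_ideal (f : C(X, ℂ)) (I : ClosedIdeal A) {x : A}
    (hx : x ∈ I.toSubmodule) : act f x ∈ I.toSubmodule := by
  have hs : x ∈ I.starPart := ⟨hx, I.star_mem hx⟩
  change act f x ∈ (I.toSubmodule : Set A)
  rw [← I.isClosed.closure_eq, Metric.mem_closure_iff]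
  intro ε hε
  obtain ⟨e, he, _, _, hlt⟩ := I.exists_approx x hs (ε / (‖(act f : A →L[ℂ] A)‖ + 1)) (by positivity)
  refine ⟨act f (x * e), ?_, ?_⟩
  · rw [act_mul]
    exact I.mul_mem_left _ he.1
  · rw [dist_eq_norm, ← map_sub]
    have h1 := (act f : A →L[ℂ] A).le_opNorm (x - x * e)
    rw [lt_div_iff₀ (by positivity)] at hlt
    nlinarith [norm_nonneg (x - x * e), norm_nonneg (act f : A →L[ℂ] A)]

/-- Multiplication by `f ∈ C(X)` on a quotient of a `C(X)`-algebra, `f (a + I) = f a + I`. -/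
def actQuot (I : ClosedIdeal A) (f : C(X, ℂ)) : I.Quotient →L[ℂ] I.Quotient :=
  LinearMap.mkContinuous
    (show I.Quotient →ₗ[ℂ] I.Quotient from Submodule.mapQ I.toSubmodule I.toSubmodule
      (act f : A →L[ℂ] A).toLinearMap fun _ hx => act_mem_ideal f I hx)
    ‖(act f : A →L[ℂ] A)‖ (by
      intro x
      refine le_of_forall_pos_le_add fun ε hε => ?_
      obtain ⟨a, rfl, ha⟩ := I.exists_norm_lt x
        (ε := ε / (‖(act f : A →L[ℂ] A)‖ + 1)) (by positivity)
      have h1 : ‖I.mkL (act f a)‖ ≤ ‖(act f : A →L[ℂ] A)‖ * ‖a‖ :=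
        (I.norm_mkL_le _).trans ((act f : A →L[ℂ] A).le_opNorm a)
      have h2 : ε / (‖(act f : A →L[ℂ] A)‖ + 1) * (‖(act f : A →L[ℂ] A)‖ + 1) = ε :=
        div_mul_cancel₀ _ (by positivity)
      have h3 : 0 ≤ ε / (‖(act f : A →L[ℂ] A)‖ + 1) := by positivity
      refine h1.trans ?_
      nlinarith [norm_nonneg (act f : A →L[ℂ] A)])

theorem actQuot_proj (I : ClosedIdeal A) (f : C(X, ℂ)) (a : A) :
    actQuot I f (I.proj a) = I.proj (act f a) := rfl

/-- Multiplication by `f ∈ C(X)` on a quotient, as a multiplier. -/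
def quotMultiplier (I : ClosedIdeal A) (f : C(X, ℂ)) : 𝓜(ℂ, I.Quotient) where
  toProd := (actQuot I f, actQuot I f)
  central x y := by
    obtain ⟨a, rfl⟩ := I.proj_surjective x
    obtain ⟨b, rfl⟩ := I.proj_surjective y
    change actQuot I f _ * _ = _ * actQuot I f _
    rw [actQuot_proj, actQuot_proj, ← map_mul, ← map_mul, ← act_mul, mul_act]

theorem quotMultiplier_ext (I : ClosedIdeal A) {S T : 𝓜(ℂ, I.Quotient)}
    (h1 : ∀ a, S.fst (I.proj a) = T.fst (I.proj a)) (h2 : ∀ a, S.snd (I.proj a) = T.snd (I.proj a)) :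
    S = T := by
  refine DoubleCentralizer.ext ℂ _ _ _ (Prod.ext ?_ ?_)
  · ext x
    obtain ⟨a, rfl⟩ := I.proj_surjective x
    exact h1 a
  · ext x
    obtain ⟨a, rfl⟩ := I.proj_surjective x
    exact h2 a

/-- The induced map from `C(X)` to the multipliers of a quotient. -/
def quotHom (I : ClosedIdeal A) : C(X, ℂ) →⋆ₙₐ[ℂ] 𝓜(ℂ, I.Quotient) where
  toFun := quotMultiplier I
  map_smul' := fun c f => quotMultiplier_ext I
    (fun a => by
      change I.proj (act (c • f) a) = c • I.proj (act f a)
      rw [act_smul, map_smul])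
    (fun a => by
      change I.proj (act (c • f) a) = c • I.proj (act f a)
      rw [act_smul, map_smul])
  map_zero' := quotMultiplier_ext I
    (fun a => by
      change I.proj (act (0 : C(X, ℂ)) a) = 0
      rw [act_zero, map_zero])
    (fun a => by
      change I.proj (act (0 : C(X, ℂ)) a) = 0
      rw [act_zero, map_zero])
  map_add' := fun f g => quotMultiplier_ext I
    (fun a => by
      change I.proj (act (f + g) a) = I.proj (act f a) + I.proj (act g a)
      rw [act_add, map_add])
    (fun a => by
      change I.proj (act (f + g) a) = I.proj (act f a) + I.proj (act g a)
      rw [act_add, map_add])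
  map_mul' := fun f g => quotMultiplier_ext I
    (fun a => by
      change I.proj (act (f * g) a) = I.proj (act f (act g a))
      rw [act_act])
    (fun a => by
      change I.proj (act (f * g) a) = I.proj (act g (act f a))
      rw [mul_comm, act_act])
  map_star' := fun f => quotMultiplier_ext I
    (fun a => by
      change I.proj (act (star f) a) = star (actQuot I f (star (I.proj a)))
      rw [act_star, ← map_star I.proj a, actQuot_proj, ← map_star I.proj])
    (fun a => by
      change I.proj (act (star f) a) = star (actQuot I f (star (I.proj a)))
      rw [act_star, ← map_star I.proj a, actQuot_proj, ← map_star I.proj])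

/-- Every quotient of a `C(X)`-algebra is a `C(X)`-algebra. -/
instance instQuotient (I : ClosedIdeal A) : CXAlgebra X I.Quotient where
  θ := quotHom I
  central f := by
    rw [Semigroup.mem_center_iff]
    have hmul : ∀ x y : I.Quotient, actQuot I f (x * y) = x * actQuot I f y := by
      intro x y
      obtain ⟨a, rfl⟩ := I.proj_surjective x
      obtain ⟨b, rfl⟩ := I.proj_surjective y
      rw [actQuot_proj, ← map_mul, ← map_mul, actQuot_proj, mul_act]
    have hmul' : ∀ x y : I.Quotient, actQuot I f (x * y) = actQuot I f x * y := by
      intro x y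
      obtain ⟨a, rfl⟩ := I.proj_surjective x
      obtain ⟨b, rfl⟩ := I.proj_surjective y
      rw [actQuot_proj, ← map_mul, ← map_mul, actQuot_proj, act_mul]
    intro T
    refine DoubleCentralizer.ext ℂ _ _ _ (Prod.ext ?_ ?_)
    · ext x
      change T.fst (actQuot I f x) = actQuot I f (T.fst x)
      refine eq_of_forall_mul fun y => ?_
      rw [← T.central, ← hmul, ← hmul, T.central]
    · ext x
      change actQuot I f (T.snd x) = T.snd (actQuot I f x)
      rw [← star_inj]
      refine eq_of_forall_mul fun y => ?_
      rw [← star_inj, star_mul, star_mul, star_star, star_star, ← hmul', T.central, T.central,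
        ← hmul']
  nondegenerate := by
    have h := nondegenerate (X := X) (A := A)
    have hd := I.proj_surjective.denseRange.dense_image
      (AddMonoidHomClass.continuous_of_bound I.proj 1 fun a => by
        rw [one_mul]
        exact I.norm_proj_le a) h
    refine hd.mono ?_
    rintro _ ⟨x, hx, rfl⟩
    have hle : Submodule.span ℂ {a : A | ∃ (f : C(X, ℂ)) (b : A), (θ f).fst b = a} ≤
        (Submodule.span ℂ {a : I.Quotient | ∃ (f : C(X, ℂ)) (b : I.Quotient),
          (quotHom I f).fst b = a}).comap I.mkL := by
      rw [Submodule.span_le]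
      rintro _ ⟨f, b, rfl⟩
      exact Submodule.subset_span ⟨f, I.proj b, rfl⟩
    exact hle hx

end CXAlgebra

open CXAlgebra

/-- Closed subspaces of compact spaces are compact. -/
instance instCompactSpaceCloseds {X : Type v} [TopologicalSpace X] [CompactSpace X]
    (Y : Closeds X) : CompactSpace Y :=
  isCompact_iff_compactSpace.1 Y.isClosed.isCompact

section Restriction

variable {X : Type v} [TopologicalSpace X] [CompactSpace X] {A : Type u} [NonUnitalCStarAlgebra A]
  [CXAlgebra X A]

/-- The restriction of a function `f ∈ C(X)` to the closed set `Y`. -/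
def resFun (Y : Closeds X) (f : C(X, ℂ)) : C(Y, ℂ) := ⟨fun y => f y, by fun_prop⟩

/-- The restriction `A(Y) = A / C(X, Y) A` of the `C(X)`-algebra `A` to the closed set `Y`. -/
abbrev Restrict (A : Type u) [NonUnitalCStarAlgebra A] [CXAlgebra X A] (Y : Closeds X) : Type u :=
  (vanishingIdeal X A Y).Quotient

/-- The restriction map `π_Y : A → A(Y)`. -/
def res (A : Type u) [NonUnitalCStarAlgebra A] [CXAlgebra X A] (Y : Closeds X) :
    A →⋆ₙₐ[ℂ] Restrict A Y :=
  (vanishingIdeal X A Y).proj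

/-- The restriction map `A(Y) → A(Z)` for `Z ⊆ Y`. -/
def resTo (A : Type u) [NonUnitalCStarAlgebra A] [CXAlgebra X A] {Y Z : Closeds X} (h : Z ≤ Y) :
    Restrict A Y →⋆ₙₐ[ℂ] Restrict A Z :=
  ClosedIdeal.factor (vanishingIdeal_mono h)

/-- The one-point closed set `{x}`. -/
def point [T1Space X] (x : X) : Closeds X := ⟨{x}, isClosed_singleton⟩

/-- The fibre `A(x)`. -/
abbrev Fiber [T1Space X] (A : Type u) [NonUnitalCStarAlgebra A] [CXAlgebra X A] (x : X) : Type u :=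
  Restrict A (point x)

/-- A continuous `C(X)`-algebra: `x ↦ ‖a(x)‖` is continuous for every `a`. -/
def IsContinuousCX (X : Type v) [TopologicalSpace X] [CompactSpace X] [T1Space X] (A : Type u)
    [NonUnitalCStarAlgebra A] [CXAlgebra X A] : Prop :=
  ∀ a : A, Continuous fun x : X => ‖res A (point x) a‖

end Restriction

/-- `E` is a `C`-elementary `C(Z)`-algebra: for a partition of `Z` into `r ≥ 1` nonempty closed
sets `Z j` and members `D j` of the class `C`, there is an isomorphism of `C(Z)`-algebras from `E`
to the direct sum of the algebras `C(Z j) ⊗ D j`, realized as `C(Z j, D j)`. -/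
def IsElementary (C : (D : Type u) → [NonUnitalCStarAlgebra D] → Prop)
    (Z : Type v) [TopologicalSpace Z] [CompactSpace Z]
    (E : Type (max u v)) [NonUnitalCStarAlgebra E] [CXAlgebra Z E] : Prop :=
  ∃ (r : ℕ) (P : Fin r → Closeds Z) (D : Fin r → Type u) (_ : ∀ j, NonUnitalCStarAlgebra (D j))
    (Φ : E ≃⋆ₐ[ℂ] (∀ j, C(P j, D j))),
    1 ≤ r ∧ (∀ j, (P j : Set Z).Nonempty) ∧
    (∀ i j, i ≠ j → Disjoint (P i : Set Z) (P j : Set Z)) ∧ (⋃ j, (P j : Set Z)) = univ ∧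
    (∀ j, C (D j)) ∧
    ∀ (f : C(Z, ℂ)) (e : E) (j : Fin r) (z : P j), Φ (act f e) j z = f z • Φ e j z

/-- An `n`-fibered `C`-monomorphism `(ψ 0, …, ψ n)` into the `C(X)`-algebra `A`. The
`C(Y i)`-algebra `E i` is a `C(X)`-algebra through the restriction map `C(X) → C(Y i)`. -/
structure FiberedMono (C : (D : Type u) → [NonUnitalCStarAlgebra D] → Prop)
    (X : Type v) [TopologicalSpace X] [CompactSpace X]
    (A : Type u) [NonUnitalCStarAlgebra A] [CXAlgebra X A] (n : ℕ) where
  Y : Fin (n + 1) → Closeds X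
  cover : (⋃ i, (Y i : Set X)) = univ
  E : Fin (n + 1) → Type (max u v)
  [cstar : ∀ i, NonUnitalCStarAlgebra (E i)]
  [cx : ∀ i, CXAlgebra (Y i) (E i)]
  elementary : ∀ i, IsElementary C (Y i) (E i)
  ψ : ∀ i, E i →⋆ₙₐ[ℂ] Restrict A (Y i)
  injective : ∀ i, Function.Injective (ψ i)
  linear : ∀ i (f : C(X, ℂ)) (e : E i),
    ψ i (act (resFun (Y i) f) e) = act f (ψ i e)
  containment : ∀ i j, i ≤ j → ∀ e : E i, ∃ e' : E j,
    resTo A (inf_le_left : Y i ⊓ Y j ≤ Y i) (ψ i e) =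
      resTo A (inf_le_right : Y i ⊓ Y j ≤ Y j) (ψ j e')

namespace FiberedMono

variable {C : (D : Type u) → [NonUnitalCStarAlgebra D] → Prop}
  {X : Type v} [TopologicalSpace X] [CompactSpace X]
  {A : Type u} [NonUnitalCStarAlgebra A] [CXAlgebra X A] {n : ℕ}

attribute [instance] cstar cx

/-- The fibered product `A(ψ 0, …, ψ n)`. -/
def fiberedProduct (Ψ : FiberedMono.{u, v} C X A n) : NonUnitalStarSubalgebra ℂ (∀ i, Ψ.E i) where
  carrier := {d | ∀ i j, resTo A (inf_le_left : Ψ.Y i ⊓ Ψ.Y j ≤ Ψ.Y i) (Ψ.ψ i (d i)) =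
    resTo A (inf_le_right : Ψ.Y i ⊓ Ψ.Y j ≤ Ψ.Y j) (Ψ.ψ j (d j))}
  add_mem' := fun {a b} ha hb i j => by
    rw [Pi.add_apply, Pi.add_apply, map_add, map_add, map_add, map_add, ha i j, hb i j]
  zero_mem' := fun i j => by
    rw [Pi.zero_apply, Pi.zero_apply, map_zero, map_zero, map_zero, map_zero]
  mul_mem' := fun {a b} ha hb i j => by
    rw [Pi.mul_apply, Pi.mul_apply, map_mul, map_mul, map_mul, map_mul, ha i j, hb i j]
  smul_mem' := fun c x hx i j => by
    rw [Pi.smul_apply, Pi.smul_apply, map_smul, map_smul, map_smul, map_smul, hx i j]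
  star_mem' := fun {a} ha i j => by
    rw [Pi.star_apply, Pi.star_apply, map_star, map_star, map_star, map_star, ha i j]

/-- `η` is the map into `A` induced by `(ψ 0, …, ψ n)`: the *-homomorphism determined by
`π_{Y i} (η d) = ψ i (d i)` for all `i`; it is a `C(X)`-linear monomorphism. -/
structure IsInducedMono (Ψ : FiberedMono.{u, v} C X A n) (η : Ψ.fiberedProduct →⋆ₙₐ[ℂ] A) :
    Prop where
  res_eq : ∀ (d : Ψ.fiberedProduct) (i : Fin (n + 1)),
    res A (Ψ.Y i) (η d) = Ψ.ψ i ((d : ∀ i, Ψ.E i) i)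
  injective : Function.Injective η
  linear : ∀ (f : C(X, ℂ)) (d d' : Ψ.fiberedProduct),
    (∀ i, (d' : ∀ i, Ψ.E i) i = act (resFun (Ψ.Y i) f) ((d : ∀ i, Ψ.E i) i)) →
      η d' = act f (η d)

end FiberedMono

end CXAlgebras

end CStarBundle

end

noncomputable section

namespace CStarBundle

/-! ### Kernels, quotients and ranges of *-homomorphisms -/

section Hom

variable {A B D : Type*} [NonUnitalCStarAlgebra A] [NonUnitalCStarAlgebra B]
  [NonUnitalCStarAlgebra D]

/-! Near a point `x` the finite set is almost contained in a subalgebra `D` of the fiber that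
belongs to the class. The ideals of elements vanishing on shrinking closed neighbourhoods of `x`
increase to a dense subset of the ideal defining the fiber, so weak semiprojectivity lifts the
embedding of `D` approximately to some `A(V)`. The lift stays injective in every fiber over a small
`V`: injectivity on `D` is detected by one norm-one element per simple summand, and continuity of
the field keeps the norms of their images above 1/2 (`exists_local_hom`).

In dimension at most `n` every finite open cover is refined by closed sets sorted into `n + 1`
disjoint families (`HasCoveringDimLE.exists_closed_refinement`). Let `Y i` be the union of the
`i`-th family; the local homomorphisms on its members assemble to an elementary algebra over `Y i`.
What is missing is the containment on overlaps. It comes from stability: a homomorphism that almost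
maps a suitable finite set into a closed subalgebra `T` is close to one with values in `T`
(`HasLifts.exists_perturb`). If `T` is the algebra cut out by the levels above `i` and it still
approximates enough elements, the local maps over `Y i` can be pushed into the restriction of `T`.
Afterwards `exists_mem_inf_norm_lt` corrects an approximant in `T` so that it also belongs to level
`i`.

The order of choices matters. The tolerance demanded by level `i` has to be known before the levels
above it are built, and one open cover must serve all levels before the dimension hypothesis
supplies the sets `Y i`. Hence `exists_levels` is an induction whose statement quantifies over all
partitions subordinate to a cover chosen in advance. Each level is recorded as a closed subalgebra
`S i` of `A`, the preimage of the elementary algebra under restriction to `Y i`; the range of the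
induced map is then the intersection of the `S i`.

Members of the class are direct sums, and lifting from a sum requires lifts with orthogonal ranges.
`HasLifts.prod` obtains them by lifting orthogonal positive elements and working inside hereditary
subalgebras. -/

theorem continuous_hom (f : A →⋆ₙₐ[ℂ] B) : Continuous f :=
  AddMonoidHomClass.continuous_of_bound f 1 fun a => by
    rw [one_mul]
    exact NonUnitalStarAlgHom.norm_apply_le f a

theorem norm_hom_sub_le (f : A →⋆ₙₐ[ℂ] B) (a b : A) : ‖f a - f b‖ ≤ ‖a - b‖ := by
  rw [← map_sub]
  exact NonUnitalStarAlgHom.norm_apply_le f _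

/-- The kernel of a *-homomorphism. -/
def kerIdeal (f : A →⋆ₙₐ[ℂ] B) : ClosedIdeal A where
  toSubmodule :=
    { carrier := {a | f a = 0}
      add_mem' := fun {a b} (ha : f a = 0) (hb : f b = 0) => by
        change f (a + b) = 0
        rw [map_add, ha, hb, add_zero]
      zero_mem' := map_zero f
      smul_mem' := fun c a (ha : f a = 0) => by
        change f (c • a) = 0
        rw [map_smul, ha, smul_zero] }
  mul_mem_left := fun a {x} (hx : f x = 0) => by
    change f (a * x) = 0
    rw [map_mul, hx, mul_zero]
  mul_mem_right := fun a {x} (hx : f x = 0) => by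
    change f (x * a) = 0
    rw [map_mul, hx, zero_mul]
  isClosed := isClosed_singleton.preimage (continuous_hom f)

namespace ClosedIdeal

theorem proj_eq_zero_iff (I : ClosedIdeal A) {a : A} : I.proj a = 0 ↔ a ∈ I.toSubmodule := by
  rw [← map_zero I.proj, proj_eq_iff, sub_zero]

/-- The map on `A / I` induced by a *-homomorphism that vanishes on `I`. -/
def lift (I : ClosedIdeal A) (f : A →⋆ₙₐ[ℂ] B) (h : ∀ a ∈ I.toSubmodule, f a = 0) :
    I.Quotient →⋆ₙₐ[ℂ] B :=
  let g : I.Quotient →ₗ[ℂ] B := I.toSubmodule.liftQ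
    { toFun := f, map_add' := map_add f, map_smul' := map_smul f } h
  { toFun := g
    map_smul' := map_smul g
    map_zero' := map_zero g
    map_add' := map_add g
    map_mul' := fun x y => by
      obtain ⟨a, rfl⟩ := I.mkL_surjective x
      obtain ⟨b, rfl⟩ := I.mkL_surjective y
      exact map_mul f a b
    map_star' := fun x => by
      obtain ⟨a, rfl⟩ := I.mkL_surjective x
      exact map_star f a }

theorem lift_injective (I : ClosedIdeal A) (f : A →⋆ₙₐ[ℂ] B) (h : ∀ a, a ∈ I.toSubmodule ↔ f a = 0) :
    Function.Injective (I.lift f fun a ha => (h a).1 ha) := by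
  rw [injective_iff_map_eq_zero]
  intro x hx
  obtain ⟨a, rfl⟩ := I.proj_surjective x
  exact I.proj_eq_zero_iff.2 ((h a).2 hx)

theorem norm_proj_eq (I : ClosedIdeal A) (f : A →⋆ₙₐ[ℂ] B) (h : ∀ a, a ∈ I.toSubmodule ↔ f a = 0)
    (a : A) : ‖I.proj a‖ = ‖f a‖ :=
  (NonUnitalStarAlgHom.norm_map _ (I.lift_injective f h) (I.proj a)).symm

theorem exists_proj_eq_norm_lt (I : ClosedIdeal A) {a : A} {c : ℝ} (h : ‖I.proj a‖ < c) :
    ∃ b, I.proj b = I.proj a ∧ ‖b‖ < c := by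
  obtain ⟨b, hb, hlt⟩ := I.exists_norm_lt (I.proj a) (sub_pos.2 h)
  exact ⟨b, hb, by linarith⟩

/-- The preimage of a closed ideal. -/
def comap (f : A →⋆ₙₐ[ℂ] B) (I : ClosedIdeal B) : ClosedIdeal A := kerIdeal (I.proj.comp f)

theorem mem_comap {f : A →⋆ₙₐ[ℂ] B} {I : ClosedIdeal B} {a : A} :
    a ∈ (I.comap f).toSubmodule ↔ f a ∈ I.toSubmodule := by
  rw [← I.proj_eq_zero_iff]
  rfl

/-- The map `A / f⁻¹(I) → B / I`. -/
def comapMap (f : A →⋆ₙₐ[ℂ] B) (I : ClosedIdeal B) : (I.comap f).Quotient →⋆ₙₐ[ℂ] I.Quotient :=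
  (I.comap f).lift (I.proj.comp f) fun _ ha => ha

theorem comapMap_injective (f : A →⋆ₙₐ[ℂ] B) (I : ClosedIdeal B) :
    Function.Injective (I.comapMap f) :=
  (I.comap f).lift_injective _ fun _ => Iff.rfl

theorem factor_factor {I J K : ClosedIdeal A} (h : I.toSubmodule ≤ J.toSubmodule)
    (h' : J.toSubmodule ≤ K.toSubmodule) (x : I.Quotient) :
    factor h' (factor h x) = factor (h.trans h') x := by
  obtain ⟨a, rfl⟩ := I.proj_surjective x
  rfl

end ClosedIdeal

/-- The norm of `f a` is the quotient norm modulo the kernel. This lemma, and its version inside a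
subalgebra, turn smallness over a closed set into smallness in `A`. -/
theorem exists_eq_norm_lt (f : A →⋆ₙₐ[ℂ] B) {a : A} {c : ℝ} (h : ‖f a‖ < c) :
    ∃ b, f b = f a ∧ ‖b‖ < c := by
  rw [← (kerIdeal f).norm_proj_eq f fun _ => Iff.rfl] at h
  obtain ⟨b, hb, hlt⟩ := (kerIdeal f).exists_proj_eq_norm_lt h
  refine ⟨b, ?_, hlt⟩
  rw [← sub_eq_zero, ← map_sub]
  exact (kerIdeal f).proj_eq_iff.1 hb

/-- The map induced on the quotient by the kernel is injective, hence isometric, so its range is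
complete. -/
theorem isClosed_range (f : A →⋆ₙₐ[ℂ] B) : IsClosed (Set.range f) := by
  have hi := NonUnitalStarAlgHom.isometry _ ((kerIdeal f).lift_injective f fun _ => Iff.rfl)
  have h : Set.range f = Set.range ((kerIdeal f).lift f fun _ ha => ha) := by
    ext b
    constructor
    · rintro ⟨a, rfl⟩
      exact ⟨(kerIdeal f).proj a, rfl⟩
    · rintro ⟨x, rfl⟩
      obtain ⟨a, rfl⟩ := (kerIdeal f).proj_surjective x
      exact ⟨a, rfl⟩
  rw [h]
  exact hi.isClosedEmbedding.isClosed_range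

theorem isClosed_map (f : A →⋆ₙₐ[ℂ] B) (S : NonUnitalStarSubalgebra ℂ A)
    (hS : IsClosed (S : Set A)) : IsClosed (S.map f : Set B) := by
  have := isClosed_range (f.comp (NonUnitalStarSubalgebraClass.subtype S))
  rw [NonUnitalStarAlgHom.coe_comp, Set.range_comp] at this
  simpa using this

theorem exists_mem_eq_norm_lt (f : A →⋆ₙₐ[ℂ] B) (S : NonUnitalStarSubalgebra ℂ A)
    (hS : IsClosed (S : Set A)) {a : A} (ha : a ∈ S) {c : ℝ} (h : ‖f a‖ < c) :
    ∃ b ∈ S, f b = f a ∧ ‖b‖ < c := by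
  obtain ⟨b, hb, hlt⟩ := exists_eq_norm_lt (f.comp (NonUnitalStarSubalgebraClass.subtype S))
    (a := ⟨a, ha⟩) h
  exact ⟨b, b.2, hb, hlt⟩

/-- The source `D` carries only algebraic structure because this is also applied to the fibered
product, a *-subalgebra that is not shown to be closed. -/
theorem exists_comp_eq {D : Type*} [NonUnitalRing D] [Module ℂ D] [Star D]
    (i : A →⋆ₙₐ[ℂ] B) (hi : Function.Injective i) (g : D →⋆ₙₐ[ℂ] B)
    (h : ∀ d, ∃ a, i a = g d) : ∃ k : D →⋆ₙₐ[ℂ] A, ∀ d, i (k d) = g d := by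
  choose k hk using h
  exact ⟨{
    toFun := k
    map_smul' := fun c d => hi (by rw [hk, map_smul, map_smul]; simp [hk])
    map_zero' := hi (by rw [hk, map_zero, map_zero])
    map_add' := fun d e => hi (by rw [hk, map_add, map_add, hk, hk])
    map_mul' := fun d e => hi (by rw [hk, map_mul, map_mul, hk, hk])
    map_star' := fun d => hi (by rw [hk, map_star, map_star, hk]) }, hk⟩

/-- The inclusion of a closed *-subalgebra. -/
abbrev incl (S : NonUnitalStarSubalgebra ℂ A) : S →⋆ₙₐ[ℂ] A := NonUnitalStarSubalgebraClass.subtype S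

theorem subalgebra_separableSpace [SeparableSpace A] (S : NonUnitalStarSubalgebra ℂ A) :
    SeparableSpace S := by
  have := UniformSpace.secondCountable_of_separable A
  infer_instance

theorem quotient_separableSpace [SeparableSpace A] (I : ClosedIdeal A) :
    SeparableSpace I.Quotient :=
  I.proj_surjective.denseRange.separableSpace (continuous_hom I.proj)

end Hom

/-! ### The lifting property without nontriviality -/

/-- The lifting property in the definition of weak semiprojectivity, for separable algebras that may
be zero. -/
structure HasLifts (D : Type u) [NonUnitalCStarAlgebra D] : Prop where
  separable : SeparableSpace D
  lifts : ∀ (B : Type u) [NonUnitalCStarAlgebra B] [SeparableSpace B]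
    (J : ℕ → ClosedIdeal B) (_ : ∀ n, (J n).toSubmodule ≤ (J (n + 1)).toSubmodule)
    (Jinf : ClosedIdeal B) (hle : ∀ n, (J n).toSubmodule ≤ Jinf.toSubmodule)
    (_ : (Jinf.toSubmodule : Set B) = closure (⋃ n, ((J n).toSubmodule : Set B)))
    (φ : D →⋆ₙₐ[ℂ] Jinf.Quotient) (F : Finset D) (ε : ℝ) (_ : 0 < ε),
    ∃ (n : ℕ) (ψ : D →⋆ₙₐ[ℂ] (J n).Quotient),
      ∀ d ∈ F, ‖ClosedIdeal.factor (hle n) (ψ d) - φ d‖ < ε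

theorem IsWeaklySemiprojective.hasLifts {D : Type u} [NonUnitalCStarAlgebra D]
    (h : IsWeaklySemiprojective D) : HasLifts D := ⟨h.separable, h.dense_range⟩

theorem HasLifts.of_equiv {D E : Type u} [NonUnitalCStarAlgebra D] [NonUnitalCStarAlgebra E]
    (h : HasLifts D) (e : D ≃⋆ₐ[ℂ] E) : HasLifts E where
  separable := by
    have := h.separable
    exact e.surjective.denseRange.separableSpace (continuous_hom (e : D →⋆ₙₐ[ℂ] E))
  lifts B _ _ J hJ Jinf hle hcl φ F ε hε := by
    classical
    obtain ⟨n, ψ, hψ⟩ := h.lifts B J hJ Jinf hle hcl (φ.comp (e : D →⋆ₙₐ[ℂ] E))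
      (F.image e.symm) ε hε
    refine ⟨n, ψ.comp (e.symm : E →⋆ₙₐ[ℂ] D), fun d hd => ?_⟩
    have := hψ (e.symm d) (Finset.mem_image_of_mem _ hd)
    simpa using this

theorem HasLifts.of_subsingleton {D : Type u} [NonUnitalCStarAlgebra D] [Subsingleton D] :
    HasLifts D where
  separable := inferInstance
  lifts B _ _ J hJ Jinf hle hcl φ F ε hε := by
    refine ⟨0, 0, fun d _ => ?_⟩
    rw [Subsingleton.elim d 0, map_zero, map_zero, map_zero]
    simpa using hε

/-! ### Stability of almost inclusions -/

section Asymptotic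

open scoped ENNReal

variable {D : Type u} [NonUnitalCStarAlgebra D] {A : ℕ → Type u} [∀ n, NonUnitalCStarAlgebra (A n)]

/-- Evaluation of a bounded sequence at an index. -/
def lpEval (m : ℕ) : lp A ∞ →⋆ₙₐ[ℂ] A m where
  toFun x := x m
  map_smul' _ _ := rfl
  map_zero' := rfl
  map_add' _ _ := rfl
  map_mul' _ _ := rfl
  map_star' _ := rfl

/-- The sequence obtained from a finite family by extending it with zero. -/
def lpExtend (n : ℕ) (x : ∀ i : Fin n, A i) : lp A ∞ :=
  ⟨fun m => if h : m < n then x ⟨m, h⟩ else 0, memℓp_infty ⟨‖x‖, by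
    rintro _ ⟨m, rfl⟩
    dsimp only
    split_ifs with h
    · exact norm_le_pi_norm x ⟨m, h⟩
    · simp⟩⟩

theorem lpExtend_apply (n : ℕ) (x : ∀ i : Fin n, A i) (m : ℕ) :
    lpExtend n x m = if h : m < n then x ⟨m, h⟩ else 0 := rfl

theorem continuous_lpExtend (n : ℕ) : Continuous (lpExtend n : (∀ i : Fin n, A i) → lp A ∞) := by
  refine (LipschitzWith.of_dist_le_mul (K := 1) fun x y => ?_).continuous
  rw [NNReal.coe_one, one_mul, dist_eq_norm, dist_eq_norm]
  refine lp.norm_le_of_forall_le (norm_nonneg _) fun m => ?_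
  rw [lp.coeFn_sub, Pi.sub_apply, lpExtend_apply, lpExtend_apply]
  split_ifs with h
  · exact norm_le_pi_norm (x - y) ⟨m, h⟩
  · simp

/-- The pairs of `d ∈ D` and a bounded sequence in `∏ B n` asymptotic to `φ n d`. -/
def asympAlgebra (B : ∀ n, NonUnitalStarSubalgebra ℂ (A n)) (φ : ∀ n, D →⋆ₙₐ[ℂ] A n) :
    NonUnitalStarSubalgebra ℂ (D × lp A ∞) where
  carrier := {p | (∀ n, p.2 n ∈ B n) ∧ Tendsto (fun n => ‖p.2 n - φ n p.1‖) atTop (𝓝 0)}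
  add_mem' := fun {p q} hp hq => ⟨fun n => add_mem (hp.1 n) (hq.1 n), by
    have := hp.2.add hq.2
    rw [add_zero] at this
    refine squeeze_zero (fun n => norm_nonneg _) (fun n => ?_) this
    have h : (p + q).2 n - φ n (p + q).1 = (p.2 n - φ n p.1) + (q.2 n - φ n q.1) := by
      change p.2 n + q.2 n - φ n (p.1 + q.1) = _
      rw [map_add]
      abel
    rw [h]
    exact norm_add_le _ _⟩
  zero_mem' := ⟨fun n => zero_mem _, by
    refine tendsto_const_nhds.congr fun n => ?_
    change 0 = ‖0 - φ n 0‖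
    rw [map_zero, sub_zero, norm_zero]⟩
  mul_mem' := fun {p q} hp hq => ⟨fun n => mul_mem (hp.1 n) (hq.1 n), by
    have h1 : Tendsto (fun n => ‖p.2 n - φ n p.1‖ * ‖q.2‖ + ‖p.1‖ * ‖q.2 n - φ n q.1‖)
        atTop (𝓝 0) := by
      have := (hp.2.mul_const ‖q.2‖).add (hq.2.const_mul ‖p.1‖)
      simpa using this
    refine squeeze_zero (fun n => norm_nonneg _) (fun n => ?_) h1
    have h2 : (p * q).2 n - φ n (p * q).1 =
        (p.2 n - φ n p.1) * q.2 n + φ n p.1 * (q.2 n - φ n q.1) := by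
      change p.2 n * q.2 n - φ n (p.1 * q.1) = _
      rw [map_mul]
      noncomm_ring
    rw [h2]
    refine (norm_add_le _ _).trans (add_le_add ?_ ?_)
    · refine (norm_mul_le _ _).trans (mul_le_mul_of_nonneg_left ?_ (norm_nonneg _))
      exact lp.norm_apply_le_norm ENNReal.top_ne_zero q.2 n
    · refine (norm_mul_le _ _).trans (mul_le_mul_of_nonneg_right ?_ (norm_nonneg _))
      exact NonUnitalStarAlgHom.norm_apply_le _ _⟩
  smul_mem' := fun c p hp => ⟨fun n => SMulMemClass.smul_mem c (hp.1 n), by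
    have := hp.2.const_mul ‖c‖
    rw [mul_zero] at this
    refine this.congr fun n => ?_
    change _ = ‖c • p.2 n - φ n (c • p.1)‖
    rw [map_smul, ← smul_sub, norm_smul]⟩
  star_mem' := fun {p} hp => ⟨fun n => star_mem (hp.1 n), by
    refine hp.2.congr fun n => ?_
    change _ = ‖star (p.2 n) - φ n (star p.1)‖
    rw [map_star, ← star_sub, norm_star]⟩

variable {B : ∀ n, NonUnitalStarSubalgebra ℂ (A n)} {φ : ∀ n, D →⋆ₙₐ[ℂ] A n}

theorem isClosed_asympAlgebra (hB : ∀ n, IsClosed (B n : Set (A n))) :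
    IsClosed (asympAlgebra B φ : Set (D × lp A ∞)) := by
  refine isClosed_of_closure_subset fun p hp => ?_
  have hcl : ∀ ε > 0, ∃ q ∈ asympAlgebra B φ, ‖p - q‖ < ε := fun ε hε => by
    obtain ⟨q, hq, hlt⟩ := Metric.mem_closure_iff.1 hp ε hε
    exact ⟨q, hq, by rwa [← dist_eq_norm]⟩
  have h2 : ∀ q : D × lp A ∞, ∀ n, ‖p.2 n - q.2 n‖ ≤ ‖p - q‖ := fun q n =>
    (lp.norm_apply_le_norm ENNReal.top_ne_zero (p.2 - q.2) n).trans (norm_snd_le (p - q))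
  refine ⟨fun n => ?_, ?_⟩
  · change _ ∈ (B n : Set (A n))
    rw [← (hB n).closure_eq, Metric.mem_closure_iff]
    intro ε hε
    obtain ⟨q, hq, hlt⟩ := hcl ε hε
    exact ⟨q.2 n, hq.1 n, by rw [dist_eq_norm]; exact (h2 q n).trans_lt hlt⟩
  · rw [Metric.tendsto_nhds]
    intro ε hε
    obtain ⟨q, hq, hlt⟩ := hcl (ε / 3) (by positivity)
    filter_upwards [Metric.tendsto_nhds.1 hq.2 (ε / 3) (by positivity)] with n hn
    rw [dist_zero_right, norm_norm] at hn ⊢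
    have h3 : p.2 n - φ n p.1 = (p.2 n - q.2 n) + (q.2 n - φ n q.1) + φ n (q.1 - p.1) := by
      rw [map_sub]
      abel
    have h4 : ‖φ n (q.1 - p.1)‖ ≤ ‖p - q‖ := by
      refine (NonUnitalStarAlgHom.norm_apply_le _ _).trans ?_
      rw [norm_sub_rev]
      exact norm_fst_le (p - q)
    rw [h3]
    have := norm_add₃_le (a := p.2 n - q.2 n) (b := q.2 n - φ n q.1) (c := φ n (q.1 - p.1))
    linarith [h2 q n]

/-- The finitely supported sequences in `asympAlgebra`, as an ideal. -/
def asympIdeal [h : IsClosed (asympAlgebra B φ : Set (D × lp A ∞))] (n : ℕ) :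
    ClosedIdeal (asympAlgebra B φ) where
  toSubmodule :=
    { carrier := {p | p.1.1 = 0 ∧ ∀ m, n ≤ m → p.1.2 m = 0}
      add_mem' := fun {p q} hp hq => ⟨by
        change p.1.1 + q.1.1 = 0
        rw [hp.1, hq.1, add_zero], fun m hm => by
        change p.1.2 m + q.1.2 m = 0
        rw [hp.2 m hm, hq.2 m hm, add_zero]⟩
      zero_mem' := ⟨rfl, fun _ _ => rfl⟩
      smul_mem' := fun c p hp => ⟨by
        change c • p.1.1 = 0
        rw [hp.1, smul_zero], fun m hm => by
        change c • p.1.2 m = 0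
        rw [hp.2 m hm, smul_zero]⟩ }
  mul_mem_left := fun a p hp => ⟨by
    change a.1.1 * p.1.1 = 0
    rw [hp.1, mul_zero], fun m hm => by
    change a.1.2 m * p.1.2 m = 0
    rw [hp.2 m hm, mul_zero]⟩
  mul_mem_right := fun a p hp => ⟨by
    change p.1.1 * a.1.1 = 0
    rw [hp.1, zero_mul], fun m hm => by
    change p.1.2 m * a.1.2 m = 0
    rw [hp.2 m hm, zero_mul]⟩
  isClosed := by
    have h1 : IsClosed {p : asympAlgebra B φ | p.1.1 = 0} :=
      isClosed_singleton.preimage (continuous_fst.comp continuous_subtype_val)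
    have h2 : IsClosed {p : asympAlgebra B φ | ∀ m, n ≤ m → p.1.2 m = 0} := by
      simp only [ofPred_forall]
      refine isClosed_iInter fun m => isClosed_iInter fun _ => ?_
      exact isClosed_singleton.preimage
        ((continuous_hom (lpEval m)).comp (continuous_snd.comp continuous_subtype_val))
    exact h1.inter h2

/-- The projection of `asympAlgebra` to `D`. -/
def asympFst (B : ∀ n, NonUnitalStarSubalgebra ℂ (A n)) (φ : ∀ n, D →⋆ₙₐ[ℂ] A n) :
    asympAlgebra B φ →⋆ₙₐ[ℂ] D :=
  (NonUnitalStarAlgHom.fst ℂ D (lp A ∞)).comp (incl _)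

theorem asympFst_surjective
    (hφ : ∀ d, ∃ b : ∀ n, A n, (∀ n, b n ∈ B n) ∧ Tendsto (fun n => ‖b n - φ n d‖) atTop (𝓝 0)) :
    Function.Surjective (asympFst B φ) := fun d => by
  obtain ⟨b, hb, ht⟩ := hφ d
  obtain ⟨C, hC⟩ := ht.bddAbove_range
  refine ⟨⟨(d, ⟨b, memℓp_infty ⟨C + ‖d‖, ?_⟩⟩), hb, ht⟩, rfl⟩
  rintro _ ⟨n, rfl⟩
  have h1 : ‖b n - φ n d‖ ≤ C := hC ⟨n, rfl⟩
  have h2 := NonUnitalStarAlgHom.norm_apply_le (φ n) d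
  have h3 := norm_sub_norm_le (b n) (φ n d)
  dsimp only
  linarith

theorem exists_lpExtend_near {p : D × lp A ∞} (hp : p ∈ asympAlgebra B φ) (h0 : p.1 = 0)
    {ε : ℝ} (hε : 0 < ε) : ∃ n, ‖p.2 - lpExtend n (fun i => p.2 i)‖ ≤ ε := by
  have h1 := hp.2
  simp only [h0, map_zero, sub_zero] at h1
  obtain ⟨n, hn⟩ := eventually_atTop.1 (Metric.tendsto_nhds.1 h1 ε hε)
  refine ⟨n, lp.norm_le_of_forall_le hε.le fun m => ?_⟩
  rw [lp.coeFn_sub, Pi.sub_apply, lpExtend_apply]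
  split_ifs with h
  · simpa using hε.le
  · have := hn m (not_lt.1 h)
    rw [dist_zero_right, norm_norm] at this
    simpa using this.le

/-- The lifting property only tests separable algebras, and bounded sequences do not form one. Being
asymptotic to `φ n d` leaves an extension of `D` by null sequences, and both pieces are separable.
-/
theorem asympAlgebra_separableSpace [SeparableSpace D] [∀ n, SeparableSpace (A n)]
    [h : IsClosed (asympAlgebra B φ : Set (D × lp A ∞))]
    (hs : Function.Surjective (asympFst B φ)) : SeparableSpace (asympAlgebra B φ) := by
  have := fun n => UniformSpace.secondCountable_of_separable (A n)
  choose s hs using hs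
  let T : Set (D × lp A ∞) := ⋃ n, Set.range fun x : ∀ i : Fin n, A i => ((0 : D), lpExtend n x)
  have hT : IsSeparable T := .iUnion fun n =>
    isSeparable_range (continuous_const.prodMk (continuous_lpExtend n))
  let S : Set (D × lp A ∞) := Set.range fun k => ((s (denseSeq D k) : asympAlgebra B φ) : D × lp A ∞)
  have hS : IsSeparable S := (countable_range _).isSeparable
  have hST : IsSeparable ((fun q : (D × lp A ∞) × (D × lp A ∞) => q.1 + q.2) '' (S ×ˢ T)) :=
    (hS.prod hT).image continuous_add
  refine (hST.closure.mono fun p hp => ?_).separableSpace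
  rw [Metric.mem_closure_iff]
  intro ε hε
  obtain ⟨k, hk⟩ := Metric.denseRange_iff.1 (denseRange_denseSeq D) p.1 (ε / 2) (by positivity)
  set t := s (denseSeq D k) with ht
  have h1 : ‖asympFst B φ (⟨p, hp⟩ - t)‖ < ε / 2 := by
    rw [map_sub, ht, hs]
    rwa [dist_eq_norm] at hk
  -- The difference of `p` and the chosen lift `t` splits as a small `q` with the same first
  -- coordinate plus a null sequence `r`, which is approximated by finite ones.
  obtain ⟨q, hq, hlt⟩ := exists_eq_norm_lt _ h1
  let r : asympAlgebra B φ := ⟨p, hp⟩ - t - q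
  have hr : r.1.1 = 0 := by
    change asympFst B φ (⟨p, hp⟩ - t - q) = 0
    rw [map_sub, hq, sub_self]
  obtain ⟨n, hn⟩ := exists_lpExtend_near r.2 hr (ε := ε / 2) (by positivity)
  refine ⟨t.1 + (0, lpExtend n fun i => r.1.2 i), ⟨(t.1, (0, lpExtend n fun i => r.1.2 i)),
    ⟨⟨k, rfl⟩, mem_iUnion.2 ⟨n, ⟨_, rfl⟩⟩⟩, rfl⟩, ?_⟩
  have h2 : p - (t.1 + (0, lpExtend n fun i => r.1.2 i)) =
      q.1 + (r.1.1, r.1.2 - lpExtend n fun i => r.1.2 i) := by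
    have h3 : p = t.1 + q.1 + r.1 := by
      change p = t.1 + q.1 + (p - t.1 - q.1)
      abel
    have h4 : (r.1.1, r.1.2 - lpExtend n fun i => r.1.2 i) =
        r.1 - (0, lpExtend n fun i => r.1.2 i) := Prod.ext (sub_zero _).symm rfl
    rw [h4]
    nth_rw 1 [h3]
    abel
  rw [dist_eq_norm, h2]
  have h5 : ‖((r.1.1, r.1.2 - lpExtend n fun i => r.1.2 i) : D × lp A ∞)‖ ≤ ε / 2 := by
    rw [hr, Prod.norm_mk, norm_zero]
    exact max_le (by positivity) hn
  have h6 : ‖q.1‖ < ε / 2 := hlt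
  linarith [norm_add_le q.1 (r.1.1, r.1.2 - lpExtend n fun i => r.1.2 i)]

/-- The algebra `D` is the quotient of `asympAlgebra` by the closure of the ideals `J n` of
sequences vanishing from `n` on. An approximate lift of the identity of `D` to the quotient by `J N`
can be evaluated at each coordinate `m ≥ N`, where its values lie in `B m` and are close to those of
`φ m`. -/
theorem HasLifts.eventually_perturb (hD : HasLifts D) [∀ n, SeparableSpace (A n)]
    (hB : ∀ n, IsClosed (B n : Set (A n)))
    (hφ : ∀ d, ∃ b : ∀ n, A n, (∀ n, b n ∈ B n) ∧ Tendsto (fun n => ‖b n - φ n d‖) atTop (𝓝 0))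
    (F : Finset D) (ε : ℝ) (hε : 0 < ε) :
    ∀ᶠ n in atTop, ∃ ψ : D →⋆ₙₐ[ℂ] A n, (∀ d, ψ d ∈ B n) ∧ ∀ d ∈ F, ‖ψ d - φ n d‖ < ε := by
  have hcl : IsClosed (asympAlgebra B φ : Set (D × lp A ∞)) := isClosed_asympAlgebra hB
  have hs := asympFst_surjective hφ
  have := hD.separable
  have := asympAlgebra_separableSpace hs
  let Jinf : ClosedIdeal (asympAlgebra B φ) := kerIdeal (asympFst B φ)
  let J : ℕ → ClosedIdeal (asympAlgebra B φ) := asympIdeal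
  have hle : ∀ n, (J n).toSubmodule ≤ Jinf.toSubmodule := fun n p hp => hp.1
  let e : Jinf.Quotient →⋆ₙₐ[ℂ] D := Jinf.lift (asympFst B φ) fun _ h => h
  have he : Function.Injective e := Jinf.lift_injective _ fun _ => Iff.rfl
  obtain ⟨Φ, hΦ⟩ := exists_comp_eq e he (NonUnitalStarAlgHom.id ℂ D) fun d => by
    obtain ⟨p, hp⟩ := hs d
    exact ⟨Jinf.proj p, hp⟩
  obtain ⟨N, Ψ, hΨ⟩ := hD.lifts (asympAlgebra B φ) J
    (fun n p hp => ⟨hp.1, fun m hm => hp.2 m (by omega)⟩) Jinf hle (by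
      refine subset_antisymm (fun p hp => ?_)
        (closure_minimal (iUnion_subset fun n p hp => hle n hp) Jinf.isClosed)
      rw [Metric.mem_closure_iff]
      intro η hη
      obtain ⟨n, hn⟩ := exists_lpExtend_near p.2 hp (ε := η / 2) (by positivity)
      have hmem : ((0, lpExtend n fun i => p.1.2 i) : D × lp A ∞) ∈ asympAlgebra B φ := by
        refine ⟨fun m => ?_, ?_⟩
        · dsimp only
          rw [lpExtend_apply]
          split_ifs
          · exact p.2.1 m
          · exact zero_mem _
        · refine tendsto_const_nhds.congr' ?_
          filter_upwards [eventually_ge_atTop n] with m hm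
          rw [lpExtend_apply, dif_neg (not_lt.2 hm), map_zero, sub_zero, norm_zero]
      refine ⟨⟨_, hmem⟩, mem_iUnion.2 ⟨n, rfl, fun m hm => ?_⟩, ?_⟩
      · change lpExtend n (fun i => p.1.2 i) m = 0
        rw [lpExtend_apply, dif_neg (not_lt.2 hm)]
      · rw [dist_eq_norm]
        change ‖p.1 - ((0, lpExtend n fun i => p.1.2 i) : D × lp A ∞)‖ < η
        rw [Prod.norm_def]
        have h1 : (p.1 - ((0, lpExtend n fun i => p.1.2 i) : D × lp A ∞)).1 = 0 := by
          change p.1.1 - 0 = 0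
          rw [sub_zero]
          exact hp
        rw [h1, norm_zero]
        exact max_lt hη (lt_of_le_of_lt hn (by linarith)))
    Φ F (ε / 2) (by positivity)
  -- Stated for every representative `p` of `Ψ d`, since from the index `N` on all of them have the
  -- same coordinates.
  have key : ∀ d ∈ F, ∀ᶠ m in atTop, ∀ p : asympAlgebra B φ, (J N).proj p = Ψ d → N ≤ m →
      ‖p.1.2 m - φ m d‖ < ε := by
    intro d hd
    obtain ⟨p, hp⟩ := (J N).proj_surjective (Ψ d)
    have h1 := hΨ d hd
    rw [← hp, ClosedIdeal.factor_proj, ← NonUnitalStarAlgHom.norm_map e he, map_sub, hΦ] at h1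
    change ‖p.1.1 - d‖ < ε / 2 at h1
    filter_upwards [Metric.tendsto_nhds.1 p.2.2 (ε / 2) (by positivity)] with m hm q hq hNm
    rw [dist_zero_right, norm_norm] at hm
    have h2 : q.1.2 m = p.1.2 m := by
      have h3 := ((J N).proj_eq_iff.1 (hq.trans hp.symm)).2 m hNm
      exact sub_eq_zero.1 h3
    rw [h2]
    have h4 : p.1.2 m - φ m d = (p.1.2 m - φ m p.1.1) + φ m (p.1.1 - d) := by
      rw [map_sub]
      abel
    rw [h4]
    have h5 := NonUnitalStarAlgHom.norm_apply_le (φ m) (p.1.1 - d)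
    linarith [norm_add_le (p.1.2 m - φ m p.1.1) (φ m (p.1.1 - d))]
  filter_upwards [(Filter.eventually_all_finset F).2 key, eventually_ge_atTop N] with m hm hNm
  let ev : asympAlgebra B φ →⋆ₙₐ[ℂ] A m :=
    (lpEval m).comp ((NonUnitalStarAlgHom.snd ℂ D (lp A ∞)).comp (incl _))
  let χ := (J N).lift ev fun p hp => hp.2 m hNm
  refine ⟨χ.comp Ψ, fun d => ?_, fun d hd => ?_⟩
  · obtain ⟨p, hp⟩ := (J N).proj_surjective (Ψ d)
    rw [NonUnitalStarAlgHom.comp_apply, ← hp]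
    exact p.2.1 m
  · obtain ⟨p, hp⟩ := (J N).proj_surjective (Ψ d)
    rw [NonUnitalStarAlgHom.comp_apply, ← hp]
    exact hm d hd p hp hNm

end Asymptotic

/-- Almost inclusions of `D` in a closed *-subalgebra can be perturbed to inclusions. -/
theorem HasLifts.exists_perturb {D : Type u} [NonUnitalCStarAlgebra D] (hD : HasLifts D)
    (F : Finset D) (ε : ℝ) (hε : 0 < ε) :
    ∃ (G : Finset D) (δ : ℝ), 0 < δ ∧ ∀ (A : Type u) [NonUnitalCStarAlgebra A] [SeparableSpace A]
      (B : NonUnitalStarSubalgebra ℂ A), IsClosed (B : Set A) → ∀ φ : D →⋆ₙₐ[ℂ] A,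
      (∀ g ∈ G, ∃ b ∈ B, ‖φ g - b‖ < δ) →
      ∃ ψ : D →⋆ₙₐ[ℂ] A, (∀ d, ψ d ∈ B) ∧ ∀ d ∈ F, ‖ψ d - φ d‖ < ε := by
  classical
  -- Counterexamples for the first `n` terms of a dense sequence and `δ = 1 / (n + 1)` give maps `φ
  -- n` that are asymptotically contained in `B n` at every `d`, which contradicts
  -- `eventually_perturb`.
  by_contra! hcon
  have := hD.separable
  have hpos : ∀ n : ℕ, (0 : ℝ) < 1 / ((n : ℝ) + 1) := fun n => by positivity
  choose A iA sA B hB φ hφ hno using fun n : ℕ =>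
    hcon ((Finset.range n).image (denseSeq D)) (1 / ((n : ℝ) + 1)) (hpos n)
  have hlim : ∀ d, ∃ b : ∀ n, A n, (∀ n, b n ∈ B n) ∧
      Tendsto (fun n => ‖b n - φ n d‖) atTop (𝓝 0) := by
    intro d
    have h1 : ∀ n, ∃ b ∈ B n, ‖φ n d - b‖ <
        Metric.infDist (φ n d) (B n : Set (A n)) + 1 / ((n : ℝ) + 1) := fun n => by
      obtain ⟨b, hb, hlt⟩ := (Metric.infDist_lt_iff ⟨0, zero_mem (B n)⟩).1
        (lt_add_of_pos_right (Metric.infDist (φ n d) (B n : Set (A n))) (hpos n))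
      exact ⟨b, hb, by rwa [← dist_eq_norm]⟩
    choose b hb hlt using h1
    refine ⟨b, hb, ?_⟩
    have h2 : Tendsto (fun n => Metric.infDist (φ n d) (B n : Set (A n))) atTop (𝓝 0) := by
      rw [Metric.tendsto_nhds]
      intro η hη
      obtain ⟨k, hk⟩ := Metric.denseRange_iff.1 (denseRange_denseSeq D) d (η / 2) (by positivity)
      have h3 := Metric.tendsto_nhds.1 (tendsto_one_div_add_atTop_nhds_zero_nat (𝕜 := ℝ)) (η / 2)
        (half_pos hη)
      filter_upwards [h3, eventually_gt_atTop k] with n hn hkn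
      obtain ⟨c, hc, hclt⟩ := hφ n (denseSeq D k)
        (Finset.mem_image_of_mem _ (Finset.mem_range.2 hkn))
      rw [Real.dist_0_eq_abs, abs_of_nonneg (hpos n).le] at hn
      rw [Real.dist_0_eq_abs, abs_of_nonneg Metric.infDist_nonneg]
      refine (Metric.infDist_le_dist_of_mem hc).trans_lt ?_
      have h4 := norm_hom_sub_le (φ n) d (denseSeq D k)
      rw [dist_eq_norm] at hk ⊢
      have h5 := norm_sub_le_norm_sub_add_norm_sub (φ n d) (φ n (denseSeq D k)) c
      linarith
    have h6 := h2.add (tendsto_one_div_add_atTop_nhds_zero_nat (𝕜 := ℝ))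
    rw [add_zero] at h6
    refine squeeze_zero (fun n => norm_nonneg _) (fun n => ?_) h6
    rw [norm_sub_rev]
    exact (hlt n).le
  obtain ⟨n, ψ, hψ, hψF⟩ := (hD.eventually_perturb hB hlim F ε hε).exists
  obtain ⟨d, hd, hle⟩ := hno n ψ hψ
  exact (hψF d hd).not_ge hle

/-! ### Finite direct sums of algebras with the lifting property -/

/-- The factorization `e = star b * b` is recorded because `exists_orthogonal_lifts` expects
positive elements in that form. -/
theorem exists_approxUnit {A : Type*} [NonUnitalCStarAlgebra A] (F : Finset A) {ε : ℝ}
    (hε : 0 < ε) :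
    ∃ e b : A, e = star b * b ∧ ‖e‖ ≤ 1 ∧ ∀ a ∈ F, ‖a - e * a * e‖ < ε := by
  let _ := CStarAlgebra.spectralOrder A
  have _ := CStarAlgebra.spectralOrderedRing A
  have h := CStarAlgebra.increasingApproximateUnit A
  have h1 : ∀ a ∈ F, ∀ᶠ e in CStarAlgebra.approximateUnit A,
      ‖a - a * e‖ < ε / 2 ∧ ‖a - e * a‖ < ε / 2 := fun a _ => by
    have h2 := Metric.tendsto_nhds.1 (h.tendsto_mul_left a) (ε / 2) (half_pos hε)
    have h3 := Metric.tendsto_nhds.1 (h.tendsto_mul_right a) (ε / 2) (half_pos hε)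
    filter_upwards [h2, h3] with e he he'
    rw [dist_comm, dist_eq_norm] at he he'
    exact ⟨he, he'⟩
  obtain ⟨e, he, he0, he1⟩ := (((Filter.eventually_all_finset F).2 h1).and
    (h.eventually_nonneg.and h.eventually_norm)).exists
  obtain ⟨b, hb⟩ := CStarAlgebra.nonneg_iff_eq_star_mul_self.1 he0
  refine ⟨e, b, hb, he1, fun a ha => ?_⟩
  have h4 : a - e * a * e = (a - e * a) + e * (a - a * e) := by noncomm_ring
  rw [h4]
  have h5 : ‖e * (a - a * e)‖ ≤ ‖a - a * e‖ :=
    (norm_mul_le _ _).trans (mul_le_of_le_one_left (norm_nonneg _) he1)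
  linarith [norm_add_le (a - e * a) (e * (a - a * e)), (he a ha).1, (he a ha).2]

/-- The lifting property is applied to `H` and the ideals `J n ∩ H`. Their union is dense in `Jinf ∩
H` because `H` is hereditary: an element `j` of `J n` close to an element of `H` is moved into `H`
as `e * j * e`, with `e` from an approximate unit of `H`. -/
theorem HasLifts.lift_hereditary {D : Type u} [NonUnitalCStarAlgebra D] (hD : HasLifts D)
    (B : Type u) [NonUnitalCStarAlgebra B] [SeparableSpace B]
    (J : ℕ → ClosedIdeal B) (hJ : ∀ n, (J n).toSubmodule ≤ (J (n + 1)).toSubmodule)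
    (Jinf : ClosedIdeal B) (hle : ∀ n, (J n).toSubmodule ≤ Jinf.toSubmodule)
    (hcl : (Jinf.toSubmodule : Set B) = closure (⋃ n, ((J n).toSubmodule : Set B)))
    (H : NonUnitalStarSubalgebra ℂ B) (hH : IsClosed (H : Set B))
    (her : ∀ u ∈ H, ∀ v ∈ H, ∀ x, u * x * v ∈ H)
    (φ : D →⋆ₙₐ[ℂ] Jinf.Quotient) (hφ : ∀ d, ∃ b ∈ H, Jinf.proj b = φ d)
    (F : Finset D) (ε : ℝ) (hε : 0 < ε) :
    ∃ (n : ℕ) (ψ : D →⋆ₙₐ[ℂ] (J n).Quotient), (∀ d, ∃ b ∈ H, (J n).proj b = ψ d) ∧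
      ∀ d ∈ F, ‖ClosedIdeal.factor (hle n) (ψ d) - φ d‖ < ε := by
  have := subalgebra_separableSpace H
  have hinj := ClosedIdeal.comapMap_injective (incl H) Jinf
  obtain ⟨φ', hφ'⟩ := exists_comp_eq (Jinf.comapMap (incl H)) hinj φ fun d => by
    obtain ⟨b, hb, h⟩ := hφ d
    exact ⟨(Jinf.comap (incl H)).proj ⟨b, hb⟩, h⟩
  obtain ⟨n, ψ, hψ⟩ := hD.lifts H (fun n => (J n).comap (incl H))
    (fun n x hx => ClosedIdeal.mem_comap.2 (hJ n (ClosedIdeal.mem_comap.1 hx)))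
    (Jinf.comap (incl H))
    (fun n x hx => ClosedIdeal.mem_comap.2 (hle n (ClosedIdeal.mem_comap.1 hx))) (by
      refine subset_antisymm (fun x hx => ?_) (closure_minimal (iUnion_subset fun n x hx =>
        ClosedIdeal.mem_comap.2 (hle n (ClosedIdeal.mem_comap.1 hx))) (ClosedIdeal.isClosed _))
      have hx' : (x : B) ∈ (Jinf.toSubmodule : Set B) := ClosedIdeal.mem_comap.1 hx
      rw [hcl] at hx'
      rw [Metric.mem_closure_iff]
      intro η hη
      obtain ⟨e, -, -, he1, he⟩ := exists_approxUnit {x} (half_pos hη)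
      obtain ⟨j, hj, hlt⟩ := Metric.mem_closure_iff.1 hx' (η / 2) (half_pos hη)
      obtain ⟨n, hn⟩ := mem_iUnion.1 hj
      refine ⟨⟨e * j * e, her e e.2 e e.2 j⟩, mem_iUnion.2 ⟨n, ?_⟩, ?_⟩
      · exact ClosedIdeal.mem_comap.2 ((J n).mul_mem_right _ ((J n).mul_mem_left _ hn))
      · rw [dist_eq_norm] at hlt ⊢
        change ‖(x : B) - e * j * e‖ < η
        have h1 : ‖(x : B) - e * x * e‖ < η / 2 := he x (Finset.mem_singleton_self x)
        have h2 : (x : B) - e * j * e = (x - e * x * e) + e * (x - j) * e := by noncomm_ring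
        have he1' : ‖(e : B)‖ ≤ 1 := he1
        have h3 : ‖(e : B) * (x - j) * e‖ ≤ ‖(x : B) - j‖ := by
          refine (norm_mul_le _ _).trans ((mul_le_of_le_one_right (norm_nonneg _) he1').trans ?_)
          exact (norm_mul_le _ _).trans (mul_le_of_le_one_left (norm_nonneg _) he1')
        rw [h2]
        linarith [norm_add_le ((x : B) - e * x * e) (e * (x - j) * e)])
    φ' F ε hε
  refine ⟨n, ((J n).comapMap (incl H)).comp ψ, fun d => ?_, fun d hd => ?_⟩
  · obtain ⟨b, hb⟩ := ((J n).comap (incl H)).proj_surjective (ψ d)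
    exact ⟨b, b.2, by rw [NonUnitalStarAlgHom.comp_apply, ← hb]; rfl⟩
  · refine lt_of_le_of_lt ?_ (hψ d hd)
    rw [← hφ' d, ← NonUnitalStarAlgHom.norm_map _ hinj, map_sub, NonUnitalStarAlgHom.comp_apply]
    obtain ⟨b, hb⟩ := ((J n).comap (incl H)).proj_surjective (ψ d)
    rw [← hb]
    rfl

/-- The sum of *-homomorphisms with orthogonal ranges. -/
def orthogonalSum {D₁ D₂ E : Type*} [NonUnitalCStarAlgebra D₁] [NonUnitalCStarAlgebra D₂]
    [NonUnitalCStarAlgebra E] (f : D₁ →⋆ₙₐ[ℂ] E) (g : D₂ →⋆ₙₐ[ℂ] E)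
    (h : ∀ d e, f d * g e = 0 ∧ g e * f d = 0) : D₁ × D₂ →⋆ₙₐ[ℂ] E where
  toFun p := f p.1 + g p.2
  map_smul' c p := by simp
  map_zero' := by simp
  map_add' p q := by
    simp only [Prod.fst_add, Prod.snd_add, map_add]
    abel
  map_mul' p q := by
    simp only [Prod.fst_mul, Prod.snd_mul, map_mul, add_mul, mul_add, (h _ _).1, (h _ _).2]
    abel
  map_star' p := by
    simp only [Prod.fst_star, Prod.snd_star, map_star, star_add]

/-- The two-sided annihilator of a self-adjoint set. -/
def annihilator {B : Type*} [NonUnitalCStarAlgebra B] (S : Set B) (hS : ∀ s ∈ S, star s ∈ S) :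
    NonUnitalStarSubalgebra ℂ B where
  carrier := {x | ∀ s ∈ S, x * s = 0 ∧ s * x = 0}
  add_mem' := fun {x y} hx hy s hs => by
    rw [add_mul, mul_add, (hx s hs).1, (hx s hs).2, (hy s hs).1, (hy s hs).2, add_zero]
    exact ⟨rfl, rfl⟩
  zero_mem' := fun s _ => ⟨zero_mul s, mul_zero s⟩
  mul_mem' := fun {x y} hx hy s hs => by
    rw [mul_assoc, ← mul_assoc s, (hx s hs).2, (hy s hs).1, mul_zero, zero_mul]
    exact ⟨rfl, rfl⟩
  smul_mem' := fun c x hx s hs => by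
    rw [smul_mul_assoc, mul_smul_comm, (hx s hs).1, (hx s hs).2, smul_zero]
    exact ⟨rfl, rfl⟩
  star_mem' := fun {x} hx s hs => by
    have h := hx _ (hS s hs)
    constructor
    · rw [← star_inj, star_mul, star_star, star_zero, h.2]
    · rw [← star_inj, star_mul, star_star, star_zero, h.1]

section Annihilator

variable {B : Type*} [NonUnitalCStarAlgebra B] {S : Set B} {hS : ∀ s ∈ S, star s ∈ S}

theorem isClosed_annihilator : IsClosed (annihilator S hS : Set B) := by
  change IsClosed {x | ∀ s ∈ S, x * s = 0 ∧ s * x = 0}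
  simp only [ofPred_forall, ofPred_and]
  refine isClosed_iInter fun s => isClosed_iInter fun _ => IsClosed.inter ?_ ?_
  · exact isClosed_eq (by fun_prop) continuous_const
  · exact isClosed_eq (by fun_prop) continuous_const

theorem annihilator_hereditary {u w : B} (hu : u ∈ annihilator S hS) (hw : w ∈ annihilator S hS)
    (x : B) : u * x * w ∈ annihilator S hS := fun s hs => by
  rw [mul_assoc _ w, (hw s hs).1, mul_zero, mul_assoc u, ← mul_assoc s, (hu s hs).2, zero_mul]
  exact ⟨rfl, rfl⟩

end Annihilator

theorem exists_selfAdjoint_lift {A B : Type*} [NonUnitalCStarAlgebra A] [NonUnitalCStarAlgebra B]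
    (f : A →⋆ₙₐ[ℂ] B) (hf : Function.Surjective f) {b : B} (hb : star b = b) :
    ∃ a, star a = a ∧ f a = b := by
  obtain ⟨a, rfl⟩ := hf b
  refine ⟨(2⁻¹ : ℂ) • (a + star a), ?_, ?_⟩
  · rw [star_smul, star_add, star_star, add_comm]
    simp
  · rw [map_smul, map_add, map_star, hb, ← two_smul ℂ (f a), smul_smul]
    simp

/-- The difference of the two orthogonal positive elements lifts to a self-adjoint `a`. Functional
calculus commutes with `f`, so the positive and negative parts of `a` are orthogonal lifts. -/
theorem exists_orthogonal_lifts {A B : Type*} [NonUnitalCStarAlgebra A] [NonUnitalCStarAlgebra B]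
    (f : A →⋆ₙₐ[ℂ] B) (hf : Function.Surjective f) (x y : B) (h : star x * x * (star y * y) = 0) :
    ∃ p q : A, star p = p ∧ star q = q ∧ p * q = 0 ∧ q * p = 0 ∧ f p = star x * x ∧
      f q = star y * y := by
  obtain ⟨a, ha, hfa⟩ := exists_selfAdjoint_lift f hf (b := star x * x - star y * y)
    (by simp)
  have hsa : IsSelfAdjoint a := ha
  have hpos : f (a⁺) = (f a)⁺ :=
    f.map_cfcₙ (·⁺ : ℝ → ℝ) a (by fun_prop) (by simp) (continuous_hom f) hsa (hsa.map f)
  have hneg : f (a⁻) = (f a)⁻ :=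
    f.map_cfcₙ (·⁻ : ℝ → ℝ) a (by fun_prop) (by simp) (continuous_hom f) hsa (hsa.map f)
  let _ := CStarAlgebra.spectralOrder B
  have _ := CStarAlgebra.spectralOrderedRing B
  have hu := CFC.posPart_negPart_unique hfa h (star_mul_self_nonneg x) (star_mul_self_nonneg y)
  refine ⟨a⁺, a⁻, ?_, ?_, CFC.posPart_mul_negPart a, CFC.negPart_mul_posPart a,
    hpos.trans hu.1, hneg.trans hu.2⟩
  · exact (cfcₙ_predicate (p := IsSelfAdjoint) (·⁺ : ℝ → ℝ) a).star_eq
  · exact (cfcₙ_predicate (p := IsSelfAdjoint) (·⁻ : ℝ → ℝ) a).star_eq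

/-- A map that only almost lands in the image of `H` is first perturbed into that image and then
lifted inside `H`. The data `G` and `δ` depend on `D`, `F` and `ε` alone, so approximate units can
be chosen for them afterwards. -/
theorem HasLifts.lift_near_hereditary {D : Type u} [NonUnitalCStarAlgebra D] (hD : HasLifts D)
    (F : Finset D) (ε : ℝ) (hε : 0 < ε) :
    ∃ (G : Finset D) (δ : ℝ), 0 < δ ∧ ∀ (B : Type u) [NonUnitalCStarAlgebra B] [SeparableSpace B]
      (J : ℕ → ClosedIdeal B) (_ : ∀ n, (J n).toSubmodule ≤ (J (n + 1)).toSubmodule)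
      (Jinf : ClosedIdeal B) (hle : ∀ n, (J n).toSubmodule ≤ Jinf.toSubmodule)
      (_ : (Jinf.toSubmodule : Set B) = closure (⋃ n, ((J n).toSubmodule : Set B)))
      (H : NonUnitalStarSubalgebra ℂ B) (_ : IsClosed (H : Set B))
      (_ : ∀ u ∈ H, ∀ v ∈ H, ∀ x, u * x * v ∈ H)
      (φ : D →⋆ₙₐ[ℂ] Jinf.Quotient) (_ : ∀ g ∈ G, ∃ b ∈ H, ‖φ g - Jinf.proj b‖ < δ),
      ∃ (n : ℕ) (ψ : D →⋆ₙₐ[ℂ] (J n).Quotient), (∀ d, ∃ b ∈ H, (J n).proj b = ψ d) ∧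
        ∀ d ∈ F, ‖ClosedIdeal.factor (hle n) (ψ d) - φ d‖ < ε := by
  obtain ⟨G, δ, hδ, hG⟩ := hD.exists_perturb F (ε / 2) (half_pos hε)
  refine ⟨G, δ, hδ, fun B _ _ J hJ Jinf hle hcl H hH her φ hφ => ?_⟩
  have := quotient_separableSpace Jinf
  obtain ⟨φ', hφ', hF⟩ := hG Jinf.Quotient (H.map Jinf.proj) (isClosed_map _ _ hH) φ
    fun g hg => by
      obtain ⟨b, hb, hlt⟩ := hφ g hg
      exact ⟨Jinf.proj b, ⟨b, hb, rfl⟩, hlt⟩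
  obtain ⟨n, ψ, hψ, hψF⟩ := hD.lift_hereditary B J hJ Jinf hle hcl H hH her φ' hφ' F (ε / 2)
    (half_pos hε)
  refine ⟨n, ψ, hψ, fun d hd => ?_⟩
  have := norm_sub_le_norm_sub_add_norm_sub (ClosedIdeal.factor (hle n) (ψ d)) (φ' d) (φ d)
  linarith [hF d hd, hψF d hd]

/-- Lifts of the two summands add up to a homomorphism only if their ranges are orthogonal.
Approximate units of the summands have orthogonal images under `φ`; lifting these to orthogonal `p`
and `q` separates two hereditary subalgebras into which the summands are lifted independently. -/
theorem HasLifts.prod {D₁ D₂ : Type u} [NonUnitalCStarAlgebra D₁] [NonUnitalCStarAlgebra D₂]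
    (h₁ : HasLifts D₁) (h₂ : HasLifts D₂) : HasLifts (D₁ × D₂) where
  separable := by
    have := h₁.separable
    have := h₂.separable
    infer_instance
  lifts B _ _ J hJ Jinf hle hcl φ F ε hε := by
    classical
    obtain ⟨G₁, δ₁, hδ₁, hG₁⟩ := h₁.lift_near_hereditary (F.image Prod.fst) (ε / 2) (half_pos hε)
    obtain ⟨G₂, δ₂, hδ₂, hG₂⟩ := h₂.lift_near_hereditary (F.image Prod.snd) (ε / 2) (half_pos hε)
    obtain ⟨e₁, b₁, rfl, -, he₁⟩ := exists_approxUnit G₁ hδ₁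
    obtain ⟨e₂, b₂, rfl, -, he₂⟩ := exists_approxUnit G₂ hδ₂
    obtain ⟨p, q, hp, hq, hpq, hqp, hφp, hφq⟩ := exists_orthogonal_lifts Jinf.proj
      Jinf.proj_surjective (φ (b₁, 0)) (φ (0, b₂)) (by
        rw [← map_star, ← map_star, ← map_mul, ← map_mul, ← map_mul, Prod.star_def, Prod.star_def,
          Prod.mk_mul_mk, Prod.mk_mul_mk, Prod.mk_mul_mk]
        simp only [star_zero, mul_zero, zero_mul]
        exact map_zero φ)
    rw [← map_star, ← map_mul] at hφp hφq
    -- Annihilators are closed and hereditary by their form. The double annihilator contains `p`,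
    -- the single one contains `q`, and they annihilate each other.
    let H₂ := annihilator {p} (by rintro _ rfl; rw [hp]; rfl)
    let H₁ := annihilator (H₂ : Set B) fun _ hx => star_mem (s := H₂) hx
    have hq₂ : q ∈ H₂ := by
      rintro _ rfl
      exact ⟨hqp, hpq⟩
    have hp₁ : p ∈ H₁ := fun y hy => (hy p rfl).symm
    obtain ⟨n₁, ψ₁, hψ₁, hF₁⟩ := hG₁ B J hJ Jinf hle hcl H₁ isClosed_annihilator
      (fun u hu v hv x => annihilator_hereditary hu hv x)
      (φ.comp (NonUnitalStarAlgHom.inl ℂ D₁ D₂)) (fun g hg => by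
        obtain ⟨c, hc⟩ := Jinf.proj_surjective (φ (g, 0))
        -- With `e₁ = star b₁ * b₁` the image of this element is `φ (e₁ * g * e₁, 0)`, which is
        -- `δ₁`-close to `φ (g, 0)`.
        refine ⟨p * c * p, annihilator_hereditary hp₁ hp₁ c, ?_⟩
        rw [map_mul, map_mul, hc, hφp, NonUnitalStarAlgHom.comp_apply,
          NonUnitalStarAlgHom.inl_apply, ← map_mul, ← map_mul]
        refine (norm_hom_sub_le φ _ _).trans_lt ?_
        have := he₁ g hg
        simpa [Prod.norm_def, Prod.star_def] using this)
    obtain ⟨n₂, ψ₂, hψ₂, hF₂⟩ := hG₂ B J hJ Jinf hle hcl H₂ isClosed_annihilator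
      (fun u hu v hv x => annihilator_hereditary hu hv x)
      (φ.comp (NonUnitalStarAlgHom.inr ℂ D₁ D₂)) (fun g hg => by
        obtain ⟨c, hc⟩ := Jinf.proj_surjective (φ (0, g))
        refine ⟨q * c * q, annihilator_hereditary hq₂ hq₂ c, ?_⟩
        rw [map_mul, map_mul, hc, hφq, NonUnitalStarAlgHom.comp_apply,
          NonUnitalStarAlgHom.inr_apply, ← map_mul, ← map_mul]
        refine (norm_hom_sub_le φ _ _).trans_lt ?_
        have := he₂ g hg
        simpa [Prod.norm_def, Prod.star_def] using this)
    have hmono : Monotone fun n => (J n).toSubmodule := monotone_nat_of_le_succ hJ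
    let n := max n₁ n₂
    have hn₁ : (J n₁).toSubmodule ≤ (J n).toSubmodule := hmono (le_max_left _ _)
    have hn₂ : (J n₂).toSubmodule ≤ (J n).toSubmodule := hmono (le_max_right _ _)
    refine ⟨n, orthogonalSum ((ClosedIdeal.factor hn₁).comp ψ₁) ((ClosedIdeal.factor hn₂).comp ψ₂)
      fun d e => ?_, fun d hd => ?_⟩
    · obtain ⟨x, hx, hxd⟩ := hψ₁ d
      obtain ⟨y, hy, hye⟩ := hψ₂ e
      rw [NonUnitalStarAlgHom.comp_apply, NonUnitalStarAlgHom.comp_apply, ← hxd, ← hye,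
        ClosedIdeal.factor_proj, ClosedIdeal.factor_proj, ← map_mul, ← map_mul, (hx y hy).1,
        (hx y hy).2, map_zero]
      exact ⟨rfl, rfl⟩
    · change ‖ClosedIdeal.factor (hle n) (ClosedIdeal.factor hn₁ (ψ₁ d.1) +
        ClosedIdeal.factor hn₂ (ψ₂ d.2)) - φ d‖ < ε
      have hd' : φ d = φ (d.1, 0) + φ (0, d.2) := by
        rw [← map_add]
        simp
      rw [map_add, ClosedIdeal.factor_factor, ClosedIdeal.factor_factor, hd', add_sub_add_comm]
      have h3 := hF₁ d.1 (Finset.mem_image_of_mem _ hd)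
      have h4 := hF₂ d.2 (Finset.mem_image_of_mem _ hd)
      refine (norm_add_le _ _).trans_lt ?_
      rw [NonUnitalStarAlgHom.comp_apply, NonUnitalStarAlgHom.inl_apply] at h3
      rw [NonUnitalStarAlgHom.comp_apply, NonUnitalStarAlgHom.inr_apply] at h4
      linarith

theorem HasLifts.pi_fin : ∀ (m : ℕ) (S : Fin m → Type u) [∀ i, NonUnitalCStarAlgebra (S i)]
    (_ : ∀ i, HasLifts (S i)), HasLifts (∀ i, S i)
  | 0, S, _, _ => HasLifts.of_subsingleton
  | m + 1, S, _, h => by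
    let f : (∀ i, S i) →⋆ₙₐ[ℂ] S 0 × (∀ i : Fin m, S i.succ) :=
      { toFun := fun x => (x 0, fun i => x i.succ)
        map_smul' := fun _ _ => rfl
        map_zero' := rfl
        map_add' := fun _ _ => rfl
        map_mul' := fun _ _ => rfl
        map_star' := fun _ => rfl }
    have hf : Function.Bijective f := by
      refine ⟨fun x y hxy => ?_, fun p => ⟨Fin.cons p.1 p.2, rfl⟩⟩
      have h0 : x 0 = y 0 := congrArg Prod.fst hxy
      have h1 : (f x).2 = (f y).2 := congrArg Prod.snd hxy
      funext i
      refine Fin.cases h0 (fun j => ?_) i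
      exact congrFun h1 j
    exact ((h 0).prod (HasLifts.pi_fin m (fun i => S i.succ) fun i => h i.succ)).of_equiv
      (StarAlgEquiv.ofBijective f hf).symm

theorem IsSumOfSimpleWSP.hasLifts {D : Type u} [NonUnitalCStarAlgebra D] (h : IsSumOfSimpleWSP D) :
    HasLifts D := by
  obtain ⟨m, S, _, hS, ⟨e⟩⟩ := h
  exact (HasLifts.pi_fin m S fun i => (hS i).2.hasLifts).of_equiv e.symm

/-- Injectivity of a *-homomorphism on a direct sum of simple algebras is detected by finitely many
elements. -/
theorem IsSumOfSimpleWSP.exists_witnesses {D : Type u} [NonUnitalCStarAlgebra D]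
    (h : IsSumOfSimpleWSP D) : ∃ W : Finset D, (∀ w ∈ W, ‖w‖ = 1) ∧
      ∀ (B : Type u) [NonUnitalCStarAlgebra B] (f : D →⋆ₙₐ[ℂ] B), (∀ w ∈ W, f w ≠ 0) →
        Function.Injective f := by
  classical
  obtain ⟨m, S, _, hS, ⟨e⟩⟩ := h
  have h1 : ∀ i, ∃ s : S i, ‖s‖ = 1 := fun i => by
    have := (hS i).1.1
    obtain ⟨x, hx⟩ := exists_ne (0 : S i)
    refine ⟨((‖x‖⁻¹ : ℝ) : ℂ) • x, ?_⟩
    rw [norm_smul]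
    simp [hx]
  choose s hs using h1
  refine ⟨Finset.univ.image fun i => e.symm (Pi.single i (s i)), ?_, fun B _ f hf => ?_⟩
  · intro w hw
    obtain ⟨i, -, rfl⟩ := Finset.mem_image.1 hw
    rw [StarAlgEquiv.norm_map, Pi.norm_single, hs]
  rw [injective_iff_map_eq_zero]
  intro d hd
  rw [← e.map_eq_zero_iff]
  funext i
  by_contra hne
  let g : S i →⋆ₙₐ[ℂ] B :=
    { toFun := fun x => f (e.symm (Pi.single i x))
      map_smul' := fun c x => by rw [Pi.single_smul, map_smul, map_smul]; rfl
      map_zero' := by rw [Pi.single_zero, map_zero, map_zero]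
      map_add' := fun x y => by rw [Pi.single_add, map_add, map_add]
      map_mul' := fun x y => by rw [Pi.single_mul, map_mul, map_mul]
      map_star' := fun x => by rw [Pi.single_star, map_star, map_star] }
  -- Multiplication by an element of the `i`-th summand isolates the `i`-th coordinate. If that
  -- coordinate is nonzero, the ideal `kerIdeal g` of a simple algebra is nonzero, hence everything,
  -- and it contains the witness.
  have hg : star (e d i) * e d i ∈ (kerIdeal g).toSubmodule := by
    change f (e.symm (Pi.single i (star (e d i) * e d i))) = 0
    have h2 : Pi.single i (star (e d i) * e d i) = Pi.single i (star (e d i)) * e d := by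
      funext j
      by_cases hj : j = i
      · subst hj
        simp
      · simp [hj]
    rw [h2, map_mul, StarAlgEquiv.symm_apply_apply, map_mul, hd, mul_zero]
  rcases (hS i).1.2 (kerIdeal g) with hbot | htop
  · rw [hbot, Submodule.mem_bot, CStarRing.star_mul_self_eq_zero_iff] at hg
    exact hne hg
  · have h3 : s i ∈ (kerIdeal g).toSubmodule := by rw [htop]; trivial
    exact hf _ (Finset.mem_image_of_mem _ (Finset.mem_univ i)) h3

open CXAlgebra

/-! ### Norms in `C(X)`-algebras -/

theorem point_le {X : Type v} [TopologicalSpace X] [T1Space X] {Y : Closeds X} {y : X}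
    (h : y ∈ Y) : point y ≤ Y := fun _ hz => by
  rw [Set.eq_of_mem_singleton hz]
  exact h

section Norms

variable {X : Type v} [TopologicalSpace X] [CompactSpace X] {A : Type u} [NonUnitalCStarAlgebra A]
  [CXAlgebra X A]

theorem norm_act_le (f : C(X, ℂ)) (a : A) : ‖act f a‖ ≤ ‖f‖ * ‖a‖ := by
  refine ((act f : A →L[ℂ] A).le_opNorm a).trans (mul_le_mul_of_nonneg_right ?_ (norm_nonneg a))
  rw [act, DoubleCentralizer.norm_fst]
  exact NonUnitalStarAlgHom.norm_apply_le _ f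

theorem act_one (a : A) : act (1 : C(X, ℂ)) a = a := by
  have h : IsClosed {a : A | act (1 : C(X, ℂ)) a = a} :=
    isClosed_eq (act (1 : C(X, ℂ))).continuous continuous_id
  have hd : Dense {a : A | act (1 : C(X, ℂ)) a = a} := (nondegenerate (X := X) (A := A)).mono
    fun x hx => by
      induction hx using Submodule.span_induction with
      | mem y hy =>
        obtain ⟨f, b, rfl⟩ := hy
        change act (1 : C(X, ℂ)) (act f b) = act f b
        rw [← act_act, one_mul]
      | zero => exact map_zero _
      | add y z _ _ hy hz =>
        change act (1 : C(X, ℂ)) (y + z) = y + z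
        rw [map_add, hy, hz]
      | smul c y _ hy =>
        change act (1 : C(X, ℂ)) (c • y) = c • y
        rw [map_smul, hy]
  have := hd.closure_eq
  rw [h.closure_eq] at this
  exact (this ▸ mem_univ a : a ∈ {a : A | act (1 : C(X, ℂ)) a = a})

theorem act_sub (f g : C(X, ℂ)) (a : A) : act (f - g) a = act f a - act g a := by
  have := act_add (f - g) g a
  rw [sub_add_cancel] at this
  rw [this, add_sub_cancel_right]

theorem res_eq_zero_iff {Y : Closeds X} {a : A} :
    res A Y a = 0 ↔ a ∈ (vanishingIdeal X A Y).toSubmodule :=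
  (vanishingIdeal X A Y).proj_eq_zero_iff

theorem res_surjective (Y : Closeds X) : Function.Surjective (res A Y) :=
  (vanishingIdeal X A Y).proj_surjective

theorem resTo_res {Y Z : Closeds X} (h : Z ≤ Y) (a : A) : resTo A h (res A Y a) = res A Z a := rfl

theorem act_res (Y : Closeds X) (f : C(X, ℂ)) (a : A) : act f (res A Y a) = res A Y (act f a) := rfl

theorem norm_res_mono {Y Z : Closeds X} (h : Z ≤ Y) (a : A) : ‖res A Z a‖ ≤ ‖res A Y a‖ :=
  NonUnitalStarAlgHom.norm_apply_le (resTo A h) (res A Y a)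

theorem res_act_eq_zero {Y : Closeds X} {f : C(X, ℂ)} (h : ∀ y ∈ Y, f y = 0) (a : A) :
    res A Y (act f a) = 0 :=
  res_eq_zero_iff.2 (subset_closure (Submodule.subset_span ⟨f, a, h, rfl⟩))

theorem res_act_congr {Y : Closeds X} {f g : C(X, ℂ)} (h : ∀ y ∈ Y, f y = g y) (a : A) :
    res A Y (act f a) = res A Y (act g a) := by
  rw [← sub_eq_zero, ← map_sub, ← act_sub]
  exact res_act_eq_zero (fun y hy => by rw [ContinuousMap.sub_apply, h y hy, sub_self]) a

/-- Restriction to `Y` sees only the values of `f` on `Y`, where `f` agrees with its radial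
truncation to modulus at most `c`. -/
theorem norm_res_act_le {Y : Closeds X} {f : C(X, ℂ)} {c : ℝ} (hc : 0 < c)
    (h : ∀ y ∈ Y, ‖f y‖ ≤ c) (a : A) : ‖res A Y (act f a)‖ ≤ c * ‖a‖ := by
  have hpos : ∀ z : ℂ, 0 < max c ‖z‖ := fun z => lt_max_of_lt_left hc
  let g : C(X, ℂ) := ⟨fun x => ((c / max c ‖f x‖ : ℝ) : ℂ) * f x, by
    refine (Complex.continuous_ofReal.comp (continuous_const.div (by fun_prop)
      fun x => (hpos _).ne')).mul f.continuous⟩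
  have hg : ‖g‖ ≤ c := (ContinuousMap.norm_le _ hc.le).2 fun x => by
    change ‖((c / max c ‖f x‖ : ℝ) : ℂ) * f x‖ ≤ c
    rw [norm_mul, Complex.norm_real, Real.norm_of_nonneg (div_pos hc (hpos _)).le, div_mul_eq_mul_div,
      div_le_iff₀ (hpos _)]
    exact mul_le_mul_of_nonneg_left (le_max_right _ _) hc.le
  have hfg : ∀ y ∈ Y, f y = g y := fun y hy => by
    change f y = ((c / max c ‖f y‖ : ℝ) : ℂ) * f y
    rw [max_eq_left (h y hy), div_self hc.ne', Complex.ofReal_one, one_mul]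
  rw [res_act_congr hfg]
  refine (NonUnitalStarAlgHom.norm_apply_le _ _).trans ((norm_act_le g a).trans ?_)
  exact mul_le_mul_of_nonneg_right hg (norm_nonneg a)

theorem mul_mem_vanishingIdeal_sup {Y Z : Closeds X} {a b : A}
    (ha : a ∈ (vanishingIdeal X A Y).toSubmodule) (hb : b ∈ (vanishingIdeal X A Z).toSubmodule) :
    a * b ∈ (vanishingIdeal X A (Y ⊔ Z)).toSubmodule := by
  have hcl := (vanishingIdeal X A (Y ⊔ Z)).isClosed
  have h1 : ∀ (f : C(X, ℂ)) (c : A), (∀ y ∈ Y, f y = 0) →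
      act f c * b ∈ ((vanishingIdeal X A (Y ⊔ Z)).toSubmodule : Set A) := by
    intro f c hf
    rw [← hcl.closure_eq]
    refine map_mem_closure (f := fun x => act f c * x) (by fun_prop) hb fun x hx => ?_
    induction hx using Submodule.span_induction with
    | mem x hx =>
      obtain ⟨g, d, hg, rfl⟩ := hx
      refine res_eq_zero_iff.1 ?_
      dsimp only
      rw [← mul_act, ← act_mul, ← act_act]
      refine res_act_eq_zero (fun y hy => ?_) _
      rw [ContinuousMap.mul_apply]
      have hy' : y ∈ (Y : Set X) ∪ Z := by rwa [← Closeds.coe_sup]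
      rcases hy' with hy | hy
      · rw [hf y hy, mul_zero]
      · rw [hg y hy, zero_mul]
    | zero => simp
    | add x y _ _ hx hy => dsimp only at hx hy ⊢; rw [mul_add]; exact Submodule.add_mem _ hx hy
    | smul c x _ hx => dsimp only at hx ⊢; rw [mul_smul_comm]; exact Submodule.smul_mem _ c hx
  change a * b ∈ ((vanishingIdeal X A (Y ⊔ Z)).toSubmodule : Set A)
  rw [← hcl.closure_eq]
  refine map_mem_closure (f := fun x => x * b) (by fun_prop) ha fun x hx => ?_
  induction hx using Submodule.span_induction with
  | mem x hx =>
    obtain ⟨f, c, hf, rfl⟩ := hx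
    exact h1 f c hf
  | zero => simp
  | add x y _ _ hx hy => dsimp only at hx hy ⊢; rw [add_mul]; exact Submodule.add_mem _ hx hy
  | smul c x _ hx => dsimp only at hx ⊢; rw [smul_mul_assoc]; exact Submodule.smul_mem _ c hx

/-- An element of both ideals is a limit of products `a * e` with `e` in an approximate unit of the
second ideal, and products of the two ideals vanish on the union. -/
theorem mem_vanishingIdeal_sup {Y Z : Closeds X} {a : A} :
    a ∈ (vanishingIdeal X A (Y ⊔ Z)).toSubmodule ↔
      a ∈ (vanishingIdeal X A Y).toSubmodule ∧ a ∈ (vanishingIdeal X A Z).toSubmodule := by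
  refine ⟨fun h => ⟨vanishingIdeal_mono le_sup_left h, vanishingIdeal_mono le_sup_right h⟩,
    fun h => ?_⟩
  change a ∈ ((vanishingIdeal X A (Y ⊔ Z)).toSubmodule : Set A)
  rw [← (vanishingIdeal X A (Y ⊔ Z)).isClosed.closure_eq, Metric.mem_closure_iff]
  intro ε hε
  obtain ⟨e, he, -, -, hlt⟩ := (vanishingIdeal X A Z).exists_approx a
    ⟨h.2, ClosedIdeal.star_mem _ h.2⟩ ε hε
  exact ⟨a * e, mul_mem_vanishingIdeal_sup h.1 he.1, by rwa [dist_eq_norm]⟩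

theorem norm_res_sup (Y Z : Closeds X) (a : A) :
    ‖res A (Y ⊔ Z) a‖ = max ‖res A Y a‖ ‖res A Z a‖ :=
  (vanishingIdeal X A (Y ⊔ Z)).norm_proj_eq ((res A Y).prod (res A Z)) (fun a => by
    rw [mem_vanishingIdeal_sup, ← res_eq_zero_iff, ← res_eq_zero_iff]
    exact Prod.mk_eq_zero.symm) a

theorem res_bot (a : A) : res A (⊥ : Closeds X) a = 0 := by
  rw [← act_one (X := X) a]
  exact res_act_eq_zero (fun y hy => absurd hy (by simp [← SetLike.mem_coe])) a

theorem norm_res_finset_sup_lt {ι : Type*} (s : Finset ι) (Y : ι → Closeds X) (a : A) {c : ℝ}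
    (hc : 0 < c) (h : ∀ i ∈ s, ‖res A (Y i) a‖ < c) : ‖res A (s.sup Y) a‖ < c := by
  classical
  induction s using Finset.induction_on with
  | empty => rwa [Finset.sup_empty, res_bot, norm_zero]
  | insert i s _ ih =>
    rw [Finset.sup_insert, norm_res_sup]
    exact max_lt (h i (Finset.mem_insert_self i s))
      (ih fun j hj => h j (Finset.mem_insert_of_mem hj))

theorem res_top_eq_zero {a : A} (h : res A (⊤ : Closeds X) a = 0) : a = 0 := by
  have h1 : a ∈ closure ((Submodule.span ℂ {a : A | ∃ (f : C(X, ℂ)) (b : A),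
      (∀ y ∈ (⊤ : Closeds X), f y = 0) ∧ act f b = a} : Submodule ℂ A) : Set A) :=
    res_eq_zero_iff.1 h
  have h2 : Submodule.span ℂ {a : A | ∃ (f : C(X, ℂ)) (b : A),
      (∀ y ∈ (⊤ : Closeds X), f y = 0) ∧ act f b = a} = ⊥ := by
    rw [Submodule.span_eq_bot]
    rintro _ ⟨f, b, hf, rfl⟩
    have : f = 0 := by
      ext x
      exact hf x (by rw [← SetLike.mem_coe, Closeds.coe_top]; trivial)
    rw [this, act_zero]
  rw [h2] at h1
  have h3 : a ∈ closure ({0} : Set A) := h1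
  rwa [closure_singleton] at h3

variable [T2Space X]

/-- Upper semicontinuity of the norm, bounding restrictions to all closed subsets of a neighbourhood
at once. For a product `act f b` with `f x = 0` the neighbourhood is the set where `f` is small;
sums and limits follow. -/
theorem exists_isOpen_norm_res_lt_of_res_eq_zero {x : X} {a : A} (ha : res A (point x) a = 0)
    {ε : ℝ} (hε : 0 < ε) :
    ∃ U : Set X, IsOpen U ∧ x ∈ U ∧ ∀ Y : Closeds X, (Y : Set X) ⊆ U → ‖res A Y a‖ < ε := by
  have key : ∀ k ∈ Submodule.span ℂ {a : A | ∃ (f : C(X, ℂ)) (b : A),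
      (∀ y ∈ (point x : Closeds X), f y = 0) ∧ act f b = a}, ∀ η : ℝ, 0 < η →
      ∃ U : Set X, IsOpen U ∧ x ∈ U ∧ ∀ Y : Closeds X, (Y : Set X) ⊆ U → ‖res A Y k‖ < η := by
    intro k hk
    induction hk using Submodule.span_induction with
    | mem k hk =>
      obtain ⟨f, b, hf, rfl⟩ := hk
      intro η hη
      have hpos : 0 < η / (‖b‖ + 1) := by positivity
      refine ⟨{y | ‖f y‖ < η / (‖b‖ + 1)}, isOpen_lt (by fun_prop) continuous_const, ?_,
        fun Y hY => ?_⟩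
      · change ‖f x‖ < _
        rwa [hf x rfl, norm_zero]
      · refine (norm_res_act_le hpos (fun y hy => (hY hy : ‖f y‖ < _).le) b).trans_lt ?_
        rw [div_mul_eq_mul_div, div_lt_iff₀ (by positivity)]
        nlinarith [norm_nonneg b]
    | zero => exact fun η hη => ⟨univ, isOpen_univ, mem_univ x, fun Y _ => by simpa using hη⟩
    | add k l _ _ hk hl =>
      intro η hη
      obtain ⟨U, hU, hxU, hkU⟩ := hk (η / 2) (half_pos hη)
      obtain ⟨V, hV, hxV, hlV⟩ := hl (η / 2) (half_pos hη)
      refine ⟨U ∩ V, hU.inter hV, ⟨hxU, hxV⟩, fun Y hY => ?_⟩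
      have h1 := hkU Y (hY.trans inter_subset_left)
      have h2 := hlV Y (hY.trans inter_subset_right)
      rw [map_add]
      linarith [norm_add_le (res A Y k) (res A Y l)]
    | smul c k _ hk =>
      intro η hη
      obtain ⟨U, hU, hxU, hkU⟩ := hk (η / (‖c‖ + 1)) (by positivity)
      refine ⟨U, hU, hxU, fun Y hY => ?_⟩
      have h1 := hkU Y hY
      rw [lt_div_iff₀ (by positivity)] at h1
      rw [map_smul, norm_smul]
      nlinarith [norm_nonneg (res A Y k)]
  obtain ⟨k, hk, hlt⟩ := Metric.mem_closure_iff.1 (res_eq_zero_iff.1 ha :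
    a ∈ closure (Submodule.span ℂ {a : A | ∃ (f : C(X, ℂ)) (b : A),
      (∀ y ∈ (point x : Closeds X), f y = 0) ∧ act f b = a} : Set A)) (ε / 2) (half_pos hε)
  obtain ⟨U, hU, hxU, hkU⟩ := key k hk (ε / 2) (half_pos hε)
  refine ⟨U, hU, hxU, fun Y hY => ?_⟩
  rw [dist_eq_norm] at hlt
  have h1 := NonUnitalStarAlgHom.norm_apply_le (res A Y) (a - k)
  have h2 : res A Y a = res A Y (a - k) + res A Y k := by rw [← map_add, sub_add_cancel]
  rw [h2]
  linarith [norm_add_le (res A Y (a - k)) (res A Y k), hkU Y hY]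

theorem exists_isOpen_norm_res_lt {x : X} {a : A} {c : ℝ} (h : ‖res A (point x) a‖ < c) :
    ∃ U : Set X, IsOpen U ∧ x ∈ U ∧ ∀ Y : Closeds X, (Y : Set X) ⊆ U → ‖res A Y a‖ < c := by
  obtain ⟨b, hb, hlt⟩ := exists_eq_norm_lt _ h
  have h0 : res A (point x) (a - b) = 0 := by rw [map_sub, hb, sub_self]
  obtain ⟨U, hU, hxU, h1⟩ := exists_isOpen_norm_res_lt_of_res_eq_zero h0 (sub_pos.2 hlt)
  refine ⟨U, hU, hxU, fun Y hY => ?_⟩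
  have h2 : res A Y a = res A Y (a - b) + res A Y b := by rw [← map_add, sub_add_cancel]
  rw [h2]
  linarith [norm_add_le (res A Y (a - b)) (res A Y b), h1 Y hY,
    NonUnitalStarAlgHom.norm_apply_le (res A Y) b]

/-- Upper semicontinuity spreads the bound from each fiber to a closed neighbourhood, and finitely
many of these cover `Y`. As a consequence, elements of `A(Y)` and their norms are controlled
fiberwise. -/
theorem norm_res_lt_of_fibers {Y : Closeds X} {a : A} {c : ℝ} (hc : 0 < c)
    (h : ∀ y ∈ Y, ‖res A (point y) a‖ < c) : ‖res A Y a‖ < c := by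
  have h1 : ∀ y ∈ (Y : Set X), ∃ V : Closeds X, (V : Set X) ∈ 𝓝 y ∧ ‖res A V a‖ < c := by
    intro y hy
    obtain ⟨U, hU, hyU, hlt⟩ := exists_isOpen_norm_res_lt (h y hy)
    obtain ⟨V, hV, hVc, hVU⟩ := exists_mem_nhds_isClosed_subset (hU.mem_nhds hyU)
    exact ⟨⟨V, hVc⟩, hV, hlt _ hVU⟩
  choose! V hV hlt using h1
  obtain ⟨t, ht, hcov⟩ := Y.isClosed.isCompact.elim_nhds_subcover (fun y => (V y : Set X)) hV
  refine (norm_res_mono (Z := Y) (Y := t.sup V) ?_ a).trans_lt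
    (norm_res_finset_sup_lt t V a hc fun y hy => hlt y (ht y hy))
  intro y hy
  rw [← SetLike.mem_coe, Closeds.coe_finset_sup, Finset.sup_eq_iSup]
  exact hcov hy

theorem norm_res_le_of_fibers {Y : Closeds X} {a : A} {c : ℝ} (hc : 0 ≤ c)
    (h : ∀ y ∈ Y, ‖res A (point y) a‖ ≤ c) : ‖res A Y a‖ ≤ c :=
  le_of_forall_pos_le_add fun _ hε => (norm_res_lt_of_fibers (by positivity)
    fun y hy => (h y hy).trans_lt (lt_add_of_pos_right c hε)).le

theorem res_eq_iff_fibers {Y : Closeds X} {a b : A} :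
    res A Y a = res A Y b ↔ ∀ y ∈ Y, res A (point y) a = res A (point y) b := by
  refine ⟨fun h y hy => congrArg (resTo A (point_le hy)) h, fun h => ?_⟩
  rw [← sub_eq_zero, ← map_sub, ← norm_le_zero_iff]
  refine norm_res_le_of_fibers le_rfl fun y hy => ?_
  rw [map_sub, h y hy, sub_self, norm_zero]

theorem restrict_ext {Y : Closeds X} {a b : Restrict A Y}
    (h : ∀ y (hy : y ∈ Y), resTo A (point_le hy) a = resTo A (point_le hy) b) : a = b := by
  obtain ⟨a, rfl⟩ := res_surjective Y a
  obtain ⟨b, rfl⟩ := res_surjective Y b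
  exact res_eq_iff_fibers.2 h

theorem norm_restrict_le {Y : Closeds X} {a : Restrict A Y} {c : ℝ} (hc : 0 ≤ c)
    (h : ∀ y (hy : y ∈ Y), ‖resTo A (point_le hy) a‖ ≤ c) : ‖a‖ ≤ c := by
  obtain ⟨a, rfl⟩ := res_surjective Y a
  exact norm_res_le_of_fibers hc h

theorem eq_of_fibers {a b : A} (h : ∀ y : X, res A (point y) a = res A (point y) b) : a = b := by
  rw [← sub_eq_zero]
  refine res_top_eq_zero (X := X) ?_
  rw [map_sub, sub_eq_zero]
  exact res_eq_iff_fibers.2 fun y _ => h y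

end Norms

/-! ### Gluing -/

section Gluing

variable {X : Type v} [TopologicalSpace X] [CompactSpace X] [T2Space X] {A : Type u}
  [NonUnitalCStarAlgebra A] [CXAlgebra X A]

/-- The function equal to `f` on `Y` and to 0 on `Z` is well defined and continuous on the union;
Tietze extends it. -/
theorem exists_extension_of_disjoint_zero {Y Z : Closeds X} {f : C(X, ℂ)}
    (h : ∀ x ∈ Y ⊓ Z, f x = 0) : ∃ g : C(X, ℂ), (∀ y ∈ Y, g y = f y) ∧ ∀ z ∈ Z, g z = 0 := by
  classical
  let k : X → ℂ := fun x => if x ∈ Y then f x else 0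
  have hkY : ∀ y ∈ Y, k y = f y := fun y hy => if_pos hy
  have hkZ : ∀ z ∈ Z, k z = 0 := fun z hz => by
    by_cases hy : z ∈ Y
    · rw [hkY z hy]
      exact h z (by rw [← SetLike.mem_coe, Closeds.coe_inf]; exact ⟨hy, hz⟩)
    · exact if_neg hy
  have hk : ContinuousOn k ((Y : Set X) ∪ Z) :=
    (f.continuous.continuousOn.congr hkY).union_of_isClosed
      (continuousOn_const.congr hkZ) Y.isClosed Z.isClosed
  obtain ⟨g, hg⟩ := ContinuousMap.exists_restrict_eq (Y.isClosed.union Z.isClosed)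
    ⟨_, continuousOn_iff_continuous_domRestrict.1 hk⟩
  have hgk : ∀ x ∈ (Y : Set X) ∪ Z, g x = k x := fun x hx =>
    congrArg (fun q : C(((Y : Set X) ∪ Z : Set X), ℂ) => q ⟨x, hx⟩) hg
  exact ⟨g, fun y hy => (hgk y (Or.inl hy)).trans (hkY y hy),
    fun z hz => (hgk z (Or.inr hz)).trans (hkZ z hz)⟩

/-- In terms of ideals, the one of `Y ⊓ Z` lies in the sum of those of `Y` and `Z`. The image of the
ideal of `Z` in `A(Y)` is closed, so generators `act f b` suffice, and there `f` is replaced on `Z`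
by zero. -/
theorem exists_res_eq_zero_of_res_inf {Y Z : Closeds X} {a : A} (h : res A (Y ⊓ Z) a = 0) :
    ∃ b, res A Y b = res A Y a ∧ res A Z b = 0 := by
  let S := (vanishingIdeal X A Z).starPart.map (res A Y)
  have hS : IsClosed (S : Set (Restrict A Y)) :=
    isClosed_map _ _ (vanishingIdeal X A Z).isClosed_starPart
  suffices hmem : res A Y a ∈ (S : Set (Restrict A Y)) by
    obtain ⟨b, hb, hba⟩ := hmem
    exact ⟨b, hba, res_eq_zero_iff.2 hb.1⟩
  rw [← hS.closure_eq]
  refine map_mem_closure (continuous_hom (res A Y)) (res_eq_zero_iff.1 h) fun x hx => ?_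
  induction hx using Submodule.span_induction with
  | mem x hx =>
    obtain ⟨f, b, hf, rfl⟩ := hx
    obtain ⟨g, hgY, hgZ⟩ := exists_extension_of_disjoint_zero hf
    have hm := res_eq_zero_iff.1 (res_act_eq_zero hgZ b)
    exact ⟨act g b, ⟨hm, ClosedIdeal.star_mem _ hm⟩, res_act_congr hgY b⟩
  | zero => rw [map_zero]; exact zero_mem S
  | add x y _ _ hx hy => rw [map_add]; exact add_mem (S := NonUnitalStarSubalgebra ℂ _) hx hy
  | smul c x _ hx => rw [map_smul]; exact SMulMemClass.smul_mem (S := NonUnitalStarSubalgebra ℂ _) c hx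

/-- An element glued over the old sets is corrected on the new one by an element vanishing on the
union of the old ones. -/
theorem exists_glue {ι : Type*} (s : Finset ι) (Y : ι → Closeds X) (a : ι → A)
    (h : ∀ i ∈ s, ∀ j ∈ s, ∀ x ∈ Y i, x ∈ Y j → res A (point x) (a i) = res A (point x) (a j)) :
    ∃ b, ∀ i ∈ s, res A (Y i) b = res A (Y i) (a i) := by
  classical
  induction s using Finset.induction_on with
  | empty => exact ⟨0, fun i hi => absurd hi (Finset.notMem_empty i)⟩
  | insert k s hk ih =>
    obtain ⟨b, hb⟩ := ih fun i hi j hj => h i (Finset.mem_insert_of_mem hi) j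
      (Finset.mem_insert_of_mem hj)
    have h0 : res A (Y k ⊓ s.sup Y) (a k - b) = 0 := by
      rw [map_sub, sub_eq_zero]
      refine res_eq_iff_fibers.2 fun x hx => ?_
      rw [← SetLike.mem_coe, Closeds.coe_inf, Closeds.coe_finset_sup, Finset.sup_eq_iSup] at hx
      obtain ⟨i, hi⟩ := mem_iUnion.1 hx.2
      obtain ⟨his, hxi⟩ := mem_iUnion.1 hi
      rw [h k (Finset.mem_insert_self k s) i (Finset.mem_insert_of_mem his) x hx.1 hxi]
      exact (res_eq_iff_fibers.1 (hb i his) x hxi).symm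
    obtain ⟨c, hcY, hcs⟩ := exists_res_eq_zero_of_res_inf h0
    refine ⟨b + c, fun i hi => ?_⟩
    rcases Finset.mem_insert.1 hi with rfl | hi
    · rw [map_add, hcY, map_sub, add_sub_cancel]
    · have : res A (Y i) c = 0 := by
        have := congrArg (resTo A (Finset.le_sup (f := Y) hi)) hcs
        rwa [map_zero] at this
      rw [map_add, this, add_zero, hb i hi]

theorem restrict_ext_of_cover {n : ℕ} {Y : Fin n → Closeds X} {W : Closeds X} (hle : ∀ i, Y i ≤ W)
    (hW : ∀ x ∈ W, ∃ i, x ∈ Y i) {a b : Restrict A W}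
    (h : ∀ i, resTo A (hle i) a = resTo A (hle i) b) : a = b := by
  obtain ⟨a, rfl⟩ := res_surjective W a
  obtain ⟨b, rfl⟩ := res_surjective W b
  refine res_eq_iff_fibers.2 fun x hx => ?_
  obtain ⟨i, hi⟩ := hW x hx
  have h1 := h i
  rw [resTo_res, resTo_res] at h1
  exact res_eq_iff_fibers.1 h1 x hi

theorem exists_glue_restrict {n : ℕ} {Y : Fin n → Closeds X} (W : Closeds X) (hle : ∀ i, Y i ≤ W)
    (a : ∀ i, Restrict A (Y i))
    (h : ∀ i j x (hi : x ∈ Y i) (hj : x ∈ Y j),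
      resTo A (point_le hi) (a i) = resTo A (point_le hj) (a j)) :
    ∃ b : Restrict A W, ∀ i, resTo A (hle i) b = a i := by
  choose a' ha using fun i => res_surjective (Y i) (a i)
  obtain ⟨b, hb⟩ := exists_glue Finset.univ Y a' fun i _ j _ x hi hj => by
    have := h i j x hi hj
    rw [← ha, ← ha, resTo_res, resTo_res] at this
    exact this
  refine ⟨res A W b, fun i => ?_⟩
  rw [resTo_res, hb i (Finset.mem_univ i), ha i]

theorem exists_glueHom {n : ℕ} {E : Type*} [NonUnitalRing E] [Module ℂ E] [Star E]
    (Y : Fin n → Closeds X) (ψ : ∀ i, E →⋆ₙₐ[ℂ] Restrict A (Y i))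
    (h : ∀ e i j x (hi : x ∈ Y i) (hj : x ∈ Y j),
      resTo A (point_le hi) (ψ i e) = resTo A (point_le hj) (ψ j e))
    (W : Closeds X) (hle : ∀ i, Y i ≤ W) (hW : ∀ x ∈ W, ∃ i, x ∈ Y i) :
    ∃ ψ' : E →⋆ₙₐ[ℂ] Restrict A W, ∀ e i, resTo A (hle i) (ψ' e) = ψ i e := by
  choose k hk using fun e => exists_glue_restrict W hle (fun i => ψ i e) (h e)
  refine ⟨{
    toFun := k
    map_smul' := fun c d => restrict_ext_of_cover hle hW fun i => ?_
    map_zero' := restrict_ext_of_cover hle hW fun i => ?_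
    map_add' := fun d e => restrict_ext_of_cover hle hW fun i => ?_
    map_mul' := fun d e => restrict_ext_of_cover hle hW fun i => ?_
    map_star' := fun d => restrict_ext_of_cover hle hW fun i => ?_ }, hk⟩
  · rw [hk, map_smul, MonoidHom.id_apply, map_smul, hk]
  · rw [hk, map_zero, map_zero]
  · change resTo A (hle i) (k (d + e)) = resTo A (hle i) (k d + k e)
    rw [hk, map_add, map_add, hk, hk]
  · change resTo A (hle i) (k (d * e)) = resTo A (hle i) (k d * k e)
    rw [hk, map_mul, map_mul, hk, hk]
  · rw [hk, map_star, map_star, hk]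

theorem exists_glueHom_univ {n : ℕ} {E : Type*} [NonUnitalRing E] [Module ℂ E] [Star E]
    (Y : Fin n → Closeds X) (ψ : ∀ i, E →⋆ₙₐ[ℂ] Restrict A (Y i))
    (h : ∀ e i j x (hi : x ∈ Y i) (hj : x ∈ Y j),
      resTo A (point_le hi) (ψ i e) = resTo A (point_le hj) (ψ j e))
    (hY : ∀ x, ∃ i, x ∈ Y i) :
    ∃ η : E →⋆ₙₐ[ℂ] A, ∀ e i, res A (Y i) (η e) = ψ i e := by
  obtain ⟨ψ', hψ'⟩ := exists_glueHom Y ψ h ⊤ (fun _ => le_top) fun x _ => hY x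
  obtain ⟨η, hη⟩ := exists_comp_eq (res A (⊤ : Closeds X))
    ((injective_iff_map_eq_zero _).2 fun a ha => res_top_eq_zero ha) ψ' fun e => res_surjective _ _
  exact ⟨η, fun e i => by rw [← hψ', ← hη, resTo_res]⟩

end Gluing

open CXAlgebra

/-! ### Sections of trivial fields -/

section Sections

theorem exists_finite_partition {K : Type*} [TopologicalSpace K] [CompactSpace K] [T2Space K]
    {D : Type*} [NormedAddCommGroup D] (g : C(K, D)) {ε : ℝ} (hε : 0 < ε) :
    ∃ (t : Finset K) (ρ : t → C(K, ℝ)), (∀ i x, 0 ≤ ρ i x) ∧ (∀ x, ∑ i, ρ i x = 1) ∧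
      ∀ i x, ρ i x ≠ 0 → ‖g i - g x‖ < ε := by
  let U : K → Set K := fun y => {x | ‖g y - g x‖ < ε}
  have hU : ∀ y, IsOpen (U y) := fun y => isOpen_lt (by fun_prop) continuous_const
  obtain ⟨t, ht⟩ := isCompact_univ.elim_finite_subcover U hU fun x _ =>
    mem_iUnion.2 ⟨x, by simpa [U] using hε⟩
  obtain ⟨ρ, hρ⟩ := PartitionOfUnity.exists_isSubordinate isClosed_univ (fun i : t => U i)
    (fun i => hU i) (fun x hx => by
      obtain ⟨y, hy⟩ := mem_iUnion.1 (ht hx)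
      obtain ⟨hyt, hxy⟩ := mem_iUnion.1 hy
      exact mem_iUnion.2 ⟨⟨y, hyt⟩, hxy⟩)
  refine ⟨t, fun i => ρ i, fun i x => ρ.nonneg i x, fun x => ?_, fun i x hx => ?_⟩
  · rw [← ρ.sum_eq_one (mem_univ x), finsum_eq_sum_of_fintype]
  · exact hρ i (subset_tsupport _ hx)

variable {X : Type v} [TopologicalSpace X] [CompactSpace X] [T2Space X] {A : Type u}
  [NonUnitalCStarAlgebra A] [CXAlgebra X A] {D : Type*} [NonUnitalCStarAlgebra D]

theorem res_point_act (x : X) (f : C(X, ℂ)) (a : A) :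
    res A (point x) (act f a) = f x • res A (point x) a := by
  have h : ∀ y ∈ (point x : Closeds X), f y = (f x • (1 : C(X, ℂ))) y := fun y hy => by
    rw [Set.eq_of_mem_singleton hy]
    simp
  rw [res_act_congr h, act_smul, act_one, map_smul]

theorem resTo_point_act {P : Closeds X} {x : X} (hx : x ∈ P) (f : C(X, ℂ)) (a : Restrict A P) :
    resTo A (point_le hx) (act f a) = f x • resTo A (point_le hx) a := by
  obtain ⟨a, rfl⟩ := res_surjective P a
  rw [act_res, resTo_res, resTo_res, res_point_act]

variable {P : Closeds X} (φ : D →⋆ₙₐ[ℂ] Restrict A P)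
  (S : NonUnitalStarSubalgebra ℂ (Restrict A P))

/-- A partition of unity on whose supports `g` is nearly constant replaces `g` by a finite sum of
functions times constants. The corresponding element lies in `S` because `S` is stable under `C(X)`.
-/
theorem exists_approx_section (hact : ∀ (f : C(X, ℂ)), ∀ a ∈ S, act f a ∈ S) (hφ : ∀ d, φ d ∈ S)
    (g : C(P, D)) {ε : ℝ} (hε : 0 < ε) :
    ∃ a ∈ S, ∀ x (hx : x ∈ P),
      ‖resTo A (point_le hx) a - resTo A (point_le hx) (φ (g ⟨x, hx⟩))‖ ≤ ε := by
  obtain ⟨t, ρ, hρ0, hρ1, hρ⟩ := exists_finite_partition g hε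
  have hext : ∀ i : t, ∃ f : C(X, ℂ), ∀ x (hx : x ∈ P), f x = (ρ i ⟨x, hx⟩ : ℂ) := fun i => by
    obtain ⟨f, hf⟩ := ContinuousMap.exists_restrict_eq P.isClosed
      (⟨fun x => (ρ i x : ℂ), by fun_prop⟩ : C(P, ℂ))
    exact ⟨f, fun x hx => congrArg (fun q : C(P, ℂ) => q ⟨x, hx⟩) hf⟩
  choose f hf using hext
  refine ⟨∑ i, act (f i) (φ (g i)), sum_mem fun i _ => hact _ _ (hφ _), fun x hx => ?_⟩
  have h1 : resTo A (point_le hx) (∑ i, act (f i) (φ (g i))) -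
      resTo A (point_le hx) (φ (g ⟨x, hx⟩)) =
      resTo A (point_le hx) (φ (∑ i, (ρ i ⟨x, hx⟩ : ℂ) • (g i - g ⟨x, hx⟩))) := by
    simp only [smul_sub, Finset.sum_sub_distrib, ← Finset.sum_smul, ← Complex.ofReal_sum, hρ1,
      Complex.ofReal_one, one_smul, map_sub, map_sum, map_smul, resTo_point_act hx, hf _ x hx]
  rw [h1]
  refine (NonUnitalStarAlgHom.norm_apply_le _ _).trans
    ((NonUnitalStarAlgHom.norm_apply_le _ _).trans ?_)
  calc ‖∑ i, (ρ i ⟨x, hx⟩ : ℂ) • (g i - g ⟨x, hx⟩)‖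
      ≤ ∑ i, ρ i ⟨x, hx⟩ * ε := by
        refine norm_sum_le_of_le _ fun i _ => ?_
        rw [norm_smul, Complex.norm_real, Real.norm_of_nonneg (hρ0 _ _)]
        by_cases h0 : ρ i ⟨x, hx⟩ = 0
        · rw [h0, zero_mul, zero_mul]
        · exact mul_le_mul_of_nonneg_left (hρ i _ h0).le (hρ0 _ _)
    _ = ε := by rw [← Finset.sum_mul, hρ1, one_mul]

/-- The approximate sections are uniformly Cauchy over the fibers, hence Cauchy in `A(P)`. Keeping
track of `S` is what later gives the containment between levels. -/
theorem exists_section (hS : IsClosed (S : Set (Restrict A P)))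
    (hact : ∀ (f : C(X, ℂ)), ∀ a ∈ S, act f a ∈ S) (hφ : ∀ d, φ d ∈ S) (g : C(P, D)) :
    ∃ a ∈ S, ∀ x (hx : x ∈ P),
      resTo A (point_le hx) a = resTo A (point_le hx) (φ (g ⟨x, hx⟩)) := by
  choose a haS ha using fun n : ℕ => exists_approx_section φ S hact hφ g
    (ε := (1 / 2) ^ n) (by positivity)
  have hcau : CauchySeq a := by
    refine cauchySeq_of_le_tendsto_0 (fun n => 2 * (1 / 2 : ℝ) ^ n) (fun n m N hn hm => ?_) ?_
    · rw [dist_eq_norm]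
      refine norm_restrict_le (by positivity) fun x hx => ?_
      have hp : ∀ k, N ≤ k → (1 / 2 : ℝ) ^ k ≤ (1 / 2 : ℝ) ^ N := fun k hk =>
        pow_le_pow_of_le_one (by norm_num) (by norm_num) hk
      have h1 := ha n x hx
      have h2 := ha m x hx
      rw [norm_sub_rev] at h2
      rw [map_sub]
      have h3 := norm_sub_le_norm_sub_add_norm_sub (resTo A (point_le hx) (a n))
        (resTo A (point_le hx) (φ (g ⟨x, hx⟩))) (resTo A (point_le hx) (a m))
      linarith [hp n hn, hp m hm]
    · have := (tendsto_pow_atTop_nhds_zero_of_lt_one (r := (1 / 2 : ℝ)) (by norm_num)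
        (by norm_num)).const_mul 2
      simpa using this
  obtain ⟨b, hb⟩ := cauchySeq_tendsto_of_complete hcau
  refine ⟨b, hS.mem_of_tendsto hb (Eventually.of_forall haS), fun x hx => ?_⟩
  rw [← sub_eq_zero, ← norm_le_zero_iff]
  have h1 : Tendsto (fun n => ‖resTo A (point_le hx) (a n) -
      resTo A (point_le hx) (φ (g ⟨x, hx⟩))‖) atTop
      (𝓝 ‖resTo A (point_le hx) b - resTo A (point_le hx) (φ (g ⟨x, hx⟩))‖) :=
    ((((continuous_hom (resTo A (point_le hx))).tendsto b).comp hb).sub_const _).norm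
  exact le_of_tendsto_of_tendsto h1 (tendsto_pow_atTop_nhds_zero_of_lt_one (by norm_num)
    (by norm_num)) (Eventually.of_forall fun n => ha n x hx)

/-- The `C(P)`-linear extension `C(P, D) → A(P)` of a *-homomorphism `D → A(P)`. -/
theorem exists_sectionHom (hS : IsClosed (S : Set (Restrict A P)))
    (hact : ∀ (f : C(X, ℂ)), ∀ a ∈ S, act f a ∈ S) (hφ : ∀ d, φ d ∈ S) :
    ∃ Φ : C(P, D) →⋆ₙₐ[ℂ] Restrict A P, (∀ g, Φ g ∈ S) ∧ ∀ g x (hx : x ∈ P),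
      resTo A (point_le hx) (Φ g) = resTo A (point_le hx) (φ (g ⟨x, hx⟩)) := by
  choose k hkS hk using exists_section φ S hS hact hφ
  refine ⟨{
    toFun := k
    map_smul' := fun c g => restrict_ext fun x hx => ?_
    map_zero' := restrict_ext fun x hx => ?_
    map_add' := fun g h => restrict_ext fun x hx => ?_
    map_mul' := fun g h => restrict_ext fun x hx => ?_
    map_star' := fun g => restrict_ext fun x hx => ?_ }, hkS, hk⟩
  · rw [hk _ x hx, MonoidHom.id_apply, map_smul, hk _ x hx, ContinuousMap.smul_apply, map_smul,
      map_smul]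
  · rw [hk _ x hx, ContinuousMap.zero_apply, map_zero, map_zero]
  · change resTo A (point_le hx) (k (g + h)) = resTo A (point_le hx) (k g + k h)
    rw [hk _ x hx, map_add, hk _ x hx, hk _ x hx, ContinuousMap.add_apply, map_add, map_add]
  · change resTo A (point_le hx) (k (g * h)) = resTo A (point_le hx) (k g * k h)
    rw [hk _ x hx, map_mul, hk _ x hx, hk _ x hx, ContinuousMap.mul_apply, map_mul, map_mul]
  · rw [hk _ x hx, map_star, hk _ x hx, ContinuousMap.star_apply, map_star, map_star]

end Sections

open CXAlgebra MultiplierAlgebra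

/-! ### Direct sums of trivial fields as `C(Z)`-algebras -/

section SumAlgebra

variable {Z : Type v} [TopologicalSpace Z] [CompactSpace Z] {r : ℕ} (P : Fin r → Closeds Z)
  (D : Fin r → Type u) [∀ j, NonUnitalCStarAlgebra (D j)]

/-- Multiplication by a function on a direct sum of trivial fields. -/
def sumAct (f : C(Z, ℂ)) : (∀ j, C(P j, D j)) →L[ℂ] (∀ j, C(P j, D j)) :=
  LinearMap.mkContinuous
    { toFun := fun e j => ⟨fun z => f z • e j z, by fun_prop⟩
      map_add' := fun e e' => by
        ext j z
        exact smul_add _ _ _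
      map_smul' := fun c e => by
        ext j z
        exact smul_comm _ _ _ } ‖f‖ fun e => by
    refine (pi_norm_le_iff_of_nonneg (by positivity)).2 fun j =>
      (ContinuousMap.norm_le _ (by positivity)).2 fun z => ?_
    change ‖f z • e j z‖ ≤ _
    rw [norm_smul]
    exact mul_le_mul (f.norm_coe_le_norm _) (((e j).norm_coe_le_norm z).trans (norm_le_pi_norm e j))
      (norm_nonneg _) (norm_nonneg _)

variable {P D}

theorem sumAct_mul (f : C(Z, ℂ)) (e e' : ∀ j, C(P j, D j)) :
    sumAct P D f (e * e') = sumAct P D f e * e' := by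
  ext j z
  exact (smul_mul_assoc _ _ _).symm

theorem mul_sumAct (f : C(Z, ℂ)) (e e' : ∀ j, C(P j, D j)) :
    sumAct P D f (e * e') = e * sumAct P D f e' := by
  ext j z
  exact (mul_smul_comm _ _ _).symm

variable (P D)

/-- Multiplication by a function on a direct sum of trivial fields, as a multiplier. -/
def sumMultiplier (f : C(Z, ℂ)) : 𝓜(ℂ, ∀ j, C(P j, D j)) where
  toProd := (sumAct P D f, sumAct P D f)
  central e e' := by
    change sumAct P D f e * e' = e * sumAct P D f e'
    rw [← sumAct_mul, mul_sumAct]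

variable {P D}

theorem sumMultiplier_ext {S T : 𝓜(ℂ, ∀ j, C(P j, D j))} (h₁ : ∀ e j z, S.fst e j z = T.fst e j z)
    (h₂ : ∀ e j z, S.snd e j z = T.snd e j z) : S = T := by
  refine DoubleCentralizer.ext ℂ _ _ _ (Prod.ext ?_ ?_)
  · ext e j z
    exact h₁ e j z
  · ext e j z
    exact h₂ e j z

variable (P D)

/-- The `C(Z)`-algebra structure of a direct sum of trivial fields. -/
abbrev sumCXAlgebra : CXAlgebra Z (∀ j, C(P j, D j)) where
  θ :=
    { toFun := sumMultiplier P D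
      map_smul' := fun c f => sumMultiplier_ext (fun e j z => smul_assoc c (f z) (e j z))
        (fun e j z => smul_assoc c (f z) (e j z))
      map_zero' := sumMultiplier_ext (fun _ _ _ => zero_smul _ _) (fun _ _ _ => zero_smul _ _)
      map_add' := fun f g => sumMultiplier_ext (fun _ _ _ => add_smul _ _ _)
        (fun _ _ _ => add_smul _ _ _)
      map_mul' := fun f g => sumMultiplier_ext (fun _ _ _ => mul_smul _ _ _)
        (fun e j z => by
          change (f z * g z) • e j z = g z • f z • e j z
          rw [mul_comm, mul_smul])
      map_star' := fun f => sumMultiplier_ext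
        (fun e j z => by
          change star (f z) • e j z = star (f z • star (e j z))
          rw [star_smul, star_star])
        (fun e j z => by
          change star (f z) • e j z = star (f z • star (e j z))
          rw [star_smul, star_star]) }
  central f := by
    rw [Semigroup.mem_center_iff]
    intro T
    refine DoubleCentralizer.ext ℂ _ _ _ (Prod.ext ?_ ?_)
    · ext1 e
      change T.fst (sumAct P D f e) = sumAct P D f (T.fst e)
      refine eq_of_forall_mul fun y => ?_
      rw [← T.central, ← mul_sumAct, ← mul_sumAct, T.central]
    · ext1 e
      change sumAct P D f (T.snd e) = T.snd (sumAct P D f e)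
      rw [← star_inj]
      refine eq_of_forall_mul fun y => ?_
      rw [← star_inj, star_mul, star_mul, star_star, star_star, ← sumAct_mul, T.central, T.central,
        ← sumAct_mul]
  nondegenerate := by
    refine dense_univ.mono fun e _ => Submodule.subset_span ⟨1, e, ?_⟩
    ext j z
    exact one_smul _ _

theorem isElementary_sum (C : (D : Type u) → [NonUnitalCStarAlgebra D] → Prop) (hr : 1 ≤ r)
    (hne : ∀ j, (P j : Set Z).Nonempty) (hd : ∀ i j, i ≠ j → Disjoint (P i : Set Z) (P j : Set Z))
    (hcov : (⋃ j, (P j : Set Z)) = univ) (hC : ∀ j, C (D j)) :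
    letI := sumCXAlgebra P D
    IsElementary C Z (∀ j, C(P j, D j)) :=
  letI := sumCXAlgebra P D
  ⟨r, P, D, inferInstance, StarAlgEquiv.refl _ _, hr, hne, hd, hcov, hC, fun _ _ _ _ => rfl⟩

end SumAlgebra

/-- Restriction of functions along a continuous map. -/
def compHom {K L D : Type*} [TopologicalSpace K] [CompactSpace K] [TopologicalSpace L]
    [CompactSpace L] [NonUnitalCStarAlgebra D] (i : C(K, L)) : C(L, D) →⋆ₙₐ[ℂ] C(K, D) where
  toFun g := g.comp i
  map_smul' _ _ := rfl
  map_zero' := rfl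
  map_add' _ _ := rfl
  map_mul' _ _ := rfl
  map_star' _ := rfl

/-! ### Elementary subalgebras over a closed set -/

/-- Finitely many pairwise disjoint nonempty closed sets, at least one. -/
structure ClosedPartition (X : Type v) [TopologicalSpace X] where
  r : ℕ
  one_le : 1 ≤ r
  part : Fin r → Closeds X
  nonempty : ∀ j, (part j : Set X).Nonempty
  disjoint : ∀ i j, ∀ x ∈ part i, x ∈ part j → i = j

namespace ClosedPartition

variable {X : Type v} [TopologicalSpace X]

/-- The union of the parts. -/
def union (Y : ClosedPartition X) : Closeds X := Finset.univ.sup Y.part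

theorem mem_union {Y : ClosedPartition X} {x : X} : x ∈ Y.union ↔ ∃ j, x ∈ Y.part j := by
  rw [← SetLike.mem_coe, union, Closeds.coe_finset_sup, Finset.sup_eq_iSup]
  simp

theorem part_le (Y : ClosedPartition X) (j : Fin Y.r) : Y.part j ≤ Y.union := fun _ hx =>
  mem_union.2 ⟨j, hx⟩

/-- The parts as closed subsets of the union. -/
def subPart (Y : ClosedPartition X) (j : Fin Y.r) : Closeds Y.union :=
  ⟨{z | (z : X) ∈ Y.part j}, (Y.part j).isClosed.preimage continuous_subtype_val⟩

/-- The inclusion of a part. -/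
def partMap (Y : ClosedPartition X) (j : Fin Y.r) : C(Y.part j, Y.subPart j) :=
  ⟨fun x => ⟨⟨x, Y.part_le j x.2⟩, x.2⟩, by fun_prop⟩

end ClosedPartition

/-- The subalgebra `S` of `A` is the preimage of the image of a `C`-elementary `C(Y)`-algebra in
`A(Y)`. -/
def IsElementaryPreimage (C : (D : Type u) → [NonUnitalCStarAlgebra D] → Prop)
    {X : Type v} [TopologicalSpace X] [CompactSpace X] {A : Type u} [NonUnitalCStarAlgebra A]
    [CXAlgebra X A] (Y : Closeds X) (S : NonUnitalStarSubalgebra ℂ A) : Prop :=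
  ∃ (E : Type (max u v)) (_ : NonUnitalCStarAlgebra E) (_ : CXAlgebra Y E)
    (ψ : E →⋆ₙₐ[ℂ] Restrict A Y),
    IsElementary.{u, v} C Y E ∧ Function.Injective ψ ∧
    (∀ (f : C(X, ℂ)) (e : E), ψ (act (resFun Y f) e) = act f (ψ e)) ∧
    ∀ a, a ∈ S ↔ ∃ e, ψ e = res A Y a

/-- Choose `t'` in `T` with the restriction of `s`. Over `Y` the difference `t - t'` has norm below
`c + c'`, so some `b` in `T` with that restriction is equally small. Then `t - b` restricts to `s`,
hence lies in both algebras, at distance less than `c + (c + c')` from `a`. -/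
theorem exists_mem_inf_norm_lt {X : Type v} [TopologicalSpace X] [CompactSpace X] {A : Type u}
    [NonUnitalCStarAlgebra A] [CXAlgebra X A] (Y : Closeds X) {S T : NonUnitalStarSubalgebra ℂ A}
    (hT : IsClosed (T : Set A)) (hS : ∀ a b, a ∈ S → res A Y a = res A Y b → b ∈ S)
    (hST : ∀ a ∈ S, ∃ t ∈ T, res A Y t = res A Y a) {a t s : A} (ht : t ∈ T) (hs : s ∈ S)
    {c c' : ℝ} (hat : ‖a - t‖ < c) (has : ‖res A Y a - res A Y s‖ < c') :
    ∃ b, b ∈ S ∧ b ∈ T ∧ ‖a - b‖ < 2 * c + c' := by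
  obtain ⟨t', ht', hts⟩ := hST s hs
  have h1 : ‖res A Y (t - t')‖ < c + c' := by
    have h2 : res A Y (t - t') = res A Y (t - a) + (res A Y a - res A Y s) := by
      rw [map_sub, map_sub, hts]
      abel
    have h3 := NonUnitalStarAlgHom.norm_apply_le (res A Y) (t - a)
    rw [norm_sub_rev t a] at h3
    rw [h2]
    linarith [norm_add_le (res A Y (t - a)) (res A Y a - res A Y s)]
  obtain ⟨b, hb, hbt, hlt⟩ := exists_mem_eq_norm_lt (res A Y) T hT (sub_mem ht ht') h1
  refine ⟨t - b, hS s _ hs ?_, sub_mem ht hb, ?_⟩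
  · rw [map_sub, hbt, map_sub, sub_sub_cancel, hts]
  · have h2 : a - (t - b) = (a - t) + b := by abel
    rw [h2]
    linarith [norm_add_le (a - t) b]

section Step

variable {X : Type v} [TopologicalSpace X] [CompactSpace X] [T2Space X] {A : Type u}
  [NonUnitalCStarAlgebra A] [CXAlgebra X A]

theorem exists_cutoff (Y : ClosedPartition X) :
    ∃ u : Fin Y.r → C(X, ℂ), ∀ i j, ∀ x ∈ Y.part j, u i x = if i = j then 1 else 0 := by
  have h : ∀ i, ∃ g : C(X, ℂ), (∀ y ∈ Y.part i, g y = (1 : C(X, ℂ)) y) ∧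
      ∀ z ∈ (Finset.univ.erase i).sup Y.part, g z = 0 := by
    intro i
    refine exists_extension_of_disjoint_zero fun x hx => ?_
    rw [← SetLike.mem_coe, Closeds.coe_inf, Closeds.coe_finset_sup, Finset.sup_eq_iSup] at hx
    obtain ⟨j, hj⟩ := mem_iUnion.1 hx.2
    obtain ⟨hji, hxj⟩ := mem_iUnion.1 hj
    exact absurd (Y.disjoint j i x hxj hx.1) (Finset.ne_of_mem_erase hji)
  choose u hu1 hu0 using h
  refine ⟨u, fun i j x hx => ?_⟩
  split_ifs with hij
  · subst hij
    exact hu1 i x hx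
  · refine hu0 i x ?_
    rw [← SetLike.mem_coe, Closeds.coe_finset_sup, Finset.sup_eq_iSup]
    exact mem_iUnion.2 ⟨j, mem_iUnion.2
      ⟨Finset.mem_erase.2 ⟨fun h => hij h.symm, Finset.mem_univ j⟩, hx⟩⟩

/-- Cutoff functions that are 1 on one part and 0 on the others combine the elements `t j` without
leaving `T`. -/
theorem exists_mem_res_union_eq (Y : ClosedPartition X) (T : NonUnitalStarSubalgebra ℂ A)
    (hact : ∀ (f : C(X, ℂ)), ∀ a ∈ T, act f a ∈ T) (a : A)
    (h : ∀ j, ∃ t ∈ T, res A (Y.part j) t = res A (Y.part j) a) :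
    ∃ t ∈ T, res A Y.union t = res A Y.union a := by
  choose t htT ht using h
  obtain ⟨u, hu⟩ := exists_cutoff Y
  refine ⟨∑ i, act (u i) (t i), sum_mem fun i _ => hact _ _ (htT i),
    res_eq_iff_fibers.2 fun x hx => ?_⟩
  obtain ⟨j, hj⟩ := ClosedPartition.mem_union.1 hx
  rw [map_sum, ← res_eq_iff_fibers.1 (ht j) x hj]
  simp only [res_point_act, hu _ j x hj, ite_smul, one_smul, zero_smul]
  rw [Finset.sum_ite_eq' Finset.univ j, if_pos (Finset.mem_univ j)]

/-- Each `φ j` extends linearly over its part to continuous functions with values in `D j`. The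
parts are disjoint, so the extensions glue without further conditions. -/
theorem exists_elementary_hom (Y : ClosedPartition X) (D : Fin Y.r → Type u)
    [∀ j, NonUnitalCStarAlgebra (D j)]
    (φ : ∀ j, D j →⋆ₙₐ[ℂ] Restrict A (Y.part j))
    (T : NonUnitalStarSubalgebra ℂ A) (hT : IsClosed (T : Set A))
    (hact : ∀ (f : C(X, ℂ)), ∀ a ∈ T, act f a ∈ T)
    (hφ : ∀ j d, φ j d ∈ T.map (res A (Y.part j))) :
    ∃ ψ : (∀ j, C(Y.subPart j, D j)) →⋆ₙₐ[ℂ] Restrict A Y.union,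
      (∀ e, ∃ t ∈ T, res A Y.union t = ψ e) ∧
      ∀ e j x (hx : x ∈ Y.part j), resTo A (point_le (Y.part_le j hx)) (ψ e) =
        resTo A (point_le hx) (φ j (e j (Y.partMap j ⟨x, hx⟩))) := by
  have h1 := fun j => exists_sectionHom (φ j) (T.map (res A (Y.part j))) (isClosed_map _ _ hT)
    (fun f a ⟨t, ht, hta⟩ => ⟨act f t, hact f t ht, by
      rw [← hta]
      rfl⟩) (hφ j)
  choose Φ hΦT hΦ using h1
  obtain ⟨ψ, hψ⟩ := exists_glueHom Y.part
    (fun j => ((Φ j).comp (compHom (Y.partMap j))).comp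
      (Pi.evalNonUnitalStarAlgHom ℂ (fun j => C(Y.subPart j, D j)) j))
    (fun e i j x hi hj => by
      obtain rfl := Y.disjoint i j x hi hj
      rfl) Y.union Y.part_le fun x hx => ClosedPartition.mem_union.1 hx
  refine ⟨ψ, fun e => ?_, fun e j x hx => ?_⟩
  · obtain ⟨a, ha⟩ := res_surjective Y.union (ψ e)
    rw [← ha]
    refine exists_mem_res_union_eq Y T hact a fun j => ?_
    obtain ⟨t, htT, ht⟩ := hΦT j (compHom (Y.partMap j) (e j))
    refine ⟨t, htT, ht.trans ?_⟩
    rw [← resTo_res (Y.part_le j), ha, hψ]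
    rfl
  · have h2 := congrArg (resTo A (point_le hx)) (hψ e j)
    obtain ⟨a, ha⟩ := res_surjective Y.union (ψ e)
    rw [← ha, resTo_res, resTo_res] at h2
    rw [← ha, resTo_res, h2]
    exact hΦ j (compHom (Y.partMap j) (e j)) x hx

/-- The algebra is pulled back to `A` so that different levels can be intersected. The last clause
is witnessed by sections that are constant on each part. -/
theorem exists_elementaryPreimage (C : (D : Type u) → [NonUnitalCStarAlgebra D] → Prop)
    (Y : ClosedPartition X) (D : Fin Y.r → Type u)
    [∀ j, NonUnitalCStarAlgebra (D j)]
    (hC : ∀ j, C (D j)) (φ : ∀ j, D j →⋆ₙₐ[ℂ] Restrict A (Y.part j))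
    (hinj : ∀ j x (hx : x ∈ Y.part j), Function.Injective ((resTo A (point_le hx)).comp (φ j)))
    (T : NonUnitalStarSubalgebra ℂ A) (hT : IsClosed (T : Set A))
    (hact : ∀ (f : C(X, ℂ)), ∀ a ∈ T, act f a ∈ T)
    (hφ : ∀ j d, φ j d ∈ T.map (res A (Y.part j))) :
    ∃ S : NonUnitalStarSubalgebra ℂ A, IsClosed (S : Set A) ∧
      (∀ (f : C(X, ℂ)), ∀ a ∈ S, act f a ∈ S) ∧ IsElementaryPreimage.{u, v} C Y.union S ∧
      (∀ a ∈ S, ∃ t ∈ T, res A Y.union t = res A Y.union a) ∧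
      ∀ (d : ∀ j, D j) (a : A) (c : ℝ), 0 < c → (∀ j, ‖res A (Y.part j) a - φ j (d j)‖ < c) →
        ∃ s ∈ S, ‖res A Y.union a - res A Y.union s‖ < c := by
  obtain ⟨ψ, hψT, hψ⟩ := exists_elementary_hom Y D φ T hT hact hφ
  let _ : CXAlgebra Y.union (∀ j, C(Y.subPart j, D j)) := sumCXAlgebra Y.subPart D
  have hlin : ∀ (f : C(X, ℂ)) (e : ∀ j, C(Y.subPart j, D j)),
      ψ (act (resFun Y.union f) e) = act f (ψ e) := fun f e => by
    refine restrict_ext fun x hx => ?_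
    obtain ⟨j, hj⟩ := ClosedPartition.mem_union.1 hx
    rw [resTo_point_act hx, hψ _ j x hj, hψ _ j x hj, ← map_smul, ← map_smul]
    rfl
  have hmem : ∀ a, a ∈ (NonUnitalStarAlgHom.range ψ).comap (res A Y.union) ↔
      ∃ e, ψ e = res A Y.union a := fun a => by
    rw [NonUnitalStarSubalgebra.mem_comap, NonUnitalStarAlgHom.mem_range]
  have hcl : IsClosed ((NonUnitalStarAlgHom.range ψ).comap (res A Y.union) : Set A) := by
    rw [NonUnitalStarSubalgebra.coe_comap, NonUnitalStarAlgHom.coe_range]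
    exact (isClosed_range ψ).preimage (continuous_hom _)
  refine ⟨(NonUnitalStarAlgHom.range ψ).comap (res A Y.union), hcl,
    fun f a ha => ?_, ⟨_, inferInstance, inferInstance,
      ψ, ?_, ?_, hlin, hmem⟩, fun a ha => ?_, fun d a c hc h => ?_⟩
  · rw [hmem] at ha ⊢
    obtain ⟨e, he⟩ := ha
    exact ⟨act (resFun Y.union f) e, by rw [hlin, he, act_res]⟩
  · refine isElementary_sum Y.subPart D C Y.one_le (fun j => ?_) (fun i j hij => ?_) ?_ hC
    · obtain ⟨x, hx⟩ := Y.nonempty j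
      exact ⟨⟨x, Y.part_le j hx⟩, hx⟩
    · exact Set.disjoint_left.2 fun z hi hj => hij (Y.disjoint i j z hi hj)
    · refine eq_univ_of_forall fun z => ?_
      obtain ⟨j, hj⟩ := ClosedPartition.mem_union.1 z.2
      exact mem_iUnion.2 ⟨j, hj⟩
  · rw [injective_iff_map_eq_zero]
    intro e he
    ext j z
    refine (injective_iff_map_eq_zero _).1 (hinj j z.1 z.2) _ ?_
    have := hψ e j z.1 z.2
    rw [he, map_zero] at this
    exact this.symm
  · obtain ⟨e, he⟩ := (hmem a).1 ha
    rw [← he]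
    exact hψT e
  · let e : ∀ j, C(Y.subPart j, D j) := fun j => ContinuousMap.const _ (d j)
    obtain ⟨s, hs⟩ := res_surjective Y.union (ψ e)
    refine ⟨s, (hmem s).2 ⟨e, hs.symm⟩, ?_⟩
    rw [← map_sub]
    refine norm_res_finset_sup_lt Finset.univ Y.part (a - s) hc fun j _ => ?_
    have h1 : res A (Y.part j) s = φ j (d j) := by
      refine restrict_ext fun x hx => ?_
      have := hψ e j x hx
      rw [← hs, resTo_res] at this
      rw [resTo_res, this]
      rfl
    rw [map_sub, h1]
    exact h j

end Step

open CXAlgebra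

theorem IsElementaryPreimage.mem_of_res_eq {C : (D : Type u) → [NonUnitalCStarAlgebra D] → Prop}
    {X : Type v} [TopologicalSpace X] [CompactSpace X] {A : Type u} [NonUnitalCStarAlgebra A]
    [CXAlgebra X A] {Y : Closeds X} {S : NonUnitalStarSubalgebra ℂ A}
    (h : IsElementaryPreimage.{u, v} C Y S) {a b : A} (ha : a ∈ S) (hab : res A Y a = res A Y b) :
    b ∈ S := by
  obtain ⟨E, _, _, ψ, -, -, -, hS⟩ := h
  obtain ⟨e, he⟩ := (hS a).1 ha
  exact (hS b).2 ⟨e, he.trans hab⟩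

/-! ### Local approximation -/

section Local

variable {C : (D : Type u) → [NonUnitalCStarAlgebra D] → Prop}
  {X : Type v} [TopologicalSpace X] [CompactSpace X] [MetrizableSpace X]
  {A : Type u} [NonUnitalCStarAlgebra A] [SeparableSpace A] [CXAlgebra X A]

/-- A decreasing sequence of closed neighbourhoods of `x` has increasing vanishing ideals. By upper
semicontinuity their union is dense in the ideal of the point, which is the situation of the lifting
property. -/
theorem HasLifts.exists_lift_to_neighbourhood {D : Type u} [NonUnitalCStarAlgebra D]
    (hD : HasLifts D) (x : X) (φ : D →⋆ₙₐ[ℂ] Fiber A x) (F : Finset D) {ε : ℝ} (hε : 0 < ε) :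
    ∃ (V : Closeds X) (hx : x ∈ V) (ψ : D →⋆ₙₐ[ℂ] Restrict A V), (V : Set X) ∈ 𝓝 x ∧
      ∀ d ∈ F, ‖resTo A (point_le hx) (ψ d) - φ d‖ < ε := by
  obtain ⟨s, hs, hb⟩ := (closed_nhds_basis x).exists_antitone_subbasis
  let V : ℕ → Closeds X := fun n => ⟨s n, (hs n).2⟩
  have hxV : ∀ n, x ∈ V n := fun n => mem_of_mem_nhds (hs n).1
  obtain ⟨n, ψ, hψ⟩ := hD.lifts A (fun n => vanishingIdeal X A (V n))
    (fun n => vanishingIdeal_mono (hb.antitone n.le_succ)) (vanishingIdeal X A (point x))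
    (fun n => vanishingIdeal_mono (point_le (hxV n))) (by
      refine subset_antisymm (fun a ha => ?_) (closure_minimal (iUnion_subset fun n =>
        vanishingIdeal_mono (point_le (hxV n))) (ClosedIdeal.isClosed _))
      rw [Metric.mem_closure_iff]
      intro η hη
      obtain ⟨U, hU, hxU, hlt⟩ := exists_isOpen_norm_res_lt_of_res_eq_zero
        (res_eq_zero_iff.2 ha) hη
      obtain ⟨n, -, hn⟩ := hb.toHasBasis.mem_iff.1 (hU.mem_nhds hxU)
      obtain ⟨b, hab, hbη⟩ := exists_eq_norm_lt _ (hlt (V n) hn)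
      refine ⟨a - b, mem_iUnion.2 ⟨n, res_eq_zero_iff.1 ?_⟩, ?_⟩
      · rw [map_sub, hab, sub_self]
      · rwa [dist_eq_norm, sub_sub_cancel])
    φ F ε hε
  exact ⟨V n, hxV n, ψ, (hs n).1, hψ⟩

/-- The bound 1/2 on the witnesses `W` is a robust form of injectivity in every fiber: it survives
any perturbation of `φ` by less than 1/2 on `W`. -/
theorem exists_local_hom (hC : ∀ (D : Type u) [NonUnitalCStarAlgebra D], C D → IsSumOfSimpleWSP D)
    (hA : IsContinuousCX X A) (x : X) (hfib : AdmitsExhaustiveSequence C (Fiber A x))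
    (F : Finset A) {ε : ℝ} (hε : 0 < ε) :
    ∃ (D : Type u) (_ : NonUnitalCStarAlgebra D) (_ : C D) (V : Closeds X)
      (φ : D →⋆ₙₐ[ℂ] Restrict A V) (h : A → D) (W : Finset D), (V : Set X) ∈ 𝓝 x ∧
      (∀ a ∈ F, ‖res A V a - φ (h a)‖ < ε) ∧
      (∀ (B : Type u) [NonUnitalCStarAlgebra B] (f : D →⋆ₙₐ[ℂ] B), (∀ w ∈ W, f w ≠ 0) →
        Function.Injective f) ∧
      ∀ w ∈ W, ∀ y (hy : y ∈ V), 1 / 2 < ‖resTo A (point_le hy) (φ w)‖ := by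
  classical
  obtain ⟨B, hBc, hBC, hB⟩ := hfib
  obtain ⟨k, hk⟩ := hB (F.image (res A (point x))) (ε / 2) (half_pos hε)
  obtain ⟨D, iD, hCD, ⟨e⟩⟩ := hBC k
  let i : D →⋆ₙₐ[ℂ] Fiber A x := (incl (B k)).comp (e : D →⋆ₙₐ[ℂ] B k)
  have hi : Function.Injective i := fun a b hab => e.injective (Subtype.ext hab)
  have h1 : ∀ a, ∃ d, a ∈ F → ‖res A (point x) a - i d‖ < ε / 2 := by
    intro a
    by_cases ha : a ∈ F
    · obtain ⟨b, hb, hlt⟩ := hk _ (Finset.mem_image_of_mem _ ha)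
      refine ⟨e.symm ⟨b, hb⟩, fun _ => ?_⟩
      change ‖res A (point x) a - (e (e.symm ⟨b, hb⟩) : B k)‖ < ε / 2
      rwa [StarAlgEquiv.apply_symm_apply]
    · exact ⟨0, fun h => absurd h ha⟩
  choose h hh using h1
  obtain ⟨W, hW1, hWinj⟩ := (hC D hCD).exists_witnesses
  obtain ⟨V, hxV, ψ, hV, hψ⟩ := (hC D hCD).hasLifts.exists_lift_to_neighbourhood x i
    (F.image h ∪ W) (ε := min (ε / 2) (1 / 4)) (by positivity)
  choose q hq using fun d => res_surjective V (ψ d)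
  have hq' : ∀ d (Z : Closeds X) (hZ : Z ≤ V), resTo A hZ (ψ d) = res A Z (q d) := fun d Z hZ => by
    rw [← hq, resTo_res]
  have hF : ∀ a ∈ F, ∃ U : Set X, IsOpen U ∧ x ∈ U ∧
      ∀ Y : Closeds X, (Y : Set X) ⊆ U → ‖res A Y (a - q (h a))‖ < ε := by
    intro a ha
    refine exists_isOpen_norm_res_lt ?_
    have h2 := hψ (h a) (Finset.mem_union_left _ (Finset.mem_image_of_mem _ ha))
    have h3 := hh a ha
    rw [hq', norm_sub_rev] at h2
    rw [map_sub]
    have h4 := norm_sub_le_norm_sub_add_norm_sub (res A (point x) a) (i (h a))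
      (res A (point x) (q (h a)))
    linarith [min_le_left (ε / 2) (1 / 4)]
  choose! U hU hxU hUF using hF
  -- Here continuity of the field enters. At `x` the lifted witnesses have norm above 3/4, by the
  -- choice of 1/4, so the norm stays above 1/2 nearby.
  have hWU : ∀ w ∈ W, {y | 1 / 2 < ‖res A (point y) (q w)‖} ∈ 𝓝 x := by
    intro w hw
    refine (isOpen_lt continuous_const (hA (q w))).mem_nhds ?_
    have h2 := hψ w (Finset.mem_union_right _ hw)
    rw [hq', norm_sub_rev] at h2
    have h3 : ‖i w‖ = 1 := (NonUnitalStarAlgHom.norm_map i hi w).trans (hW1 w hw)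
    have h4 := norm_sub_norm_le (i w) (res A (point x) (q w))
    change 1 / 2 < ‖res A (point x) (q w)‖
    linarith [min_le_right (ε / 2) (1 / 4)]
  have hN : (V : Set X) ∩ ((⋂ a ∈ F, U a) ∩ ⋂ w ∈ W, {y | 1 / 2 < ‖res A (point y) (q w)‖}) ∈ 𝓝 x :=
    inter_mem hV (inter_mem
      ((Filter.biInter_finset_mem F).2 fun a ha => (hU a ha).mem_nhds (hxU a ha))
      ((Filter.biInter_finset_mem W).2 hWU))
  obtain ⟨K, hK, hKc, hKN⟩ := exists_mem_nhds_isClosed_subset hN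
  let K' : Closeds X := ⟨K, hKc⟩
  have hKV : K' ≤ V := fun y hy => (hKN hy).1
  refine ⟨D, iD, hCD, K', (resTo A hKV).comp ψ, h, W, hK, fun a ha => ?_, hWinj,
    fun w hw y hy => ?_⟩
  · rw [NonUnitalStarAlgHom.comp_apply, hq', ← map_sub]
    exact hUF a ha K' fun y hy => mem_iInter₂.1 (hKN hy).2.1 a ha
  · have h2 : 1 / 2 < ‖res A (point y) (q w)‖ := mem_iInter₂.1 (hKN hy).2.2 w hw
    rwa [NonUnitalStarAlgHom.comp_apply, hq', resTo_res]

end Local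

/-! ### Induction on the number of levels -/

section Levels

variable {C : (D : Type u) → [NonUnitalCStarAlgebra D] → Prop}
  {X : Type v} [TopologicalSpace X] [CompactSpace X] [MetrizableSpace X]
  {A : Type u} [NonUnitalCStarAlgebra A] [SeparableSpace A] [CXAlgebra X A]

/-- Each part of `Y` lies in a member of the family `U`. -/
def ClosedPartition.Subordinate {X : Type v} [TopologicalSpace X] (Y : ClosedPartition X)
    {ι : Type*} (U : ι → Set X) : Prop := ∀ j, ∃ k, (Y.part j : Set X) ⊆ U k

/-- The set `G`, the tolerance and the cover depend only on `F` and `ε`. They are thus available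
before the partition and the algebra `T` of the other levels. -/
theorem exists_level (C : (D : Type u) → [NonUnitalCStarAlgebra D] → Prop)
    (hC : ∀ (D : Type u) [NonUnitalCStarAlgebra D], C D → IsSumOfSimpleWSP D)
    (hA : IsContinuousCX X A) (hfib : ∀ x : X, AdmitsExhaustiveSequence C (Fiber A x))
    (F : Finset A) (ε : ℝ) (hε : 0 < ε) :
    ∃ (G : Finset A) (δ : ℝ) (κ : Type v) (_ : Finite κ) (U : κ → Set X), 0 < δ ∧
      (∀ k, IsOpen (U k)) ∧ (⋃ k, U k) = univ ∧
      ∀ Y : ClosedPartition X, Y.Subordinate U →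
      ∀ T : NonUnitalStarSubalgebra ℂ A, IsClosed (T : Set A) →
        (∀ (f : C(X, ℂ)), ∀ a ∈ T, act f a ∈ T) → (∀ g ∈ G, ∃ t ∈ T, ‖g - t‖ < δ) →
        ∃ S : NonUnitalStarSubalgebra ℂ A, IsClosed (S : Set A) ∧
          (∀ (f : C(X, ℂ)), ∀ a ∈ S, act f a ∈ S) ∧ IsElementaryPreimage.{u, v} C Y.union S ∧
          (∀ a ∈ S, ∃ t ∈ T, res A Y.union t = res A Y.union a) ∧
          ∀ a ∈ F, ∃ s ∈ S, ‖res A Y.union a - res A Y.union s‖ < ε := by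
  classical
  choose D iD hCD V φ h W hV hF hWinj hW using fun x =>
    exists_local_hom (C := C) hC hA x (hfib x) F (half_pos hε)
  -- The bound `ε / 2` is for approximating `F`; the bound 1/2 keeps the witnesses nonzero in each
  -- fiber after the perturbation.
  choose G δ hδ hG using fun x => (hC (D x) (hCD x)).hasLifts.exists_perturb
    ((F.image (h x)) ∪ W x) (min (ε / 2) (1 / 2)) (by positivity)
  choose l hl using fun x d => res_surjective (V x) (φ x d)
  obtain ⟨t, -, ht⟩ := isCompact_univ.elim_nhds_subcover (fun x => interior (V x : Set X))
    fun x _ => interior_mem_nhds.2 (hV x)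
  obtain ⟨δ₀, hδ₀, hδt⟩ : ∃ δ₀ > 0, ∀ x ∈ t, δ₀ ≤ δ x := by
    rcases t.eq_empty_or_nonempty with rfl | hne
    · exact ⟨1, one_pos, fun x hx => absurd hx (Finset.notMem_empty x)⟩
    · exact ⟨t.inf' hne δ, (Finset.lt_inf'_iff hne).2 fun x _ => hδ x,
        fun x hx => Finset.inf'_le δ hx⟩
  -- The sets `G x` lie in different algebras `D x`; they enter through lifts to `A` of their images
  -- under `φ x`.
  refine ⟨t.biUnion fun x => (G x).image (l x), δ₀, t, inferInstance,
    fun x => interior (V x : Set X), hδ₀, fun _ => isOpen_interior,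
    eq_univ_of_forall fun y => ?_, fun Y hY T hT hact hGT => ?_⟩
  · obtain ⟨x, hx⟩ := mem_iUnion.1 (ht (mem_univ y))
    obtain ⟨hxt, hyx⟩ := mem_iUnion.1 hx
    exact mem_iUnion.2 ⟨⟨x, hxt⟩, hyx⟩
  choose p hp using hY
  have hle : ∀ j, Y.part j ≤ V (p j) := fun j y hy => interior_subset (hp j hy)
  have hsep := fun j => quotient_separableSpace (vanishingIdeal X A (Y.part j))
  have hpert := fun j => hG (p j) (Restrict A (Y.part j)) (T.map (res A (Y.part j)))
    (isClosed_map _ _ hT) ((resTo A (hle j)).comp (φ (p j))) fun g hg => by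
      obtain ⟨b, hb, hlt⟩ := hGT (l (p j) g) (Finset.mem_biUnion.2
        ⟨p j, (p j).2, Finset.mem_image_of_mem _ hg⟩)
      refine ⟨res A (Y.part j) b, ⟨b, hb, rfl⟩, ?_⟩
      rw [NonUnitalStarAlgHom.comp_apply, ← hl, resTo_res]
      exact (norm_hom_sub_le _ _ _).trans_lt (hlt.trans_le (hδt _ (p j).2))
  choose ψ hψT hψ using hpert
  have hinj : ∀ j x (hx : x ∈ Y.part j),
      Function.Injective ((resTo A (point_le hx)).comp (ψ j)) := by
    intro j x hx
    refine hWinj _ _ _ fun w hw h0 => ?_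
    have h1 := hW (p j) w hw x (hle j hx)
    have h2 := hψ j w (Finset.mem_union_right _ hw)
    have h3 := norm_hom_sub_le (resTo A (point_le hx)) (ψ j w) ((resTo A (hle j)).comp (φ (p j)) w)
    rw [NonUnitalStarAlgHom.comp_apply] at h0
    rw [h0, zero_sub, norm_neg, NonUnitalStarAlgHom.comp_apply, ← hl, resTo_res, resTo_res] at h3
    rw [← hl, resTo_res] at h1
    rw [NonUnitalStarAlgHom.comp_apply, ← hl, resTo_res] at h2
    linarith [min_le_right (ε / 2) (1 / 2)]
  obtain ⟨S, hS, hSact, hSE, hST, hSF⟩ := exists_elementaryPreimage C Y (fun j => D (p j))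
    (fun j => hCD _) ψ hinj T hT hact hψT
  refine ⟨S, hS, hSact, hSE, hST, fun a ha => hSF (fun j => h (p j) a) a ε hε fun j => ?_⟩
  have h1 := hψ j (h (p j) a) (Finset.mem_union_left _ (Finset.mem_image_of_mem _ ha))
  have h2 := norm_hom_sub_le (resTo A (hle j)) (res A (V (p j)) a) (φ (p j) (h (p j) a))
  have h3 := hF (p j) a ha
  rw [NonUnitalStarAlgHom.comp_apply, norm_sub_rev] at h1
  rw [resTo_res] at h2
  have h4 := norm_sub_le_norm_sub_add_norm_sub (res A (Y.part j) a)
    (resTo A (hle j) (φ (p j) (h (p j) a))) (ψ j (h (p j) a))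
  linarith [min_le_left (ε / 2) (1 / 2)]

/-- Level 0 states its demands first and is built last. Its set `G` and tolerance `δ` are added to
the goals of the remaining levels, whose intersection `T` then almost contains `G`, so level 0 can
be perturbed into `T` and is contained in all later levels over its own closed set. -/
theorem exists_levels (hC : ∀ (D : Type u) [NonUnitalCStarAlgebra D], C D → IsSumOfSimpleWSP D)
    (hA : IsContinuousCX X A) (hfib : ∀ x : X, AdmitsExhaustiveSequence C (Fiber A x)) (N : ℕ) :
    ∀ (F : Finset A) (ε : ℝ), 0 < ε →
    ∃ (κ : Type v) (_ : Finite κ) (U : κ → Set X), (∀ k, IsOpen (U k)) ∧ (⋃ k, U k) = univ ∧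
      ∀ Y : Fin N → ClosedPartition X, (∀ i, (Y i).Subordinate U) →
      ∃ S : Fin N → NonUnitalStarSubalgebra ℂ A, (∀ i, IsClosed (S i : Set A)) ∧
        (∀ i (f : C(X, ℂ)), ∀ a ∈ S i, act f a ∈ S i) ∧
        (∀ i, IsElementaryPreimage.{u, v} C (Y i).union (S i)) ∧
        (∀ i j, i < j → ∀ a ∈ S i, ∃ b ∈ S j, res A (Y i).union b = res A (Y i).union a) ∧
        ∀ a ∈ F, ∃ t, (∀ i, t ∈ S i) ∧ ‖a - t‖ < ε := by
  classical
  induction N with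
  | zero =>
    intro F ε hε
    refine ⟨PUnit, inferInstance, fun _ => univ, fun _ => isOpen_univ, iUnion_const _,
      fun Y _ => ⟨fun i => i.elim0, fun i => i.elim0, fun i => i.elim0, fun i => i.elim0,
        fun i => i.elim0, fun a _ => ⟨a, fun i => i.elim0, ?_⟩⟩⟩
    rwa [sub_self, norm_zero]
  | succ N ih =>
    intro F ε hε
    obtain ⟨G, δ, κ, _, U, hδ, hU, hUcov, hlevel⟩ :=
      exists_level C hC hA hfib F (ε / 2) (half_pos hε)
    -- In `exists_mem_inf_norm_lt` twice `ε / 4` plus the `ε / 2` of level 0 makes `ε`.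
    obtain ⟨κ', _, U', hU', hUcov', hlevels⟩ := ih (F ∪ G) (min (ε / 4) δ) (by positivity)
    refine ⟨κ × κ', inferInstance, fun k => U k.1 ∩ U' k.2, fun k => (hU _).inter (hU' _),
      eq_univ_of_forall fun x => ?_, fun Y hY => ?_⟩
    · obtain ⟨k, hk⟩ := mem_iUnion.1 (hUcov ▸ mem_univ x : x ∈ ⋃ k, U k)
      obtain ⟨k', hk'⟩ := mem_iUnion.1 (hUcov' ▸ mem_univ x : x ∈ ⋃ k, U' k)
      exact mem_iUnion.2 ⟨(k, k'), hk, hk'⟩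
    obtain ⟨S', hS'c, hS'act, hS'E, hS'lt, hS'F⟩ := hlevels (fun i => Y i.succ) fun i j => by
      obtain ⟨k, hk⟩ := hY i.succ j
      exact ⟨k.2, hk.trans inter_subset_right⟩
    -- When there are no further levels this infimum is all of `A`.
    let T : NonUnitalStarSubalgebra ℂ A := ⨅ i, S' i
    have hTmem : ∀ a, a ∈ T ↔ ∀ i, a ∈ S' i := fun a => NonUnitalStarAlgebra.mem_iInf
    have hT : IsClosed (T : Set A) := by
      rw [NonUnitalStarAlgebra.coe_iInf]
      exact isClosed_iInter hS'c
    have hTact : ∀ (f : C(X, ℂ)), ∀ a ∈ T, act f a ∈ T := fun f a ha =>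
      (hTmem _).2 fun i => hS'act i f a ((hTmem a).1 ha i)
    obtain ⟨S, hS, hSact, hSE, hST, hSF⟩ := hlevel (Y 0) (fun j => by
      obtain ⟨k, hk⟩ := hY 0 j
      exact ⟨k.1, hk.trans inter_subset_left⟩) T hT hTact fun g hg => by
        obtain ⟨t, ht, hlt⟩ := hS'F g (Finset.mem_union_right _ hg)
        exact ⟨t, (hTmem t).2 ht, hlt.trans_le (min_le_right _ _)⟩
    refine ⟨Fin.cons S S', fun i => ?_, fun i => ?_, fun i => ?_, fun i j hij => ?_,
      fun a ha => ?_⟩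
    · refine Fin.cases ?_ (fun i => ?_) i
      · exact hS
      · exact hS'c i
    · refine Fin.cases ?_ (fun i => ?_) i
      · exact hSact
      · exact hS'act i
    · refine Fin.cases ?_ (fun i => ?_) i
      · exact hSE
      · exact hS'E i
    · obtain ⟨j, rfl⟩ := Fin.exists_succ_eq.2 (Fin.ne_zero_of_lt hij)
      revert hij
      refine Fin.cases ?_ (fun i => ?_) i
      · intro _ a ha
        obtain ⟨t, ht, hta⟩ := hST a ha
        exact ⟨t, (hTmem t).1 ht j, hta⟩
      · intro hij
        exact hS'lt i j (Fin.succ_lt_succ_iff.1 hij)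
    · obtain ⟨t, ht, hlt⟩ := hS'F a (Finset.mem_union_left _ ha)
      obtain ⟨s, hs, hslt⟩ := hSF a ha
      obtain ⟨b, hbS, hbT, hb⟩ := exists_mem_inf_norm_lt (Y 0).union hT
        (fun _ _ => hSE.mem_of_res_eq) hST ((hTmem t).2 ht) hs
        (hlt.trans_le (min_le_left _ _)) hslt
      refine ⟨b, fun i => ?_, hb.trans_eq (by ring)⟩
      refine Fin.cases ?_ (fun i => ?_) i
      · exact hbS
      · exact (hTmem b).1 hbT i

end Levels

open CXAlgebra

/-! ### Covering dimension -/

theorem exists_hasCoveringDimLE {X : Type v} [TopologicalSpace X] [Nonempty X]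
    (h : coveringDim X < ⊤) :
    ∃ n : ℕ, HasCoveringDimLE X n ∧ ((n : ℕ∞) : WithBot ℕ∞) ≤ coveringDim X := by
  classical
  rw [coveringDim, if_neg (not_isEmpty_iff.2 ‹_›)] at h ⊢
  have hex : ∃ n, HasCoveringDimLE X n := by
    by_contra hne
    push Not at hne
    refine h.ne ?_
    simp [hne]
  refine ⟨Nat.find hex, Nat.find_spec hex, ?_⟩
  rw [WithBot.coe_le_coe]
  exact le_iInf₂ fun m hm => Nat.cast_le.2 (Nat.find_min' hex hm)

theorem ClosedPartition.exists_of_finite {X : Type v} [TopologicalSpace X] {ι : Type*} [Finite ι]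
    (K : ι → Closeds X) (hd : ∀ i j, ∀ x ∈ K i, x ∈ K j → i = j)
    (hne : ∃ i, (K i : Set X).Nonempty) :
    ∃ Y : ClosedPartition X, (∀ j, ∃ i, Y.part j = K i) ∧ ∀ i, ∀ x ∈ K i, x ∈ Y.union := by
  obtain ⟨r, ⟨e⟩⟩ := Finite.exists_equiv_fin {i // (K i : Set X).Nonempty}
  obtain ⟨i₀, hi₀⟩ := hne
  refine ⟨⟨r, Nat.one_le_iff_ne_zero.2 ?_, fun j => K (e.symm j).1, fun j => (e.symm j).2,
    fun i j x hi hj => e.symm.injective (Subtype.ext (hd _ _ x hi hj))⟩, fun j => ⟨_, rfl⟩,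
    fun i x hx => mem_union.2 ⟨e ⟨i, x, hx⟩, ?_⟩⟩
  · rintro rfl
    exact (e ⟨i₀, hi₀⟩).elim0
  · change x ∈ K (e.symm (e ⟨i, x, hx⟩)).1
    rwa [e.symm_apply_apply]

/-- In dimension at most `n`, every finite open cover has a finite closed refinement whose members
are sorted into `n + 1` pairwise disjoint families. -/
theorem HasCoveringDimLE.exists_closed_refinement {X : Type v} [TopologicalSpace X]
    [CompactSpace X] [T2Space X] {n : ℕ} (h : HasCoveringDimLE X n) {κ : Type*} [Finite κ]
    {U : κ → Set X} (hU : ∀ k, IsOpen (U k)) (hcov : (⋃ k, U k) = univ) :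
    ∃ (ι : Type) (_ : Finite ι) (K : ι → Closeds X) (col : ι → Fin (n + 1)),
      (∀ i, ∃ k, (K i : Set X) ⊆ U k) ∧ (∀ x, ∃ i, x ∈ K i) ∧
      ∀ i j, col i = col j → ∀ x ∈ K i, x ∈ K j → i = j := by
  classical
  obtain ⟨m, ⟨e⟩⟩ := Finite.exists_equiv_fin κ
  obtain ⟨k, V, hV, hVcov, hVU, hord⟩ := h m (fun i => U (e.symm i)) (fun i => hU _)
    (by rw [← hcov]; exact e.symm.surjective.iUnion_comp U)
  obtain ⟨f, hf⟩ := PartitionOfUnity.exists_isSubordinate isClosed_univ V hV hVcov.ge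
  have hfV : ∀ j x, 0 < f j x → x ∈ V j := fun j x hx =>
    hf j (subset_tsupport _ hx.ne')
  -- As in a barycentric subdivision, `W T` consists of the points where the functions indexed by
  -- `T` are positive and exceed all others. Distinct index sets of equal cardinality give disjoint
  -- sets, so `T.card - 1` serves as a colour between 0 and `n`.
  let ι := {T : Finset (Fin k) // T.Nonempty ∧ T.card < n + 2}
  let W : ι → Set X := fun T =>
    (⋂ j ∈ T.1, {x | 0 < f j x}) ∩ ⋂ j ∈ T.1, ⋂ l ∈ (T.1)ᶜ, {x | f l x < f j x}
  have hW : ∀ T, IsOpen (W T) := fun T =>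
    (isOpen_biInter_finset fun j _ => isOpen_lt continuous_const (f j).continuous).inter
      (isOpen_biInter_finset fun j _ => isOpen_biInter_finset fun l _ =>
        isOpen_lt (f l).continuous (f j).continuous)
  have hWmem : ∀ T x, x ∈ W T ↔ (∀ j ∈ T.1, 0 < f j x) ∧ ∀ j ∈ T.1, ∀ l ∉ T.1, f l x < f j x := by
    intro T x
    simp [W]
  have hWcov : (⋃ T, W T) = univ := by
    refine eq_univ_of_forall fun x => mem_iUnion.2 ?_
    obtain ⟨j, hj⟩ := f.exists_pos (mem_univ x)
    -- All functions positive at `x`; there are at most `n + 1` of them by the order of the cover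
    -- `V`.
    let T : Finset (Fin k) := Finset.univ.filter fun j => 0 < f j x
    have hT : ∀ j, j ∈ T ↔ 0 < f j x := fun j => by simp [T]
    have hcard : T.card ≤ n + 1 := by
      refine le_trans ?_ (hord x)
      rw [← Set.ncard_coe_finset]
      exact Set.ncard_le_ncard (fun j hj => hfV j x ((hT j).1 hj)) (Set.toFinite _)
    refine ⟨⟨T, ⟨j, (hT j).2 hj⟩, by omega⟩, (hWmem _ _).2 ⟨fun j hj => (hT j).1 hj,
      fun j hj l hl => ?_⟩⟩
    exact (not_lt.1 fun h => hl ((hT l).2 h)).trans_lt ((hT j).1 hj)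
  obtain ⟨K, hKcov, hK, hKW⟩ := exists_iUnion_eq_closed_subset hW (fun _ => Set.toFinite _) hWcov
  refine ⟨ι, inferInstance, fun T => ⟨K T, hK T⟩, fun T => ⟨T.1.card - 1, by
    have := T.2.2
    omega⟩, fun T => ?_, fun x => mem_iUnion.1 (hKcov ▸ mem_univ x), fun S T hST x hxS hxT => ?_⟩
  · obtain ⟨j, hj⟩ := T.2.1
    obtain ⟨i, hi⟩ := hVU j
    exact ⟨_, fun x hx => hi (hfV j x (((hWmem T x).1 (hKW T hx)).1 j hj))⟩
  · have hcard : S.1.card = T.1.card := by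
      have h1 := S.2.1.card_pos
      have h2 := T.2.1.card_pos
      have h3 := Fin.mk.inj hST
      omega
    have hS := ((hWmem S x).1 (hKW S hxS)).2
    have hT := ((hWmem T x).1 (hKW T hxT)).2
    refine Subtype.ext (Finset.eq_of_subset_of_card_le (fun j hj => ?_) hcard.ge)
    by_contra hjT
    obtain ⟨l, hlT, hlS⟩ : ∃ l ∈ T.1, l ∉ S.1 := by
      by_contra hne
      push Not at hne
      exact hjT (Finset.eq_of_subset_of_card_le hne hcard.le ▸ hj)
    exact lt_asymm (hS j hj l hlS) (hT l hlT j hjT)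

theorem HasCoveringDimLE.exists_closedPartitions {X : Type v} [TopologicalSpace X] [CompactSpace X]
    [T2Space X] [Nonempty X] {n : ℕ} (h : HasCoveringDimLE X n) {κ : Type*} [Finite κ]
    {U : κ → Set X} (hU : ∀ k, IsOpen (U k)) (hcov : (⋃ k, U k) = univ) :
    ∃ Y : Fin (n + 1) → ClosedPartition X, (∀ i, (Y i).Subordinate U) ∧
      ∀ x, ∃ i, x ∈ (Y i).union := by
  obtain ⟨ι, _, K, col, hKU, hKcov, hKd⟩ := h.exists_closed_refinement hU hcov
  have key : ∀ c : Fin (n + 1), (∃ i, col i = c ∧ (K i : Set X).Nonempty) →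
      ∃ Y : ClosedPartition X, Y.Subordinate U ∧ ∀ i, col i = c → ∀ x ∈ K i, x ∈ Y.union := by
    rintro c ⟨i, hi, hne⟩
    obtain ⟨Y, hY, hYu⟩ := ClosedPartition.exists_of_finite (fun i : {i // col i = c} => K i)
      (fun i j x hxi hxj => Subtype.ext (hKd i j (i.2.trans j.2.symm) x hxi hxj)) ⟨⟨i, hi⟩, hne⟩
    refine ⟨Y, fun j => ?_, fun i hi => hYu ⟨i, hi⟩⟩
    obtain ⟨i, hi⟩ := hY j
    rw [hi]
    exact hKU i
  have key' : ∀ c, ∃ Y : ClosedPartition X, Y.Subordinate U ∧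
      ∀ i, col i = c → ∀ x ∈ K i, x ∈ Y.union := by
    intro c
    -- A colour with no nonempty member borrows the partition of a colour that has one, since every
    -- level needs a nonempty part.
    by_cases hc : ∃ i, col i = c ∧ (K i : Set X).Nonempty
    · exact key c hc
    · obtain ⟨i, hi⟩ := hKcov (Classical.arbitrary X)
      obtain ⟨Y, hY, -⟩ := key (col i) ⟨i, rfl, _, hi⟩
      exact ⟨Y, hY, fun i hi x hx => absurd ⟨i, hi, x, hx⟩ hc⟩
  choose Y hY hYu using key'
  refine ⟨Y, hY, fun x => ?_⟩
  obtain ⟨i, hi⟩ := hKcov x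
  exact ⟨col i, hYu _ i rfl x hi⟩

/-! ### Induced maps -/

section Induced

variable {C : (D : Type u) → [NonUnitalCStarAlgebra D] → Prop}
  {X : Type v} [TopologicalSpace X] [CompactSpace X]
  {A : Type u} [NonUnitalCStarAlgebra A] [CXAlgebra X A] {n : ℕ}

namespace FiberedMono

theorem exists_mem_Y (Ψ : FiberedMono.{u, v} C X A n) (x : X) : ∃ i, x ∈ Ψ.Y i :=
  mem_iUnion.1 (Ψ.cover ▸ mem_univ x : x ∈ ⋃ i, (Ψ.Y i : Set X))

variable [T2Space X]

theorem exists_isInducedMono (Ψ : FiberedMono.{u, v} C X A n) :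
    ∃ η : Ψ.fiberedProduct →⋆ₙₐ[ℂ] A, Ψ.IsInducedMono η := by
  let ev : ∀ i, Ψ.fiberedProduct →⋆ₙₐ[ℂ] Ψ.E i := fun i =>
    { toFun := fun d => (d : ∀ i, Ψ.E i) i
      map_smul' := fun _ _ => rfl
      map_zero' := rfl
      map_add' := fun _ _ => rfl
      map_mul' := fun _ _ => rfl
      map_star' := fun _ => rfl }
  have hev : ∀ i d, ((Ψ.ψ i).comp (ev i)) d = Ψ.ψ i ((d : ∀ i, Ψ.E i) i) := fun _ _ => rfl
  obtain ⟨η, hη⟩ := exists_glueHom_univ Ψ.Y (fun i => (Ψ.ψ i).comp (ev i))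
    (fun d i j x hi hj => by
      have h := d.2 i j
      have hx : x ∈ Ψ.Y i ⊓ Ψ.Y j := ⟨hi, hj⟩
      rw [hev, hev]
      obtain ⟨a, ha⟩ := res_surjective _ (Ψ.ψ i ((d : ∀ i, Ψ.E i) i))
      obtain ⟨b, hb⟩ := res_surjective _ (Ψ.ψ j ((d : ∀ i, Ψ.E i) j))
      rw [← ha, ← hb, resTo_res, resTo_res] at h
      rw [← ha, ← hb, resTo_res, resTo_res, ← resTo_res (point_le hx) a, h, resTo_res])
    Ψ.exists_mem_Y
  refine ⟨η, fun d i => (hη d i).trans (hev i d), ?_, fun f d d' h => ?_⟩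
  · rw [injective_iff_map_eq_zero]
    intro d hd
    refine Subtype.ext (funext fun i => Ψ.injective i ?_)
    rw [← hev, ← hη, hd, map_zero]
    exact (map_zero (Ψ.ψ i)).symm
  · refine eq_of_fibers (X := X) fun x => ?_
    obtain ⟨i, hi⟩ := Ψ.exists_mem_Y x
    rw [← resTo_res (point_le hi), ← resTo_res (point_le hi) (act f _), hη, hev, h, Ψ.linear,
      ← act_res, hη, hev]

/-- Restrictions of a single element agree on overlaps, so the range of `η` contains every element
whose restriction to each `Y i` comes from `E i`. -/
theorem IsInducedMono.exists_apply_eq {Ψ : FiberedMono.{u, v} C X A n}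
    {η : Ψ.fiberedProduct →⋆ₙₐ[ℂ] A} (hη : Ψ.IsInducedMono η) {a : A}
    (ha : ∀ i, ∃ e, Ψ.ψ i e = res A (Ψ.Y i) a) : ∃ d, η d = a := by
  choose e he using ha
  refine ⟨⟨e, fun i j => by rw [he, he, resTo_res, resTo_res]⟩, eq_of_fibers (X := X) fun x => ?_⟩
  obtain ⟨i, hi⟩ := Ψ.exists_mem_Y x
  rw [← resTo_res (point_le hi), hη.res_eq, he, resTo_res]

end FiberedMono

end Induced

/-! ### Assembly of the fibered monomorphism -/

theorem exists_fiberedMono {C : (D : Type u) → [NonUnitalCStarAlgebra D] → Prop}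
    (hC : ∀ (D : Type u) [NonUnitalCStarAlgebra D], C D → IsSumOfSimpleWSP D)
    {X : Type v} [TopologicalSpace X] [CompactSpace X] [MetrizableSpace X] [Nonempty X]
    {A : Type u} [NonUnitalCStarAlgebra A] [SeparableSpace A] [CXAlgebra X A]
    (hA : IsContinuousCX X A) (hfib : ∀ x : X, AdmitsExhaustiveSequence C (Fiber A x))
    {n : ℕ} (hn : HasCoveringDimLE X n) (F : Finset A) {ε : ℝ} (hε : 0 < ε) :
    ∃ (Ψ : FiberedMono.{u, v} C X A n) (η : Ψ.fiberedProduct →⋆ₙₐ[ℂ] A),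
      Ψ.IsInducedMono η ∧ ∀ a ∈ F, ∃ d : Ψ.fiberedProduct, ‖a - η d‖ < ε := by
  obtain ⟨κ, _, U, hU, hUcov, hlev⟩ := exists_levels hC hA hfib (n + 1) F ε hε
  obtain ⟨Y, hYU, hYcov⟩ := hn.exists_closedPartitions hU hUcov
  obtain ⟨S, -, -, hSE, hSlt, hSF⟩ := hlev Y hYU
  choose E iE cE ψ hel hinj hlin hS using hSE
  let Ψ : FiberedMono.{u, v} C X A n :=
    { Y := fun i => (Y i).union
      cover := eq_univ_of_forall fun x => mem_iUnion.2 (hYcov x)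
      E := E
      elementary := hel
      ψ := ψ
      injective := hinj
      linear := hlin
      containment := fun i j hij e => by
        rcases hij.eq_or_lt with rfl | hij
        · exact ⟨e, rfl⟩
        obtain ⟨a, ha⟩ := res_surjective _ (ψ i e)
        obtain ⟨b, hb, hab⟩ := hSlt i j hij a ((hS i a).2 ⟨e, ha.symm⟩)
        obtain ⟨e', he'⟩ := (hS j b).1 hb
        refine ⟨e', ?_⟩
        rw [← ha, ← hab, he', resTo_res, resTo_res] }
  obtain ⟨η, hη⟩ := Ψ.exists_isInducedMono
  refine ⟨Ψ, η, hη, fun a ha => ?_⟩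
  obtain ⟨t, ht, hlt⟩ := hSF a ha
  obtain ⟨d, rfl⟩ := hη.exists_apply_eq fun i => (hS i t).1 (ht i)
  exact ⟨d, hlt⟩

end CStarBundle

end

theorem mainTheorem6
    (C : (D : Type u) → [NonUnitalCStarAlgebra D] → Prop)
    (hC : ∀ (D : Type u) [NonUnitalCStarAlgebra D], C D → CStarBundle.IsSumOfSimpleWSP D)
    (X : Type v) [TopologicalSpace X] [CompactSpace X] [TopologicalSpace.MetrizableSpace X]
    [Nonempty X] (hX : CStarBundle.coveringDim X < ⊤)
    (A : Type u) [NonUnitalCStarAlgebra A] [TopologicalSpace.SeparableSpace A]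
    [CStarBundle.CXAlgebra X A] (hA : CStarBundle.IsContinuousCX X A)
    (hfib : ∀ x : X, CStarBundle.AdmitsExhaustiveSequence C (CStarBundle.Fiber A x))
    (F : Finset A) (ε : ℝ) (hε : 0 < ε) :
    ∃ (n : ℕ) (_ : ((n : ℕ∞) : WithBot ℕ∞) ≤ CStarBundle.coveringDim X)
      (Ψ : CStarBundle.FiberedMono.{u, v} C X A n) (η : Ψ.fiberedProduct →⋆ₙₐ[ℂ] A),
      Ψ.IsInducedMono η ∧ ∀ a ∈ F, ∃ d : Ψ.fiberedProduct, ‖a - η d‖ < ε := by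
  obtain ⟨n, hn, hle⟩ := CStarBundle.exists_hasCoveringDimLE hX
  exact ⟨n, hle, CStarBundle.exists_fiberedMono hC hA hfib hn F hε⟩
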